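/- Let $\mathfrak n=\mathfrak v\oplus\mathfrak z$ be an H-type Lie algebra: $\mathfrak v,\mathfrak z$ are finite-dimensional real inner product spaces, $\mathfrak n$ is their orthogonal direct sum, the bracket of $\mathfrak n$ is non-zero and is given by an alternating bilinear map $[\cdot,\cdot]:\mathfrak v\times\mathfrak v\to\mathfrak z$ (with $\mathfrak z$ central), and the maps $J_Z:\mathfrak v\to\mathfrak v$ defined by $\langle J_ZX,Y\rangle=\langle[X,Y],Z\rangle$ satisfy $J_Z^2=-|Z|^2 I_{\mathfrak v}$ for all $Z\in\mathfrak z$. Put $\dim\mathfrak v=2m$, $\dim\mathfrak z=k$, $Q=m+k$. Let $N=\mathfrak v\times\mathfrak z$ be the corresponding H-type group, with product $(X,Z)(X_1,Z_1)=(X+X_1,\,Z+Z_1+\tfrac12[X,X_1])$ and Haar measure $dn=dX\,dZ$. Let $R=L^1(N)^\natural$ be the convolution algebra of integrable complex functions on $N$ that are biradial, i.e. of the form $f(X,Z)=f_0(|X|,|Z|)$, and let $m(R)$ (its Gelfand spectrum) be the set of all non-zero linear functionals $\psi:R\to\mathbb C$ with $\psi(f*g)=\psi(f)\psi(g)$ for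 $f,g\in R$. For $a>0$ let $$P_a(X,Z)=\frac{C\,a^{Q}}{\left(\left(a+\frac{|X|^2}{4}\right)^2+|Z|^2\right)^{Q}}\in R$$ be the Poisson kernel, where the constant $C>0$ is chosen such that $\|P_a\|_1=1$. Then for every $a>0$ the Gelfand transform of $P_a$ never vanishes: $\psi(P_a)\neq0$ for every $\psi\in m(R)$. Moreover, in terms of the bounded spherical functions, $$\hat P_a(\nu,l)=\int_N P_a\,\phi_{\nu,l}\,dn\neq0\quad(\nu>0,\ l\in\{0,1,2,\dots\}),\qquad \hat P_a(0,\mu)=\int_N P_a\,\phi_\mu\,dn\neq0\quad(\mu\ge0),$$ where $$\phi_{\nu,l}(X,Z)=e^{-\frac14\nu|X|^2}\,\frac{L^{m-1}_l(\frac12\nu|X|^2)}{\binom{l+m-1}{l}}\,\mathscr J_{\frac{k-2}{2}}(\nu|Z|),\qquad \phi_\mu(X,Z)=\mathscr J_{m-1}(\mu|X|),$$ $L^{\alpha}_l(x)=\sum_{j=0}^{l}\binom{l+\alpha}{l-j}\frac{(-x)^j}{j!}$, $\mathscr J_{-1/2}(x)=\cos x$, and $\mathscr J_r(x)=\frac{\Gamma(r+1)}{\Gamma(r+\frac12)\Gamma(\frac12)}\int_{-1}^1e^{ixs}(1-s^2)^{r-\frac12}\,ds$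 for $r>-\tfrac12$. -/

import Mathlib

open MeasureTheory

noncomputable section

/-- The map `J_Z` attached to a bracket `B : 𝔳 × 𝔳 → 𝔷`: it is determined by
`⟪J_Z X, Y⟫ = ⟪B X Y, Z⟫` for all `X, Y ∈ 𝔳` (see `inner_JMap`), i.e. `J_Z X = (B X)* Z`. -/
def JMap {v z : Type*} [NormedAddCommGroup v] [InnerProductSpace ℝ v] [FiniteDimensional ℝ v]
    [NormedAddCommGroup z] [InnerProductSpace ℝ z] [FiniteDimensional ℝ z]
    (B : v →ₗ[ℝ] v →ₗ[ℝ] z) (Z : z) (X : v) : v :=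
  LinearMap.adjoint (B X) Z

theorem inner_JMap {v z : Type*} [NormedAddCommGroup v] [InnerProductSpace ℝ v]
    [FiniteDimensional ℝ v] [NormedAddCommGroup z] [InnerProductSpace ℝ z]
    [FiniteDimensional ℝ z] (B : v →ₗ[ℝ] v →ₗ[ℝ] z) (Z : z) (X Y : v) :
    inner ℝ (JMap B Z X) Y = inner ℝ (B X Y) Z := by
  unfold JMap
  rw [LinearMap.adjoint_inner_left, real_inner_comm]

/-- An H-type Lie algebra `𝔫 = 𝔳 ⊕ 𝔷` (orthogonal direct sum of finite-dimensional real inner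
product spaces), with bracket `[(X, Z), (X', Z')] = (0, bracket X X')`. Every such bracket
satisfies the Jacobi identity and makes `𝔫` two-step nilpotent; `nonabelian` says that it is not
abelian. As then `𝔷 ≠ 0`, `J_sq` forces `𝔷` to be the whole centre and `dim 𝔳` to be even. -/
structure HTypeAlgebra (v z : Type*) [NormedAddCommGroup v] [InnerProductSpace ℝ v]
    [FiniteDimensional ℝ v] [NormedAddCommGroup z] [InnerProductSpace ℝ z]
    [FiniteDimensional ℝ z] where
  bracket : v →ₗ[ℝ] v →ₗ[ℝ] z
  bracket_self : ∀ X, bracket X X = 0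
  nonabelian : ∃ X Y, bracket X Y ≠ 0
  J_sq : ∀ (Z : z) (X : v), JMap bracket Z (JMap bracket Z X) = -(‖Z‖ ^ 2) • X

/-- The H-type group `N`: the connected, simply connected group with Lie algebra `𝔫`, identified
with `𝔳 × 𝔷` through the exponential map. Elements are written `(X, Z) = (n.1, n.2)`. -/
def HTypeGroup {v z : Type*} [NormedAddCommGroup v] [InnerProductSpace ℝ v]
    [FiniteDimensional ℝ v] [NormedAddCommGroup z] [InnerProductSpace ℝ z]
    [FiniteDimensional ℝ z] (_H : HTypeAlgebra v z) : Type _ :=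
  v × z

namespace HTypeGroup

section Group

variable {v z : Type*} [NormedAddCommGroup v] [InnerProductSpace ℝ v]
  [FiniteDimensional ℝ v] [NormedAddCommGroup z] [InnerProductSpace ℝ z]
  [FiniteDimensional ℝ z] (H : HTypeAlgebra v z)

/-- `(X, Z) (X₁, Z₁) = (X + X₁, Z + Z₁ + [X, X₁] / 2)`. -/
instance : Mul (HTypeGroup H) :=
  ⟨fun n n₁ => (n.1 + n₁.1, n.2 + n₁.2 + (1 / 2 : ℝ) • H.bracket n.1 n₁.1)⟩

instance : One (HTypeGroup H) := ⟨((0 : v), (0 : z))⟩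

instance : Inv (HTypeGroup H) := ⟨fun n => (-n.1, -n.2)⟩

instance : Group (HTypeGroup H) :=
  Group.ofLeftAxioms
    (fun a b c => Prod.ext
      (show (a.1 + b.1) + c.1 = a.1 + (b.1 + c.1) from add_assoc _ _ _)
      (show (a.2 + b.2 + (1 / 2 : ℝ) • H.bracket a.1 b.1) + c.2
          + (1 / 2 : ℝ) • H.bracket (a.1 + b.1) c.1
          = a.2 + (b.2 + c.2 + (1 / 2 : ℝ) • H.bracket b.1 c.1)
          + (1 / 2 : ℝ) • H.bracket a.1 (b.1 + c.1) by
        simp only [map_add, LinearMap.add_apply, smul_add]; abel))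
    (fun a => Prod.ext
      (show (0 : v) + a.1 = a.1 from zero_add _)
      (show (0 : z) + a.2 + (1 / 2 : ℝ) • H.bracket 0 a.1 = a.2 by simp))
    (fun a => Prod.ext
      (show -a.1 + a.1 = 0 from neg_add_cancel _)
      (show -a.2 + a.2 + (1 / 2 : ℝ) • H.bracket (-a.1) a.1 = 0 by
        simp [H.bracket_self]))

/-- `m`, where `dim 𝔳 = 2 m`. -/
def m (_H : HTypeAlgebra v z) : ℕ := Module.finrank ℝ v / 2

/-- `k = dim 𝔷`. -/
def k (_H : HTypeAlgebra v z) : ℕ := Module.finrank ℝ z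

theorem one_le_m_k : 1 ≤ m H ∧ 1 ≤ k H := by
  obtain ⟨X, Y, h⟩ := H.nonabelian
  have hli : LinearIndependent ℝ ![X, Y] := by
    rw [LinearIndependent.pair_iff]
    intro s t hst
    have h₁ : s • H.bracket X Y = 0 := by
      have := congrArg (fun V => H.bracket V Y) hst
      simpa [H.bracket_self] using this
    have h₂ : t • H.bracket X Y = 0 := by
      have := congrArg (fun V => H.bracket X V) hst
      simpa [H.bracket_self] using this
    exact ⟨(smul_eq_zero.1 h₁).resolve_right h, (smul_eq_zero.1 h₂).resolve_right h⟩
  have h₁ := hli.fintype_card_le_finrank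
  have h₂ : 0 < Module.finrank ℝ z := Module.finrank_pos_iff_exists_ne_zero.2 ⟨_, h⟩
  simp only [Fintype.card_fin] at h₁
  unfold m k
  omega

end Group

variable {v z : Type*} [NormedAddCommGroup v] [InnerProductSpace ℝ v]
  [FiniteDimensional ℝ v] [MeasurableSpace v] [BorelSpace v]
  [NormedAddCommGroup z] [InnerProductSpace ℝ z]
  [FiniteDimensional ℝ z] [MeasurableSpace z] [BorelSpace z] (H : HTypeAlgebra v z)

/-- The Haar measure `dn = dX dZ`, product of the Lebesgue measures of `𝔳` and `𝔷`. -/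
instance : MeasureSpace (HTypeGroup H) := inferInstanceAs (MeasureSpace (v × z))

/-- `L¹(N)^♮`: the (classes of) integrable functions on `N` that are biradial, i.e. of the form
`f (X, Z) = f₀ (|X|, |Z|)` almost everywhere. -/
def biradialL1 : Submodule ℂ (HTypeGroup H →₁[volume] ℂ) where
  carrier := {f | ∃ f₀ : ℝ × ℝ → ℂ, Measurable f₀ ∧ ∀ᵐ n, f n = f₀ (‖n.1‖, ‖n.2‖)}
  add_mem' := by
    rintro f g ⟨f₀, hf₀, hf⟩ ⟨g₀, hg₀, hg⟩
    refine ⟨fun p => f₀ p + g₀ p, hf₀.add hg₀, ?_⟩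
    filter_upwards [hf, hg, Lp.coeFn_add f g] with n h₁ h₂ h₃
    rw [h₃, Pi.add_apply, h₁, h₂]
  zero_mem' := by
    refine ⟨fun _ => 0, measurable_const, ?_⟩
    filter_upwards [Lp.coeFn_zero ℂ 1 (volume : Measure (HTypeGroup H))] with n h
    rw [h, Pi.zero_apply]
  smul_mem' := by
    rintro c f ⟨f₀, hf₀, hf⟩
    refine ⟨fun p => c * f₀ p, hf₀.const_mul c, ?_⟩
    filter_upwards [hf, Lp.coeFn_smul c f] with n h₁ h₂
    rw [h₂, Pi.smul_apply, h₁, smul_eq_mul]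

variable {H} in
/-- Convolution on `N`: `(f * g)(n) = ∫ f(n') g(n'⁻¹ n) dn'`. -/
def conv (f g : HTypeGroup H → ℂ) (n : HTypeGroup H) : ℂ :=
  ∫ n' : HTypeGroup H, f n' * g (n'⁻¹ * n)

/-- The Gelfand spectrum `m(L¹(N)^♮)`: the nonzero linear functionals `ψ` on `L¹(N)^♮` with
`ψ(f * g) = ψ(f) ψ(g)`, where `h` stands for the element `f * g` of `L¹(N)^♮`. The Gelfand transform
of `f` is the function `ψ ↦ ψ f` on this set. -/
def gelfandSpectrum : Set (biradialL1 H →ₗ[ℂ] ℂ) :=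
  {ψ | ψ ≠ 0 ∧ ∀ f g h : biradialL1 H,
    (h : HTypeGroup H →₁[volume] ℂ) =ᵐ[volume]
      conv (f : HTypeGroup H →₁[volume] ℂ) (g : HTypeGroup H →₁[volume] ℂ) →
    ψ h = ψ f * ψ g}

/-- `a^Q / ((a + |X|²/4)² + |Z|²)^Q` with `Q = m + k`: the Poisson kernel up to its constant. -/
def poissonCore (a : ℝ) (n : HTypeGroup H) : ℝ :=
  a ^ (m H + k H) / ((a + ‖n.1‖ ^ 2 / 4) ^ 2 + ‖n.2‖ ^ 2) ^ (m H + k H)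

/-- The normalizing constant `C`, for which `‖P_a‖₁ = 1` (for `a = 1`, hence, by the dilations of
`N`, for every `a > 0`). -/
def poissonConst : ℝ := (∫ n : HTypeGroup H, poissonCore H 1 n)⁻¹

/-- The Poisson kernel `P_a(X, Z) = C a^Q / ((a + |X|²/4)² + |Z|²)^Q`, `Q = m + k`. -/
def poissonKernel (a : ℝ) (n : HTypeGroup H) : ℝ := poissonConst H * poissonCore H a n

theorem integrable_poissonKernel {a : ℝ} (ha : 0 < a) :
    Integrable (fun n : HTypeGroup H => (poissonKernel H a n : ℂ)) := by
  obtain ⟨hm, hk⟩ := one_le_m_k H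
  have hv : Integrable (fun X : v => ((1 + ‖X‖ ^ 2) ^ (2 * m H))⁻¹) := by
    have h := integrable_rpow_neg_one_add_norm_sq (E := v) (μ := volume)
      (r := ((2 * (2 * m H) : ℕ) : ℝ)) (by
        have : Module.finrank ℝ v < 2 * (2 * m H) := by unfold m at *; omega
        exact_mod_cast this)
    refine h.congr (Filter.Eventually.of_forall fun X => ?_)
    have hp : (0 : ℝ) ≤ 1 + ‖X‖ ^ 2 := by positivity
    show (1 + ‖X‖ ^ 2) ^ (-((2 * (2 * m H) : ℕ) : ℝ) / 2) = _
    rw [show -((2 * (2 * m H) : ℕ) : ℝ) / 2 = -((2 * m H : ℕ) : ℝ) by push_cast; ring,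
      Real.rpow_neg hp, Real.rpow_natCast]
  have hz : Integrable (fun Z : z => ((1 + ‖Z‖ ^ 2) ^ k H)⁻¹) := by
    have h := integrable_rpow_neg_one_add_norm_sq (E := z) (μ := volume)
      (r := ((2 * k H : ℕ) : ℝ)) (by
        have : Module.finrank ℝ z < 2 * k H := by unfold k at *; omega
        exact_mod_cast this)
    refine h.congr (Filter.Eventually.of_forall fun Z => ?_)
    have hp : (0 : ℝ) ≤ 1 + ‖Z‖ ^ 2 := by positivity
    show (1 + ‖Z‖ ^ 2) ^ (-((2 * k H : ℕ) : ℝ) / 2) = _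
    rw [show -((2 * k H : ℕ) : ℝ) / 2 = -((k H : ℕ) : ℝ) by push_cast; ring,
      Real.rpow_neg hp, Real.rpow_natCast]
  obtain ⟨c, hc, hca, hc4⟩ : ∃ c : ℝ, 0 < c ∧ c ≤ a ∧ c ≤ 1 / 4 :=
    ⟨min a (1 / 4), by positivity, min_le_left _ _, min_le_right _ _⟩
  have hcore : Integrable (fun n : v × z => a ^ (m H + k H) /
      ((a + ‖n.1‖ ^ 2 / 4) ^ 2 + ‖n.2‖ ^ 2) ^ (m H + k H)) (volume.prod volume) := by
    refine ((hv.mul_prod hz).const_mul (a ^ (m H + k H) / (c ^ 2) ^ (m H + k H))).mono'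
      (Measurable.aestronglyMeasurable (by fun_prop)) (Filter.Eventually.of_forall fun n => ?_)
    have hA : c * (1 + ‖n.1‖ ^ 2) ≤ a + ‖n.1‖ ^ 2 / 4 := by nlinarith [sq_nonneg ‖n.1‖]
    have hA2 : c ^ 2 * (1 + ‖n.1‖ ^ 2) ^ 2 ≤ (a + ‖n.1‖ ^ 2 / 4) ^ 2 := by
      rw [← mul_pow]
      gcongr
    have hD1 : c ^ 2 * (1 + ‖n.1‖ ^ 2) ^ 2 ≤ (a + ‖n.1‖ ^ 2 / 4) ^ 2 + ‖n.2‖ ^ 2 := by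
      nlinarith [sq_nonneg ‖n.2‖]
    have hD2 : c ^ 2 * (1 + ‖n.2‖ ^ 2) ≤ (a + ‖n.1‖ ^ 2 / 4) ^ 2 + ‖n.2‖ ^ 2 := by
      have h1 : c ^ 2 ≤ 1 := by nlinarith
      have h2 : c ^ 2 * 1 ≤ c ^ 2 * (1 + ‖n.1‖ ^ 2) ^ 2 := by
        gcongr
        nlinarith [sq_nonneg ‖n.1‖]
      nlinarith [sq_nonneg ‖n.2‖]
    have hD : (c ^ 2) ^ (m H + k H) * ((1 + ‖n.1‖ ^ 2) ^ (2 * m H) * (1 + ‖n.2‖ ^ 2) ^ k H) ≤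
        ((a + ‖n.1‖ ^ 2 / 4) ^ 2 + ‖n.2‖ ^ 2) ^ (m H + k H) := by
      calc _ = (c ^ 2 * (1 + ‖n.1‖ ^ 2) ^ 2) ^ m H * (c ^ 2 * (1 + ‖n.2‖ ^ 2)) ^ k H := by
            rw [mul_pow, mul_pow, pow_add, pow_mul]; ring
        _ ≤ _ := by rw [pow_add]; gcongr
    rw [Real.norm_of_nonneg (by positivity)]
    calc _ ≤ a ^ (m H + k H) / ((c ^ 2) ^ (m H + k H) *
          ((1 + ‖n.1‖ ^ 2) ^ (2 * m H) * (1 + ‖n.2‖ ^ 2) ^ k H)) := by gcongr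
      _ = _ := by field_simp
  exact (Integrable.const_mul hcore (poissonConst H)).ofReal

/-- The Poisson kernel as an element of `L¹(N)^♮`. -/
def poissonL1 {a : ℝ} (ha : 0 < a) : biradialL1 H :=
  ⟨(integrable_poissonKernel H ha).toL1 _,
    fun p => ((poissonConst H * (a ^ (m H + k H) /
      ((a + p.1 ^ 2 / 4) ^ 2 + p.2 ^ 2) ^ (m H + k H)) : ℝ) : ℂ),
    by fun_prop, Integrable.coeFn_toL1 _⟩

/-- The generalized Bessel function `𝒥_r`, `r ≥ -1/2`. -/
def genBessel (r x : ℝ) : ℂ :=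
  if r = -1 / 2 then (Real.cos x : ℂ)
  else ((Real.Gamma (r + 1) / (Real.Gamma ((2 * r + 1) / 2) * Real.Gamma (1 / 2)) : ℝ) : ℂ) *
    ∫ s in (-1 : ℝ)..1, Complex.exp (Complex.I * x * s) *
      (((1 - s ^ 2) ^ ((2 * r - 1) / 2) : ℝ) : ℂ)

/-- The Laguerre polynomial `L^α_l`. -/
def laguerre (α l : ℕ) (x : ℝ) : ℝ :=
  ∑ j ∈ Finset.range (l + 1), ((l + α).choose (l - j) : ℝ) * (-x) ^ j / (j.factorial : ℝ)

/-- The bounded spherical function `φ_{ν,l}`. -/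
def sphericalLaguerre (ν : ℝ) (l : ℕ) (n : HTypeGroup H) : ℂ :=
  ((Real.exp (-(ν * ‖n.1‖ ^ 2 / 4)) * laguerre (m H - 1) l (ν * ‖n.1‖ ^ 2 / 2) /
    ((l + (m H - 1)).choose l : ℝ) : ℝ) : ℂ) * genBessel (((k H : ℝ) - 2) / 2) (ν * ‖n.2‖)

/-- The bounded spherical function `φ_μ`. -/
def sphericalBessel (μ : ℝ) (n : HTypeGroup H) : ℂ :=
  genBessel ((m H : ℝ) - 1) (μ * ‖n.1‖)

end HTypeGroup

end

/-! Characters and spherical functions are treated alike: each pairs with biradial functions through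
a product density A(X)B(Z), and the Poisson kernel reduces this pairing to a positive superposition
of Gaussian transforms of A, which have constant sign.

Poisson side. Write (w² + |Z|²)^{-Q} as a Gamma integral of Gaussians and pair it with B, whose
Gaussian transform is (π/s)^{k/2} e^{-ν²/(4s)}. The resulting integral of Bessel K type is a
positive multiple of ∫_ν^∞ e^{-wτ} (τ² - ν²)^{β-1} dτ, with β = m + (k+1)/2. Its exponent is linear
in w = a + |X|²/4, so the integral over X only sees y(τ) = ∫ A(X) e^{-τ|X|²/4} dX. If y is a
constant c ≠ 0 times a positive function on (ν, ∞), the result is c times a positive number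
(`integral_poissonKernel_mul_ne_zero`).

Spherical functions. For φ_{ν,l} one finds y(τ) = (4π/(τ+ν))^m ((τ-ν)/(τ+ν))^l; for φ_μ one has ν =
0 and y(τ) = (4π/τ)^m e^{-μ²/τ}.

Characters. No classification of spherical functions is used; a character ψ is found from its values
on product Gaussians with parameters (b, r) (`gaussN`), whose span is dense. It is contractive,
hence has a bounded density. The convolution of two Gaussians depends on r, r' only through r + r',
so ψ is exponential in r; holomorphy in 1/r and a growth bound make the exponent -ν²/4 with ν ≥ 0
(`exists_frequency`). Hence B may be a plane wave e^{i⟨l,Z⟩} with |l| = ν, and y satisfies y(b)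
y(b') = (4π/(b+b'))^m y((bb'+ν²)/(b+b')). Differentiation gives (b² - ν²) y' = (E - mb) y. For ν >
0, analyticity at b = ν quantizes E and y = c (b-ν)^j/(b+ν)^{m+j} on (ν, ∞); for ν = 0, y = c b^{-m}
e^{-E/b} with E real (`exists_product_density`). -/

set_option linter.unusedSectionVars false

/-! ### Duality for L¹ by way of L² -/

/-- A bounded functional on `L¹(μ)` is given by integration against a bounded measurable
function, as soon as `μ` admits a positive square integrable function. -/
theorem exists_bounded_density_of_dual_L1 {α : Type*} [MeasurableSpace α] {μ : Measure α}
    {w : α → ℝ} (hwm : Measurable w) (hw : ∀ x, 0 < w x) (hw2 : MemLp w 2 μ)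
    (Ψ : (α →₁[μ] ℂ) →L[ℂ] ℂ) :
    ∃ φ : α → ℂ, Measurable φ ∧ (∃ C : ℝ, ∀ x, ‖φ x‖ ≤ C) ∧
      ∀ f : α →₁[μ] ℂ, Ψ f = ∫ x, φ x * f x ∂μ := by
  have hW : MemLp (fun x => (w x : ℂ)) 2 μ := hw2.ofReal
  have hint : Integrable (fun x => w x ^ 2) μ := hw2.integrable_sq
  -- Multiplication by `w` maps L² boundedly to L¹. Pulling `Ψ` back along it reaches a Hilbert
  -- space, where the Riesz theorem supplies `θ`; the density sought is `θ / w`.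
  let M : Lp ℂ 2 μ →L[ℂ] Lp ℂ 1 μ :=
    (ContinuousLinearMap.mul ℂ ℂ).holderL μ 2 2 1 (hW.toLp _)
  have hM : ∀ g : Lp ℂ 2 μ, M g =ᵐ[μ] fun x => (w x : ℂ) * g x := by
    intro g
    filter_upwards [(ContinuousLinearMap.mul ℂ ℂ).coeFn_holder (r := 1) (hW.toLp _) g,
      hW.coeFn_toLp] with x h1 h2
    change ((ContinuousLinearMap.mul ℂ ℂ).holder 1 (hW.toLp _) g) x = _
    rw [h1, h2]; rfl
  set h : Lp ℂ 2 μ := (InnerProductSpace.toDual ℂ (Lp ℂ 2 μ)).symm (Ψ.comp M) with hh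
  obtain ⟨θ, hθm, hθ⟩ : ∃ θ : α → ℂ, Measurable θ ∧ θ =ᵐ[μ] fun x => (starRingEnd ℂ) (h x) := by
    have h1 := (Lp.aestronglyMeasurable h).aemeasurable
    have h2 : AEMeasurable (fun x => (starRingEnd ℂ) (h x)) μ :=
      Complex.continuous_conj.measurable.comp_aemeasurable h1
    exact ⟨_, h2.measurable_mk, h2.ae_eq_mk.symm⟩
  have hΨM : ∀ g : Lp ℂ 2 μ, Ψ (M g) = ∫ x, θ x * g x ∂μ := by
    intro g
    have h1 : Ψ (M g) = inner ℂ h g := by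
      rw [hh, InnerProductSpace.toDual_symm_apply]; rfl
    rw [h1, L2.inner_def]
    refine integral_congr_ae ?_
    filter_upwards [hθ] with x hx
    rw [hx, RCLike.inner_apply, mul_comm]
  have hθ2 : MemLp θ 2 μ := by
    refine (memLp_congr_ae hθ).2 ?_
    exact (Lp.memLp h).star
  have hθw : Integrable (fun x => θ x * w x) μ := MemLp.integrable_mul hθ2 hW
  have hset : ∀ s : Set α, MeasurableSet s →
      ‖∫ x in s, θ x * w x ∂μ‖ ≤ ‖Ψ‖ * ∫ x in s, w x ^ 2 ∂μ := by
    intro s hs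
    have hg : MemLp (s.indicator fun x => (w x : ℂ)) 2 μ := hW.indicator hs
    have h1 : Ψ (M (hg.toLp _)) = ∫ x in s, θ x * w x ∂μ := by
      rw [hΨM, ← integral_indicator hs]
      refine integral_congr_ae ?_
      filter_upwards [hg.coeFn_toLp] with x hx
      rw [hx]
      by_cases hxs : x ∈ s <;> simp [hxs]
    have h2 : ‖M (hg.toLp _)‖ = ∫ x in s, w x ^ 2 ∂μ := by
      rw [L1.norm_eq_integral_norm, ← integral_indicator hs]
      refine integral_congr_ae ?_
      filter_upwards [hg.coeFn_toLp, hM (hg.toLp _)] with x hx hx2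
      rw [hx2, hx]
      by_cases hxs : x ∈ s <;> simp [hxs, sq]
    rw [← h1, ← h2]
    exact Ψ.le_opNorm _
  have hbound : ∀ u : ℂ, ‖u‖ = 1 → ∀ᵐ x ∂μ, (u * (θ x * w x)).re ≤ ‖Ψ‖ * w x ^ 2 := by
    intro u hu
    refine ae_le_of_forall_setIntegral_le (hθw.const_mul u).re (hint.const_mul _) ?_
    intro s hs _
    calc ∫ x in s, (u * (θ x * w x)).re ∂μ
        = (∫ x in s, u * (θ x * w x) ∂μ).re :=
          integral_re (𝕜 := ℂ) (hθw.const_mul u).integrableOn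
      _ ≤ ‖∫ x in s, u * (θ x * w x) ∂μ‖ := Complex.re_le_norm _
      _ = ‖∫ x in s, θ x * w x ∂μ‖ := by rw [integral_const_mul, norm_mul, hu, one_mul]
      _ ≤ _ := hset s hs
      _ = _ := by rw [integral_const_mul]
  -- The directions ±1, ±i bound the real and imaginary parts separately; hence the factor 2, not
  -- optimal but sufficient.
  have hbd : ∀ᵐ x ∂μ, ‖θ x / w x‖ ≤ 2 * ‖Ψ‖ := by
    filter_upwards [hbound 1 (by simp), hbound (-1) (by simp), hbound Complex.I (by simp),
      hbound (-Complex.I) (by simp)] with x h1 h2 h3 h4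
    have hwx := hw x
    simp only [one_mul, Complex.mul_re, Complex.ofReal_re, Complex.ofReal_im, mul_zero, sub_zero,
      neg_mul, Complex.neg_re, Complex.I_re, zero_mul, Complex.I_im, Complex.mul_im, zero_add,
      zero_sub, neg_neg] at h1 h2 h3 h4
    have key : ∀ t : ℝ, t * w x ≤ ‖Ψ‖ * w x ^ 2 → t ≤ ‖Ψ‖ * w x := fun t ht =>
      le_of_mul_le_mul_right (by nlinarith) hwx
    have a1 := key _ h1
    have a2 := key (-(θ x).re) (by linarith)
    have a3 := key (-(θ x).im) (by linarith)
    have a4 := key (θ x).im (by linarith)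
    rw [norm_div, Complex.norm_real, Real.norm_of_nonneg hwx.le, div_le_iff₀ hwx]
    have := Complex.norm_le_abs_re_add_abs_im (θ x)
    have b1 : |(θ x).re| ≤ ‖Ψ‖ * w x := abs_le.2 ⟨by linarith, a1⟩
    have b2 : |(θ x).im| ≤ ‖Ψ‖ * w x := abs_le.2 ⟨by linarith, a4⟩
    linarith
  have hm0 : Measurable fun x => θ x / (w x : ℂ) := by fun_prop
  let A : Set α := {x | ‖θ x / w x‖ ≤ 2 * ‖Ψ‖}
  have hA : MeasurableSet A := measurableSet_le hm0.norm measurable_const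
  refine ⟨A.indicator fun x => θ x / w x, hm0.indicator hA, ⟨2 * ‖Ψ‖, fun x => ?_⟩, fun f => ?_⟩
  · by_cases hx : x ∈ A
    · rw [Set.indicator_of_mem hx]; exact hx
    · rw [Set.indicator_of_notMem hx, norm_zero]; positivity
  have hφ : A.indicator (fun x => θ x / w x) =ᵐ[μ] fun x => θ x / w x := by
    filter_upwards [hbd] with x hx
    exact Set.indicator_of_mem (show x ∈ A from hx) _
  rw [integral_congr_ae (g := fun x => θ x / w x * f x) (by
    filter_upwards [hφ] with x hx
    rw [hx])]
  obtain ⟨f', hf'm, hf'⟩ : ∃ f' : α → ℂ, Measurable f' ∧ f =ᵐ[μ] f' :=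
    ⟨_, (Lp.aestronglyMeasurable f).aemeasurable.measurable_mk,
      (Lp.aestronglyMeasurable f).aemeasurable.ae_eq_mk⟩
  have hf'i : Integrable f' μ := (integrable_congr hf').1 (L1.integrable_coeFn f)
  have hfe : f = hf'i.toL1 f' := by
    rw [← Integrable.toL1_coeFn f (L1.integrable_coeFn f)]
    exact (Integrable.toL1_eq_toL1_iff _ _ _ _).2 hf'
  rw [integral_congr_ae (g := fun x => θ x / w x * f' x) (by
    filter_upwards [hf'] with x hx
    rw [hx])]
  -- On `S n` the quotient `f' / w` is at most `n w`, hence square integrable, so the truncation of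
  -- `f'` to `S n` is in the range of `M`. Since `w > 0`, every point lies in `S n` for large `n`.
  let S : ℕ → Set α := fun n => {x | ‖f' x‖ ≤ n * w x ^ 2}
  have hS : ∀ n, MeasurableSet (S n) := fun n =>
    measurableSet_le hf'm.norm ((hwm.pow_const 2).const_mul _)
  have hSx : ∀ x, ∀ᶠ n in Filter.atTop, x ∈ S n := by
    intro x
    obtain ⟨N, hN⟩ := exists_nat_ge (‖f' x‖ / w x ^ 2)
    filter_upwards [Filter.eventually_ge_atTop N] with n hn
    have : ‖f' x‖ / w x ^ 2 ≤ n := hN.trans (by exact_mod_cast hn)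
    exact (div_le_iff₀ (pow_pos (hw x) 2)).1 this
  have hfn : ∀ n, Integrable ((S n).indicator f') μ := fun n => hf'i.indicator (hS n)
  have hΨn : ∀ n, Ψ ((hfn n).toL1 _) = ∫ x, θ x / w x * (S n).indicator f' x ∂μ := by
    intro n
    have hg : MemLp (fun x => (S n).indicator f' x / w x) 2 μ := by
      refine (hW.norm.const_mul (n : ℝ)).of_le
        ((hf'm.indicator (hS n)).div (Complex.measurable_ofReal.comp hwm)).aestronglyMeasurable
        (Filter.Eventually.of_forall fun x => ?_)
      have hwx := hw x
      by_cases hx : x ∈ S n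
      · rw [Set.indicator_of_mem hx]
        have : ‖f' x‖ ≤ n * w x ^ 2 := hx
        simp only [norm_div, Complex.norm_real, norm_mul, Real.norm_of_nonneg hwx.le,
          RCLike.norm_natCast]
        rw [div_le_iff₀ hwx]
        linarith
      · rw [Set.indicator_of_notMem hx, zero_div, norm_zero]; positivity
    have h1 : (hfn n).toL1 _ = M (hg.toLp _) := by
      refine Lp.ext ?_
      filter_upwards [(hfn n).coeFn_toL1, hM (hg.toLp _), hg.coeFn_toLp] with x a1 a2 a3
      have : (w x : ℂ) ≠ 0 := by exact_mod_cast (hw x).ne'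
      rw [a1, a2, a3]
      field_simp
    rw [h1, hΨM]
    refine integral_congr_ae ?_
    filter_upwards [hg.coeFn_toLp] with x a3
    rw [a3]; ring
  have hlim1 : Filter.Tendsto (fun n => Ψ ((hfn n).toL1 _)) Filter.atTop (nhds (Ψ f)) := by
    refine (Ψ.continuous.tendsto f).comp ?_
    rw [tendsto_iff_norm_sub_tendsto_zero]
    have h1 : ∀ n, ‖(hfn n).toL1 _ - f‖ = ∫ x, ‖(S n).indicator f' x - f' x‖ ∂μ := by
      intro n
      rw [hfe, ← Integrable.toL1_sub, L1.norm_of_fun_eq_integral_norm]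
      rfl
    simp_rw [h1]
    rw [show (0 : ℝ) = ∫ x : α, (0 : ℝ) ∂μ by simp]
    refine tendsto_integral_of_dominated_convergence (fun x => ‖f' x‖)
      (fun n => ((hfn n).sub hf'i).norm.aestronglyMeasurable) hf'i.norm ?_ ?_
    · intro n
      refine Filter.Eventually.of_forall fun x => ?_
      by_cases hx : x ∈ S n <;> simp [hx]
    · refine Filter.Eventually.of_forall fun x => ?_
      refine tendsto_const_nhds.congr' ?_
      filter_upwards [hSx x] with n hn
      simp [hn]
  refine tendsto_nhds_unique hlim1 ?_
  simp_rw [hΨn]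
  refine tendsto_integral_of_dominated_convergence (fun x => 2 * ‖Ψ‖ * ‖f' x‖)
    (fun n => hm0.aestronglyMeasurable.mul (hfn n).aestronglyMeasurable)
    (hf'i.norm.const_mul _) ?_ ?_
  · intro n
    filter_upwards [hbd] with x hx
    rw [norm_mul]
    refine mul_le_mul hx ?_ (norm_nonneg _) (by positivity)
    exact norm_indicator_le_norm_self _ _
  · refine Filter.Eventually.of_forall fun x => ?_
    refine tendsto_const_nhds.congr' ?_
    filter_upwards [hSx x] with n hn
    rw [Set.indicator_of_mem hn]

/-! ### Convolution on the group as a bounded bilinear map -/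

namespace HTypeGroup

variable {v z : Type*} [NormedAddCommGroup v] [InnerProductSpace ℝ v]
  [FiniteDimensional ℝ v] [MeasurableSpace v] [BorelSpace v]
  [NormedAddCommGroup z] [InnerProductSpace ℝ z]
  [FiniteDimensional ℝ z] [MeasurableSpace z] [BorelSpace z] (H : HTypeAlgebra v z)

theorem continuous_bracket : Continuous fun p : v × v => H.bracket p.1 p.2 := by
  have h : (fun p : v × v => H.bracket p.1 p.2) =
      fun p => (LinearMap.toContinuousLinearMap
        ((LinearMap.toContinuousLinearMap : (v →ₗ[ℝ] z) ≃ₗ[ℝ] v →L[ℝ] z).toLinearMap ∘ₗ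
          H.bracket)) p.1 p.2 := by
    ext p; rfl
  rw [h]
  fun_prop

instance : SigmaFinite (volume : Measure (HTypeGroup H)) :=
  inferInstanceAs (SigmaFinite ((volume : Measure v).prod (volume : Measure z)))

/-- Multiplication on the left by an inverse, as a formula on `𝔳 × 𝔷`. -/
theorem inv_mul_eq (n' n : HTypeGroup H) : n'⁻¹ * n =
    ((n.1 - n'.1, n.2 - n'.2 - (1 / 2 : ℝ) • H.bracket n'.1 n.1) : v × z) := by
  refine Prod.ext ?_ ?_
  · change -n'.1 + n.1 = n.1 - n'.1
    abel
  · change -n'.2 + n.2 + (1 / 2 : ℝ) • H.bracket (-n'.1) n.1 =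
      n.2 - n'.2 - (1 / 2 : ℝ) • H.bracket n'.1 n.1
    rw [map_neg, LinearMap.neg_apply, smul_neg]
    abel

theorem measurable_inv_mul :
    Measurable fun p : HTypeGroup H × HTypeGroup H => p.1⁻¹ * p.2 := by
  have h : Continuous fun p : (v × z) × (v × z) =>
      (p.2.1 - p.1.1, p.2.2 - p.1.2 - (1 / 2 : ℝ) • H.bracket p.1.1 p.2.1) := by
    have := (continuous_bracket H).comp
      (f := fun p : (v × z) × (v × z) => (p.1.1, p.2.1)) (by fun_prop)
    simp only [Function.comp_def] at this
    fun_prop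
  have h2 := h.measurable
  simp_rw [inv_mul_eq]
  exact h2

/-- On 𝔳 × 𝔷 a left translation is a skew product: it translates the base, and each fibre by an
amount depending on the base point. -/
theorem measurePreserving_inv_mul (n' : HTypeGroup H) :
    MeasurePreserving (fun n : HTypeGroup H => n'⁻¹ * n) := by
  simp_rw [inv_mul_eq]
  have hb : Measurable fun X : v => H.bracket n'.1 X :=
    ((continuous_bracket H).comp (by fun_prop : Continuous fun X : v => (n'.1, X))).measurable
  refine MeasurePreserving.skew_product (μa := (volume : Measure v)) (μb := (volume : Measure v))
    (μc := (volume : Measure z)) (μd := (volume : Measure z)) (f := fun X => X - n'.1)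
    (g := fun X Z => Z - n'.2 - (1 / 2 : ℝ) • H.bracket n'.1 X)
    (measurePreserving_sub_right volume n'.1) ?_ ?_
  · change Measurable fun p : v × z => p.2 - n'.2 - (1 / 2 : ℝ) • H.bracket n'.1 p.1
    fun_prop
  · refine Filter.Eventually.of_forall fun X => ?_
    have := (measurePreserving_sub_right (volume : Measure z)
      (n'.2 + (1 / 2 : ℝ) • H.bracket n'.1 X)).map_eq
    simpa only [sub_add_eq_sub_sub] using this

/-- The convolution integrand is the tensor product of f and g pulled back along this shear, so its
integrability and its insensitivity to null sets come from the tensor product. -/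
theorem measurePreserving_shear :
    MeasurePreserving (fun p : HTypeGroup H × HTypeGroup H => (p.1, p.1⁻¹ * p.2)) := by
  refine MeasurePreserving.skew_product (μa := (volume : Measure (HTypeGroup H)))
    (μb := (volume : Measure (HTypeGroup H)))
    (μc := (volume : Measure (HTypeGroup H))) (μd := (volume : Measure (HTypeGroup H)))
    (f := id) (g := fun n' n => n'⁻¹ * n) (MeasurePreserving.id _)
    (measurable_inv_mul H)
    (Filter.Eventually.of_forall fun n' => (measurePreserving_inv_mul H n').map_eq)

variable {H}

theorem integrable_conv_integrand {f g : HTypeGroup H → ℂ} (hf : Integrable f)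
    (hg : Integrable g) : Integrable (fun p : HTypeGroup H × HTypeGroup H =>
      f p.1 * g (p.1⁻¹ * p.2)) :=
  (measurePreserving_shear H).integrable_comp_of_integrable (hf.mul_prod hg)

theorem integrable_conv {f g : HTypeGroup H → ℂ} (hf : Integrable f)
    (hg : Integrable g) : Integrable (conv f g) :=
  (integrable_conv_integrand hf hg).integral_prod_right

theorem conv_integrand_ae {f g : HTypeGroup H → ℂ} (hf : Integrable f)
    (hg : Integrable g) : ∀ᵐ n, Integrable fun n' => f n' * g (n'⁻¹ * n) :=
  (integrable_conv_integrand hf hg).prod_left_ae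

theorem conv_congr_ae {f f' g g' : HTypeGroup H → ℂ} (hf : f =ᵐ[volume] f')
    (hg : g =ᵐ[volume] g') : conv f g =ᵐ[volume] conv f' g' := by
  have h1 : (fun p : HTypeGroup H × HTypeGroup H => f p.1 * g p.2) =ᵐ[volume.prod volume]
      fun p => f' p.1 * g' p.2 := by
    filter_upwards [Measure.quasiMeasurePreserving_fst.ae hf,
      Measure.quasiMeasurePreserving_snd.ae hg] with p h1 h2
    rw [h1, h2]
  have h2 := (measurePreserving_shear H).quasiMeasurePreserving.ae h1
  have h3 := (Measure.measurePreserving_swap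
    (μ := (volume : Measure (HTypeGroup H)))
    (ν := (volume : Measure (HTypeGroup H)))).quasiMeasurePreserving.ae h2
  filter_upwards [Measure.ae_ae_of_ae_prod h3] with n hn
  exact integral_congr_ae hn

theorem integral_norm_conv_le {f g : HTypeGroup H → ℂ} (hf : Integrable f)
    (hg : Integrable g) : ∫ n, ‖conv f g n‖ ≤ (∫ n, ‖f n‖) * ∫ n, ‖g n‖ := by
  have hi := integrable_conv_integrand hf hg
  calc ∫ n, ‖conv f g n‖ ≤ ∫ n, ∫ n', ‖f n' * g (n'⁻¹ * n)‖ := by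
        refine integral_mono (integrable_conv hf hg).norm hi.norm.integral_prod_right ?_
        intro n
        exact norm_integral_le_integral_norm _
    _ = ∫ n', ∫ n, ‖f n' * g (n'⁻¹ * n)‖ :=
        (integral_integral_swap (f := fun n' n => ‖f n' * g (n'⁻¹ * n)‖) hi.norm).symm
    _ = ∫ n', ‖f n'‖ * ∫ n, ‖g n‖ := by
        refine integral_congr_ae (Filter.Eventually.of_forall fun n' => ?_)
        simp only [norm_mul, integral_const_mul]
        congr 1
        have hp := measurePreserving_inv_mul H n'
        rw [← integral_map (f := fun n => ‖g n‖) hp.measurable.aemeasurable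
          (by rw [hp.map_eq]; exact hg.norm.aestronglyMeasurable), hp.map_eq]
    _ = _ := by rw [integral_mul_const]

variable (H) in
/-- Convolution as a bounded bilinear map on `L¹(N)`. -/
noncomputable def convL : (HTypeGroup H →₁[volume] ℂ) →L[ℂ] (HTypeGroup H →₁[volume] ℂ) →L[ℂ]
    (HTypeGroup H →₁[volume] ℂ) :=
  LinearMap.mkContinuous₂ (LinearMap.mk₂ ℂ
    (fun f g => (integrable_conv (L1.integrable_coeFn f) (L1.integrable_coeFn g)).toL1 _)
    (fun f₁ f₂ g => by
      have hi₁ := conv_integrand_ae (L1.integrable_coeFn f₁) (L1.integrable_coeFn g)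
      have hi₂ := conv_integrand_ae (L1.integrable_coeFn f₂) (L1.integrable_coeFn g)
      rw [← Integrable.toL1_add, Integrable.toL1_eq_toL1_iff]
      refine (conv_congr_ae (Lp.coeFn_add f₁ f₂) Filter.EventuallyEq.rfl).trans ?_
      filter_upwards [hi₁, hi₂] with n h₁ h₂
      simp only [conv, Pi.add_apply, add_mul]
      exact integral_add h₁ h₂)
    (fun c f g => by
      rw [← Integrable.toL1_smul, Integrable.toL1_eq_toL1_iff]
      refine (conv_congr_ae (Lp.coeFn_smul c f) Filter.EventuallyEq.rfl).trans ?_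
      refine Filter.Eventually.of_forall fun n => ?_
      simp only [conv, Pi.smul_apply, smul_eq_mul, mul_assoc, integral_const_mul])
    (fun f g₁ g₂ => by
      have hi₁ := conv_integrand_ae (L1.integrable_coeFn f) (L1.integrable_coeFn g₁)
      have hi₂ := conv_integrand_ae (L1.integrable_coeFn f) (L1.integrable_coeFn g₂)
      rw [← Integrable.toL1_add, Integrable.toL1_eq_toL1_iff]
      refine (conv_congr_ae Filter.EventuallyEq.rfl (Lp.coeFn_add g₁ g₂)).trans ?_
      filter_upwards [hi₁, hi₂] with n h₁ h₂
      simp only [conv, Pi.add_apply, mul_add]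
      exact integral_add h₁ h₂)
    (fun c f g => by
      rw [← Integrable.toL1_smul, Integrable.toL1_eq_toL1_iff]
      refine (conv_congr_ae Filter.EventuallyEq.rfl (Lp.coeFn_smul c g)).trans ?_
      refine Filter.Eventually.of_forall fun n => ?_
      simp only [conv, Pi.smul_apply, smul_eq_mul, mul_left_comm _ c, integral_const_mul]))
    1 (fun f g => by
      simp only [LinearMap.mk₂_apply, one_mul]
      rw [L1.norm_of_fun_eq_integral_norm, L1.norm_eq_integral_norm, L1.norm_eq_integral_norm]
      exact integral_norm_conv_le (L1.integrable_coeFn f) (L1.integrable_coeFn g))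

theorem coeFn_convL (f g : HTypeGroup H →₁[volume] ℂ) :
    convL H f g =ᵐ[volume] conv f g :=
  (integrable_conv (L1.integrable_coeFn f) (L1.integrable_coeFn g)).coeFn_toL1

theorem norm_convL_le (f g : HTypeGroup H →₁[volume] ℂ) : ‖convL H f g‖ ≤ ‖f‖ * ‖g‖ := by
  have h : convL H f g =
    (integrable_conv (L1.integrable_coeFn f) (L1.integrable_coeFn g)).toL1 _ := rfl
  rw [h, L1.norm_of_fun_eq_integral_norm, L1.norm_eq_integral_norm, L1.norm_eq_integral_norm]
  exact integral_norm_conv_le (L1.integrable_coeFn f) (L1.integrable_coeFn g)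

end HTypeGroup

/-! ### Gaussian integrals on Euclidean spaces -/

section Gaussian

variable {E : Type*} [NormedAddCommGroup E] [InnerProductSpace ℝ E]
  [FiniteDimensional ℝ E] [MeasurableSpace E] [BorelSpace E]

/-- The normalized Gaussian `(π r)^{-d/2} exp (-|U|² / r)` on a `d`-dimensional Euclidean space. -/
noncomputable def heat (r : ℝ) (U : E) : ℂ :=
  (((Real.pi * r) ^ (-(Module.finrank ℝ E : ℝ) / 2) * Real.exp (-(‖U‖ ^ 2 / r)) : ℝ) : ℂ)

theorem integral_gaussian_linear {b : ℝ} (hb : 0 < b) (c : ℂ) (w : E) :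
    ∫ x : E, Complex.exp (-(b * ‖x‖ ^ 2) + c * (inner ℝ w x : ℝ)) =
      (((Real.pi / b) ^ ((Module.finrank ℝ E : ℝ) / 2) : ℝ) : ℂ) *
        Complex.exp (c ^ 2 * ‖w‖ ^ 2 / (4 * b)) := by
  have h := GaussianFourier.integral_cexp_neg_mul_sq_norm_add (b := (b : ℂ)) (by simpa) c w
  simp only [neg_mul] at h
  rw [h, Complex.ofReal_cpow (by positivity)]
  push_cast
  rfl

theorem integrable_gaussian_linear {b : ℝ} (hb : 0 < b) (c : ℂ) (w : E) :
    Integrable fun x : E => Complex.exp (-(b * ‖x‖ ^ 2) + c * (inner ℝ w x : ℝ)) := by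
  have h := GaussianFourier.integrable_cexp_neg_mul_sq_norm_add (b := (b : ℂ)) (by simpa) c w
  simpa only [neg_mul] using h

theorem integrable_gaussian {b : ℝ} (hb : 0 < b) :
    Integrable fun x : E => Real.exp (-(b * ‖x‖ ^ 2)) := by
  have h := (integrable_gaussian_linear hb 0 (0 : E)).norm
  refine h.congr (Filter.Eventually.of_forall fun x => ?_)
  simp only [Complex.norm_exp]
  simp [← Complex.ofReal_pow]

theorem integral_gaussian_real {b : ℝ} (hb : 0 < b) :
    ∫ x : E, Real.exp (-(b * ‖x‖ ^ 2)) = (Real.pi / b) ^ ((Module.finrank ℝ E : ℝ) / 2) := by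
  simpa only [neg_mul] using GaussianFourier.integral_rexp_neg_mul_sq_norm (V := E) hb

/-- As a Fourier integral the Gaussian sees its argument only in a phase, so that a central shift by
a bracket [Y, X] becomes a character of Y. -/
theorem integral_heat_fourier {r : ℝ} (hr : 0 < r) (U : E) :
    ∫ l : E, Complex.exp (-((r / 4 : ℝ) * ‖l‖ ^ 2) + Complex.I * (inner ℝ U l : ℝ)) =
      (((2 * Real.pi) ^ (Module.finrank ℝ E : ℝ) : ℝ) : ℂ) * heat r U := by
  rw [integral_gaussian_linear (by positivity), heat, ← Complex.ofReal_mul, ← mul_assoc,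
    Complex.ofReal_mul]
  have hpi := Real.pi_pos
  congr 2
  · have h1 : Real.pi / (r / 4) = (2 * Real.pi) ^ (2 : ℝ) * (Real.pi * r)⁻¹ := by
      rw [Real.rpow_two]; field_simp; norm_num
    rw [h1, Real.mul_rpow (by positivity) (by positivity), ← Real.rpow_mul (by positivity),
      Real.inv_rpow (by positivity), ← Real.rpow_neg (by positivity)]
    congr 2 <;> ring
  · push_cast
    congr 1
    have : (r : ℂ) ≠ 0 := by exact_mod_cast hr.ne'
    rw [Complex.I_sq]; field_simp

theorem integral_heat_mul_character {r : ℝ} (hr : 0 < r) (l : E) :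
    ∫ U : E, heat r U * Complex.exp (Complex.I * (inner ℝ l U : ℝ)) =
      Complex.exp (-(r * ‖l‖ ^ 2 / 4)) := by
  have hpi := Real.pi_pos
  have h := integral_gaussian_linear (b := 1 / r) (by positivity) Complex.I l
  have h2 : ∀ U : E, heat r U * Complex.exp (Complex.I * (inner ℝ l U : ℝ)) =
      (((Real.pi * r) ^ (-(Module.finrank ℝ E : ℝ) / 2) : ℝ) : ℂ) *
      Complex.exp (-((1 / r : ℝ) * ‖U‖ ^ 2) + Complex.I * (inner ℝ l U : ℝ)) := by
    intro U
    rw [heat, Complex.exp_add]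
    push_cast
    rw [mul_assoc]
    congr 3
    congr 1
    field_simp
  simp_rw [h2]
  rw [integral_const_mul, h, ← mul_assoc, ← Complex.ofReal_mul]
  have h3 : (Real.pi * r) ^ (-(Module.finrank ℝ E : ℝ) / 2) *
      (Real.pi / (1 / r)) ^ ((Module.finrank ℝ E : ℝ) / 2) = 1 := by
    rw [div_div_eq_mul_div, div_one, ← Real.rpow_add (by positivity)]
    rw [show -(Module.finrank ℝ E : ℝ) / 2 + (Module.finrank ℝ E : ℝ) / 2 = 0 by ring,
      Real.rpow_zero]
  rw [h3, Complex.ofReal_one, one_mul]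
  congr 1
  have : (r : ℂ) ≠ 0 := by exact_mod_cast hr.ne'
  rw [Complex.I_sq]; push_cast; field_simp

theorem integrable_heat {r : ℝ} (hr : 0 < r) : Integrable (heat r : E → ℂ) := by
  have h := (integrable_gaussian (E := E) (b := 1 / r) (by positivity)).const_mul
    ((Real.pi * r) ^ (-(Module.finrank ℝ E : ℝ) / 2))
  refine h.ofReal.congr (Filter.Eventually.of_forall fun U => ?_)
  simp only [heat, one_div]
  congr 4
  field_simp

theorem continuous_heat (r : ℝ) : Continuous (heat r : E → ℂ) := by
  unfold heat
  fun_prop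

/-- Completing the square. In this normalization the parameter is additive under convolution, the
source of the functional equation in r + r'. -/
theorem integral_heat_conv {r r' : ℝ} (hr : 0 < r) (hr' : 0 < r') (U : E) :
    ∫ Y : E, heat r Y * heat r' (U - Y) = heat (r + r') U := by
  have hpi := Real.pi_pos
  set d : ℝ := (Module.finrank ℝ E : ℝ) with hd
  have h := integral_gaussian_linear (b := 1 / r + 1 / r') (by positivity) ((2 / r' : ℝ) : ℂ) U
  have h2 : ∀ Y : E, heat r Y * heat r' (U - Y) =
      (((Real.pi * r) ^ (-d / 2) * (Real.pi * r') ^ (-d / 2) * Real.exp (-(‖U‖ ^ 2 / r')) : ℝ) : ℂ)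
      * Complex.exp (-((1 / r + 1 / r' : ℝ) * ‖Y‖ ^ 2) + ((2 / r' : ℝ) : ℂ) *
        (inner ℝ U Y : ℝ)) := by
    intro Y
    have : Complex.exp (-((1 / r + 1 / r' : ℝ) * ‖Y‖ ^ 2) + ((2 / r' : ℝ) : ℂ) *
        (inner ℝ U Y : ℝ)) = ((Real.exp (-((1 / r + 1 / r') * ‖Y‖ ^ 2) + (2 / r') *
        (inner ℝ U Y)) : ℝ) : ℂ) := by push_cast; rfl
    rw [this, heat, heat, ← Complex.ofReal_mul, ← Complex.ofReal_mul]
    congr 1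
    have e : Real.exp (-(‖Y‖ ^ 2 / r)) * Real.exp (-(‖U - Y‖ ^ 2 / r')) =
      Real.exp (-(‖U‖ ^ 2 / r')) * Real.exp (-((1 / r + 1 / r') * ‖Y‖ ^ 2) + (2 / r') *
        (inner ℝ U Y)) := by
      rw [← Real.exp_add, ← Real.exp_add, norm_sub_sq_real]
      congr 1
      field_simp
      ring
    linear_combination (Real.pi * r) ^ (-d / 2) * (Real.pi * r') ^ (-d / 2) * e
  simp_rw [h2]
  rw [integral_const_mul, h, heat]
  have h4 : Complex.exp (((2 / r' : ℝ) : ℂ) ^ 2 * ‖U‖ ^ 2 / (4 * ((1 / r + 1 / r' : ℝ) : ℂ))) =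
     ((Real.exp ((2 / r') ^ 2 * ‖U‖ ^ 2 / (4 * (1 / r + 1 / r'))) : ℝ) : ℂ) := by
    push_cast; rfl
  rw [h4, ← Complex.ofReal_mul, ← Complex.ofReal_mul]
  congr 1
  have e : Real.exp (-(‖U‖ ^ 2 / r')) * Real.exp ((2 / r') ^ 2 * ‖U‖ ^ 2 / (4 * (1 / r + 1 / r')))
      = Real.exp (-(‖U‖ ^ 2 / (r + r'))) := by
    rw [← Real.exp_add]
    congr 1
    field_simp
    ring
  have e2 : (Real.pi * r) ^ (-d / 2) * (Real.pi * r') ^ (-d / 2) *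
      (Real.pi / (1 / r + 1 / r')) ^ (d / 2) = (Real.pi * (r + r')) ^ (-d / 2) := by
    have : Real.pi / (1 / r + 1 / r') = (Real.pi * r) * (Real.pi * r') * (Real.pi * (r + r'))⁻¹ := by
      field_simp; ring
    rw [this]
    have key : ∀ p q t : ℝ, 0 < p → 0 < q → 0 < t →
        p ^ (-d / 2) * q ^ (-d / 2) * (p * q * t⁻¹) ^ (d / 2) = t ^ (-d / 2) := by
      intro p q t hp hq ht
      have i : ∀ p : ℝ, 0 < p → p ^ (-d / 2) * p ^ (d / 2) = 1 := fun p hp => by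
        rw [← Real.rpow_add hp, show -d / 2 + d / 2 = 0 by ring, Real.rpow_zero]
      rw [Real.mul_rpow (by positivity) (by positivity), Real.mul_rpow hp.le hq.le,
        Real.inv_rpow ht.le, ← Real.rpow_neg ht.le, show -(d / 2) = -d / 2 by ring]
      linear_combination t ^ (-d / 2) * (q ^ (-d / 2) * q ^ (d / 2) * i p hp + i q hq)
    exact key _ _ _ (by positivity) (by positivity) (by positivity)
  rw [← hd]
  linear_combination Real.exp (-(‖U‖ ^ 2 / r')) * Real.exp ((2 / r') ^ 2 * ‖U‖ ^ 2 /
    (4 * (1 / r + 1 / r'))) * e2 + (Real.pi * (r + r')) ^ (-d / 2) * e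

end Gaussian

/-! ### Consequences of the H-type condition -/

section JMap

variable {v z : Type*} [NormedAddCommGroup v] [InnerProductSpace ℝ v]
  [FiniteDimensional ℝ v] [NormedAddCommGroup z] [InnerProductSpace ℝ z]
  [FiniteDimensional ℝ z] (H : HTypeAlgebra v z)

namespace HTypeAlgebra

theorem bracket_swap (X Y : v) : H.bracket X Y = -H.bracket Y X := by
  have h := H.bracket_self (X + Y)
  simp only [map_add, LinearMap.add_apply, H.bracket_self, zero_add, add_zero] at h
  exact eq_neg_of_add_eq_zero_right h

theorem inner_JMap_self (Z : z) (X : v) : inner ℝ (JMap H.bracket Z X) X = 0 := by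
  rw [inner_JMap, H.bracket_self, inner_zero_left]

/-- J_Z is skew and J_Z² = -|Z|². The H-type condition enters the proof only here and in
`finrank_eq`. -/
theorem norm_JMap_sq (Z : z) (X : v) : ‖JMap H.bracket Z X‖ ^ 2 = ‖Z‖ ^ 2 * ‖X‖ ^ 2 := by
  rw [← real_inner_self_eq_norm_sq (JMap H.bracket Z X), inner_JMap, bracket_swap, inner_neg_left,
    ← inner_JMap, H.J_sq, inner_smul_left, real_inner_self_eq_norm_sq]
  simp

/-- For a unit vector Z, (det J_Z)² = det(-1) = (-1)^{dim 𝔳}; a real square is not negative, so dim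
𝔳 is even and the integer division defining `m` is exact. -/
theorem finrank_eq : Module.finrank ℝ v = 2 * HTypeGroup.m H := by
  obtain ⟨X, Y, hXY⟩ := H.nonabelian
  set Z := (‖H.bracket X Y‖)⁻¹ • H.bracket X Y with hZ
  have hZ1 : ‖Z‖ = 1 := norm_smul_inv_norm (𝕜 := ℝ) hXY
  let J : v →ₗ[ℝ] v :=
    { toFun := JMap H.bracket Z
      map_add' := fun X Y => by simp [JMap]
      map_smul' := fun c X => by simp [JMap] }
  have hJ : J ∘ₗ J = (-1 : ℝ) • LinearMap.id := by
    ext X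
    change JMap H.bracket Z (JMap H.bracket Z X) = _
    rw [H.J_sq, hZ1]; simp
  have hdet := congrArg LinearMap.det hJ
  rw [LinearMap.det_comp, LinearMap.det_smul, LinearMap.det_id, mul_one] at hdet
  have heven : Even (Module.finrank ℝ v) := by
    by_contra hodd
    rw [Nat.not_even_iff_odd] at hodd
    rw [hodd.neg_one_pow] at hdet
    nlinarith [mul_self_nonneg (LinearMap.det J)]
  obtain ⟨c, hc⟩ := heven
  unfold HTypeGroup.m
  omega

end HTypeAlgebra

end JMap

/-! ### Convolution of product Gaussians -/

namespace HTypeGroup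

variable {v z : Type*} [NormedAddCommGroup v] [InnerProductSpace ℝ v]
  [FiniteDimensional ℝ v] [MeasurableSpace v] [BorelSpace v]
  [NormedAddCommGroup z] [InnerProductSpace ℝ z]
  [FiniteDimensional ℝ z] [MeasurableSpace z] [BorelSpace z] (H : HTypeAlgebra v z)

/-- The product Gaussian `exp (-b |X|² / 4)` times the normalized Gaussian of variance parameter
`r` in `Z`. -/
noncomputable def gaussN (b r : ℝ) (n : HTypeGroup H) : ℂ :=
  (Real.exp (-(b * ‖n.1‖ ^ 2 / 4)) : ℂ) * heat r n.2

/-- A Gaussian in `Z` whose variance parameter depends on `|X|`; convolutions of product Gaussians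
have this form. -/
noncomputable def skewGauss (B c r : ℝ) (n : HTypeGroup H) : ℂ :=
  (Real.exp (-(c * ‖n.1‖ ^ 2 / 4)) : ℂ) * heat (r + ‖n.1‖ ^ 2 / B) n.2

theorem integrable_gaussN {b r : ℝ} (hb : 0 < b) (hr : 0 < r) : Integrable (gaussN H b r) := by
  have h1 : Integrable fun X : v => (Real.exp (-(b * ‖X‖ ^ 2 / 4)) : ℂ) := by
    have := integrable_gaussian (E := v) (b := b / 4) (by positivity)
    refine this.ofReal.congr (Filter.Eventually.of_forall fun X => ?_)
    simp only []
    congr 3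
    ring
  exact h1.mul_prod (integrable_heat hr)

/-- The shift of Y by b'X/(b+b') centres the product of the two Gaussians and leaves the phase
unchanged, because J_l X is orthogonal to X. What remains is the Fourier transform of a Gaussian at
J_l X, and |J_l X| = |l||X| makes it radial. -/
theorem integral_twisted_gaussian {b b' : ℝ} (hb : 0 < b) (hb' : 0 < b') (X : v) (l : z) :
    ∫ Y : v, ((Real.exp (-(b * ‖Y‖ ^ 2 / 4)) * Real.exp (-(b' * ‖X - Y‖ ^ 2 / 4)) : ℝ) : ℂ) *
      Complex.exp ((Complex.I / 2) * (inner ℝ (JMap H.bracket l X) Y : ℝ)) =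
    (((4 * Real.pi / (b + b')) ^ m H *
      Real.exp (-(b * b' / (b + b') * ‖X‖ ^ 2 / 4)) : ℝ) : ℂ) *
      Complex.exp (-(‖l‖ ^ 2 * ‖X‖ ^ 2 / (4 * (b + b') : ℝ))) := by
  rw [← integral_add_right_eq_self _ ((b' / (b + b')) • X)]
  have h1 : ∀ Y : v, ((Real.exp (-(b * ‖Y + (b' / (b + b')) • X‖ ^ 2 / 4)) *
      Real.exp (-(b' * ‖X - (Y + (b' / (b + b')) • X)‖ ^ 2 / 4)) : ℝ) : ℂ) *
      Complex.exp ((Complex.I / 2) *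
        (inner ℝ (JMap H.bracket l X) (Y + (b' / (b + b')) • X) : ℝ)) =
      (Real.exp (-(b * b' / (b + b') * ‖X‖ ^ 2 / 4)) : ℂ) *
      Complex.exp (-(((b + b') / 4 : ℝ) * ‖Y‖ ^ 2) + (Complex.I / 2) *
        (inner ℝ (JMap H.bracket l X) Y : ℝ)) := by
    intro Y
    rw [inner_add_right, inner_smul_right, HTypeAlgebra.inner_JMap_self, mul_zero, add_zero,
      Complex.exp_add, ← mul_assoc]
    congr 1
    rw [show Complex.exp (-(((b + b') / 4 : ℝ) * ‖Y‖ ^ 2)) =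
      ((Real.exp (-((b + b') / 4 * ‖Y‖ ^ 2)) : ℝ) : ℂ) by push_cast; rfl, ← Complex.ofReal_mul]
    congr 1
    rw [← Real.exp_add, ← Real.exp_add]
    congr 1
    have e : X - (Y + (b' / (b + b')) • X) = (b / (b + b')) • X - Y := by
      have : X = (b / (b + b')) • X + (b' / (b + b')) • X := by
        rw [← add_smul, ← add_div, div_self (by positivity), one_smul]
      nth_rewrite 1 [this]
      abel
    rw [e, norm_add_sq_real, norm_sub_sq_real, inner_smul_right, inner_smul_left, norm_smul,
      norm_smul, real_inner_comm X Y, Real.norm_of_nonneg (by positivity),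
      Real.norm_of_nonneg (by positivity)]
    simp only [conj_trivial]
    field_simp
    ring
  simp_rw [h1]
  rw [integral_const_mul, integral_gaussian_linear (by positivity), Complex.ofReal_mul,
    mul_comm (((4 * Real.pi / (b + b')) ^ m H : ℝ) : ℂ), mul_assoc]
  congr 2
  · rw [HTypeAlgebra.finrank_eq H, Nat.cast_mul, Nat.cast_two, mul_div_cancel_left₀ _ two_ne_zero,
      Real.rpow_natCast]
    congr 2
    field_simp
  · congr 1
    have := HTypeAlgebra.norm_JMap_sq H l X
    rw [← Complex.ofReal_pow ‖JMap H.bracket l X‖, this, div_pow, Complex.I_sq]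
    push_cast
    have hB : (b : ℂ) + b' ≠ 0 := by exact_mod_cast (add_pos hb hb').ne'
    field_simp
    ring

/-- Expand the heat factor as a Fourier integral in l and integrate over Y first. The factor
e^{-|l|²|X|²/(4(b+b'))} so produced is Gaussian in l, and enlarges the variance parameter from R to
R + |X|²/(b+b'). -/
theorem integral_gaussian_heat_bracket {b b' R : ℝ} (hb : 0 < b) (hb' : 0 < b') (hR : 0 < R)
    (X : v) (Z : z) :
    ∫ Y : v, ((Real.exp (-(b * ‖Y‖ ^ 2 / 4)) * Real.exp (-(b' * ‖X - Y‖ ^ 2 / 4)) : ℝ) : ℂ) *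
      heat R (Z - (1 / 2 : ℝ) • H.bracket Y X) =
    (((4 * Real.pi / (b + b')) ^ m H : ℝ) : ℂ) *
      skewGauss H (b + b') (b * b' / (b + b')) R (X, Z) := by
  have hpi := Real.pi_pos
  have hc : ((((2 * Real.pi) ^ (Module.finrank ℝ z : ℝ) : ℝ)) : ℂ) ≠ 0 :=
    Complex.ofReal_ne_zero.2 (Real.rpow_pos_of_pos (by positivity) _).ne'
  refine mul_left_cancel₀ hc ?_
  rw [← integral_const_mul]
  let F : v → z → ℂ := fun Y l =>
    ((Real.exp (-(b * ‖Y‖ ^ 2 / 4)) * Real.exp (-(b' * ‖X - Y‖ ^ 2 / 4)) : ℝ) : ℂ) *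
      Complex.exp (-((R / 4 : ℝ) * ‖l‖ ^ 2) +
        Complex.I * (inner ℝ (Z - (1 / 2 : ℝ) • H.bracket Y X) l : ℝ))
  have h1 : ∀ Y : v, ((((2 * Real.pi) ^ (Module.finrank ℝ z : ℝ) : ℝ)) : ℂ) *
      (((Real.exp (-(b * ‖Y‖ ^ 2 / 4)) * Real.exp (-(b' * ‖X - Y‖ ^ 2 / 4)) : ℝ) : ℂ) *
      heat R (Z - (1 / 2 : ℝ) • H.bracket Y X)) = ∫ l, F Y l := by
    intro Y
    rw [integral_const_mul, integral_heat_fourier hR]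
    ring
  simp_rw [h1]
  have hint : Integrable (Function.uncurry F) (volume.prod volume) := by
    have hg := (integrable_gaussian (E := v) (b := b / 4) (by positivity)).mul_prod
      (integrable_gaussian (E := z) (b := R / 4) (by positivity))
    refine hg.mono' (Continuous.aestronglyMeasurable ?_) (Filter.Eventually.of_forall ?_)
    · have := (continuous_bracket H).comp
        (f := fun p : v × z => (p.1, X)) (by fun_prop)
      simp only [Function.comp_def] at this
      change Continuous fun p : v × z => _ * Complex.exp (_ +
        Complex.I * (inner ℝ (Z - (1 / 2 : ℝ) • H.bracket p.1 X) p.2 : ℝ))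
      fun_prop
    · rintro ⟨Y, l⟩
      simp only [Function.uncurry, F, norm_mul, Complex.norm_real, Complex.norm_exp]
      have e1 : (-((R / 4 : ℝ) * (‖l‖ : ℂ) ^ 2) +
        Complex.I * (inner ℝ (Z - (1 / 2 : ℝ) • H.bracket Y X) l : ℝ)).re =
          -(R / 4 * ‖l‖ ^ 2) := by
        simp [← Complex.ofReal_pow]
      rw [e1]
      refine mul_le_mul_of_nonneg_right ?_ (Real.exp_pos _).le
      rw [Real.norm_of_nonneg (Real.exp_pos _).le, Real.norm_of_nonneg (Real.exp_pos _).le]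
      have : Real.exp (-(b' * ‖X - Y‖ ^ 2 / 4)) ≤ 1 := Real.exp_le_one_iff.2 (by
        have : 0 ≤ b' * ‖X - Y‖ ^ 2 / 4 := by positivity
        linarith)
      calc _ ≤ Real.exp (-(b * ‖Y‖ ^ 2 / 4)) * 1 := by gcongr
        _ = _ := by rw [mul_one]; congr 1; ring
  rw [integral_integral_swap hint]
  have h2 : ∀ l : z, ∫ Y, F Y l = (((4 * Real.pi / (b + b')) ^ m H *
      Real.exp (-(b * b' / (b + b') * ‖X‖ ^ 2 / 4)) : ℝ) : ℂ) *
      Complex.exp (-(((R + ‖X‖ ^ 2 / (b + b')) / 4 : ℝ) * ‖l‖ ^ 2) +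
        Complex.I * (inner ℝ Z l : ℝ)) := by
    intro l
    have h3 : ∀ Y, F Y l = Complex.exp (-((R / 4 : ℝ) * ‖l‖ ^ 2) + Complex.I * (inner ℝ Z l : ℝ)) *
        (((Real.exp (-(b * ‖Y‖ ^ 2 / 4)) * Real.exp (-(b' * ‖X - Y‖ ^ 2 / 4)) : ℝ) : ℂ) *
      Complex.exp ((Complex.I / 2) * (inner ℝ (JMap H.bracket l X) Y : ℝ))) := by
      intro Y
      simp only [F]
      rw [mul_left_comm, ← Complex.exp_add, inner_sub_left, inner_smul_left,
        HTypeAlgebra.bracket_swap, inner_neg_left, ← inner_JMap]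
      congr 2
      push_cast
      simp
      ring
    simp_rw [h3]
    rw [integral_const_mul, integral_twisted_gaussian H hb hb', mul_left_comm, ← Complex.exp_add]
    congr 2
    push_cast
    have hB : (b : ℂ) + b' ≠ 0 := by exact_mod_cast (add_pos hb hb').ne'
    field_simp
    ring
  simp_rw [h2]
  rw [integral_const_mul, integral_heat_fourier (by positivity)]
  change _ = _ * (_ * ((Real.exp (-(b * b' / (b + b') * ‖X‖ ^ 2 / 4)) : ℂ) *
    heat (R + ‖X‖ ^ 2 / (b + b')) Z))
  push_cast
  ring

/-- The inner integral over 𝔷 merges r and r' into r + r' before 𝔳 is touched. The identity is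
almost everywhere because Fubini is applied at points n where the convolution integrand is
integrable. -/
theorem conv_gaussN {b b' r r' : ℝ} (hb : 0 < b) (hb' : 0 < b') (hr : 0 < r) (hr' : 0 < r') :
    conv (gaussN H b r) (gaussN H b' r') =ᵐ[volume] fun n =>
      (((4 * Real.pi / (b + b')) ^ m H : ℝ) : ℂ) *
        skewGauss H (b + b') (b * b' / (b + b')) (r + r') n := by
  filter_upwards [conv_integrand_ae (integrable_gaussN H hb hr) (integrable_gaussN H hb' hr')]
    with n hn
  rw [conv]
  have h0 := integral_prod (μ := (volume : Measure v)) (ν := (volume : Measure z)) _ hn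
  refine h0.trans ?_
  refine Eq.trans ?_
    (integral_gaussian_heat_bracket H hb hb' (add_pos hr hr') n.1 n.2)
  refine integral_congr_ae (Filter.Eventually.of_forall fun Y => ?_)
  simp only []
  rw [← integral_heat_conv hr hr', ← integral_const_mul]
  refine integral_congr_ae (Filter.Eventually.of_forall fun W => ?_)
  have e : ∀ n' : HTypeGroup H, gaussN H b' r' (n'⁻¹ * n) =
      (Real.exp (-(b' * ‖n.1 - n'.1‖ ^ 2 / 4)) : ℂ) *
        heat r' (n.2 - (1 / 2 : ℝ) • H.bracket n'.1 n.1 - n'.2) := by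
    intro n'
    rw [inv_mul_eq, sub_right_comm n.2]
    rfl
  refine (congrArg (fun t => gaussN H b r (Y, W) * t) (e (Y, W))).trans ?_
  change (Real.exp (-(b * ‖Y‖ ^ 2 / 4)) : ℂ) * heat r W * _ = _
  push_cast
  ring

end HTypeGroup

/-! ### Density of Gaussians among biradial functions -/

namespace HTypeGroup

variable {v z : Type*} [NormedAddCommGroup v] [InnerProductSpace ℝ v]
  [FiniteDimensional ℝ v] [MeasurableSpace v] [BorelSpace v]
  [NormedAddCommGroup z] [InnerProductSpace ℝ z]
  [FiniteDimensional ℝ z] [MeasurableSpace z] [BorelSpace z] (H : HTypeAlgebra v z)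

theorem measurable_normPair : Measurable fun n : HTypeGroup H => (‖n.1‖, ‖n.2‖) := by
  have h : Measurable fun n : v × z => (‖n.1‖, ‖n.2‖) := by fun_prop
  exact h

/-- Composition with (|X|, |Z|) is an isometry from the complete L¹ space of the image measure, and
its range is exactly the biradial subspace. -/
theorem isClosed_biradialL1 : IsClosed (biradialL1 H : Set (HTypeGroup H →₁[volume] ℂ)) := by
  have hp := (measurable_normPair H).measurePreserving (volume : Measure (HTypeGroup H))
  set ρ := Measure.map (fun n : HTypeGroup H => (‖n.1‖, ‖n.2‖)) volume with hρ
  let ι := Lp.compMeasurePreservingₗᵢ ℂ (E := ℂ) (p := 1) _ hp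
  have hr : (biradialL1 H : Set (HTypeGroup H →₁[volume] ℂ)) = Set.range ι := by
    ext f
    constructor
    · rintro ⟨f₀, hf₀, hf⟩
      have hi : Integrable f₀ ρ := by
        rw [hρ, integrable_map_measure hf₀.aestronglyMeasurable
          (measurable_normPair H).aemeasurable]
        exact (integrable_congr hf).1 (L1.integrable_coeFn f)
      refine ⟨hi.toL1 f₀, Lp.ext ?_⟩
      filter_upwards [hf, Lp.coeFn_compMeasurePreserving (hi.toL1 f₀) hp,
        hp.quasiMeasurePreserving.ae hi.coeFn_toL1] with n h1 h2 h3
      rw [h1]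
      exact h2.trans h3
    · rintro ⟨g, rfl⟩
      have hm := (Lp.aestronglyMeasurable g).aemeasurable
      refine ⟨hm.mk, hm.measurable_mk, ?_⟩
      filter_upwards [Lp.coeFn_compMeasurePreserving g hp,
        hp.quasiMeasurePreserving.ae hm.ae_eq_mk] with n h2 h3
      exact h2.trans h3
  rw [hr]
  exact ι.isometry.isClosedEmbedding.isClosed_range

/-- The product Gaussians as elements of `L¹(N)`. -/
noncomputable def gaussL1 {b r : ℝ} (hb : 0 < b) (hr : 0 < r) : HTypeGroup H →₁[volume] ℂ :=
  (integrable_gaussN H hb hr).toL1 _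

theorem coeFn_gaussL1 {b r : ℝ} (hb : 0 < b) (hr : 0 < r) :
    gaussL1 H hb hr =ᵐ[volume] gaussN H b r := Integrable.coeFn_toL1 _

theorem gaussL1_mem {b r : ℝ} (hb : 0 < b) (hr : 0 < r) : gaussL1 H hb hr ∈ biradialL1 H := by
  refine ⟨fun p => (Real.exp (-(b * p.1 ^ 2 / 4)) : ℂ) * (((Real.pi * r) ^
    (-(Module.finrank ℝ z : ℝ) / 2) * Real.exp (-(p.2 ^ 2 / r)) : ℝ) : ℂ), by fun_prop, ?_⟩
  filter_upwards [coeFn_gaussL1 H hb hr] with n hn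
  rw [hn, gaussN, heat]

/-- The linear span of the product Gaussians. -/
noncomputable def gaussSpan : Submodule ℂ (HTypeGroup H →₁[volume] ℂ) :=
  Submodule.span ℂ {f | ∃ (b r : ℝ) (hb : 0 < b) (hr : 0 < r), f = gaussL1 H hb hr}

/-- The compactified biradial coordinates `(exp (-|X|² / 4), exp (-|Z|²))`. -/
noncomputable def expCoord (n : HTypeGroup H) : unitInterval × unitInterval :=
  (⟨Real.exp (-(‖n.1‖ ^ 2 / 4)), (Real.exp_pos _).le, Real.exp_le_one_iff.2 (by
    have : 0 ≤ ‖n.1‖ ^ 2 / 4 := by positivity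
    linarith)⟩,
   ⟨Real.exp (-(‖n.2‖ ^ 2)), (Real.exp_pos _).le, Real.exp_le_one_iff.2 (by
    have : 0 ≤ ‖n.2‖ ^ 2 := by positivity
    linarith)⟩)

theorem measurable_expCoord : Measurable (expCoord H) := by
  have h : Measurable fun n : v × z =>
      (Real.exp (-(‖n.1‖ ^ 2 / 4)), Real.exp (-(‖n.2‖ ^ 2))) := by fun_prop
  exact (Measurable.subtype_mk h.fst).prodMk (Measurable.subtype_mk h.snd)

/-- The Gaussian weight `exp (-|X|² / 4 - |Z|²)`. -/
noncomputable def weight (n : HTypeGroup H) : ℝ :=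
  Real.exp (-(‖n.1‖ ^ 2 / 4)) * Real.exp (-(‖n.2‖ ^ 2))

theorem weight_pos (n : HTypeGroup H) : 0 < weight H n :=
  mul_pos (Real.exp_pos _) (Real.exp_pos _)

theorem measurable_weight : Measurable (weight H) := by
  have h : Measurable fun n : v × z =>
    Real.exp (-(‖n.1‖ ^ 2 / 4)) * Real.exp (-(‖n.2‖ ^ 2)) := by fun_prop
  exact h

theorem integrable_weight : Integrable (weight H) := by
  have h := (integrable_gaussian (E := v) (b := 1 / 4) (by norm_num)).mul_prod
      (integrable_gaussian (E := z) (b := 1) (by norm_num))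
  refine h.congr (Filter.Eventually.of_forall fun n => ?_)
  change Real.exp _ * Real.exp _ = Real.exp _ * Real.exp _
  congr 2 <;> ring

theorem integrable_comp_expCoord_mul_weight (F : C(unitInterval × unitInterval, ℂ)) :
    Integrable fun n => F (expCoord H n) * (weight H n : ℂ) :=
  (integrable_weight H).ofReal.bdd_mul
    (F.continuous.measurable.comp (measurable_expCoord H)).aestronglyMeasurable
    (Filter.Eventually.of_forall fun _ => F.norm_coe_le_norm _)

/-- `F ↦ F (expCoord) · weight` from continuous functions on the square to `L¹(N)`. -/
noncomputable def ofSquare : C(unitInterval × unitInterval, ℂ) →L[ℂ] (HTypeGroup H →₁[volume] ℂ) :=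
  LinearMap.mkContinuous
    { toFun := fun F => (integrable_comp_expCoord_mul_weight H F).toL1 _
      map_add' := fun F G => by
        rw [← Integrable.toL1_add, Integrable.toL1_eq_toL1_iff]
        refine Filter.Eventually.of_forall fun n => ?_
        simp [add_mul]
      map_smul' := fun c F => by
        rw [RingHom.id_apply, ← Integrable.toL1_smul, Integrable.toL1_eq_toL1_iff]
        refine Filter.Eventually.of_forall fun n => ?_
        simp [mul_assoc] }
    (∫ n, weight H n) (fun F => by
      simp only [LinearMap.coe_mk, AddHom.coe_mk]
      rw [L1.norm_of_fun_eq_integral_norm, mul_comm, ← integral_const_mul]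
      refine integral_mono (integrable_comp_expCoord_mul_weight H F).norm
        ((integrable_weight H).const_mul _) fun n => ?_
      simp only []
      rw [norm_mul, Complex.norm_real, Real.norm_of_nonneg (weight_pos H n).le]
      exact mul_le_mul_of_nonneg_right (F.norm_coe_le_norm _) (weight_pos H n).le)

theorem ofSquare_apply (F : C(unitInterval × unitInterval, ℂ)) :
    ofSquare H F = (integrable_comp_expCoord_mul_weight H F).toL1 _ := rfl

/-- Stone–Weierstrass on the square. The monomial U^i V^j times the weight is a multiple of the
Gaussian with b = i + 1 and r = 1/(j + 1), the shifts by one coming from the weight. -/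
theorem ofSquare_mem_closure (F : C(unitInterval × unitInterval, ℂ)) :
    ofSquare H F ∈ (gaussSpan H).topologicalClosure := by
  let U : C(unitInterval × unitInterval, ℂ) := ⟨fun p => ((p.1 : ℝ) : ℂ), by fun_prop⟩
  let V : C(unitInterval × unitInterval, ℂ) := ⟨fun p => ((p.2 : ℝ) : ℂ), by fun_prop⟩
  let A : StarSubalgebra ℂ C(unitInterval × unitInterval, ℂ) := StarAlgebra.adjoin ℂ {U, V}
  have hsep : A.SeparatesPoints := by
    intro p q hpq
    by_cases h : p.1 = q.1
    · refine ⟨_, ⟨V, StarAlgebra.subset_adjoin ℂ _ (by simp), rfl⟩, fun h2 => hpq ?_⟩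
      refine Prod.ext h (Subtype.ext ?_)
      exact Complex.ofReal_injective h2
    · refine ⟨_, ⟨U, StarAlgebra.subset_adjoin ℂ _ (by simp), rfl⟩, fun h2 => h ?_⟩
      exact Subtype.ext (Complex.ofReal_injective h2)
  have htop := ContinuousMap.starSubalgebra_topologicalClosure_eq_top_of_separatesPoints A hsep
  have hmono : ∀ i j : ℕ, ofSquare H (U ^ i * V ^ j) ∈ gaussSpan H := by
    intro i j
    have hr : (0 : ℝ) < 1 / (j + 1) := by positivity
    have hb : (0 : ℝ) < i + 1 := by positivity
    have hc : (Real.pi * (1 / (j + 1))) ^ (-(Module.finrank ℝ z : ℝ) / 2) ≠ 0 :=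
      (Real.rpow_pos_of_pos (by have := Real.pi_pos; positivity) _).ne'
    have e : ofSquare H (U ^ i * V ^ j) =
        (((Real.pi * (1 / (j + 1))) ^ (-(Module.finrank ℝ z : ℝ) / 2) : ℝ) : ℂ)⁻¹ •
          gaussL1 H hb hr := by
      rw [gaussL1, ← Integrable.toL1_smul, ofSquare_apply, Integrable.toL1_eq_toL1_iff]
      refine Filter.Eventually.of_forall fun n => ?_
      have hc' := Complex.ofReal_ne_zero.2 hc
      simp only [smul_eq_mul, gaussN, heat, Complex.ofReal_mul]
      rw [mul_left_comm _ (Complex.ofReal ((Real.pi * (1 / (j + 1))) ^ _)), inv_mul_cancel_left₀ hc']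
      simp only [ContinuousMap.mul_apply, ContinuousMap.pow_apply, U, V, ContinuousMap.coe_mk,
        expCoord, weight, ← Complex.ofReal_pow, ← Complex.ofReal_mul]
      congr 1
      rw [← Real.exp_nat_mul, ← Real.exp_nat_mul, ← Real.exp_add, ← Real.exp_add, ← Real.exp_add,
        ← Real.exp_add]
      congr 1
      field_simp
      ring
    rw [e]
    exact Submodule.smul_mem _ _ (Submodule.subset_span ⟨_, _, hb, hr, rfl⟩)
  have hA : ∀ G ∈ A, ofSquare H G ∈ gaussSpan H := by
    intro G hG
    have h1 : G ∈ (StarAlgebra.adjoin ℂ ({U, V} : Set _)).toSubalgebra := hG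
    -- U and V are real valued, so conjugation adds no generators and the star subalgebra is spanned
    -- by monomials.
    have hst : star ({U, V} : Set C(unitInterval × unitInterval, ℂ)) = {U, V} := by
      have hU : star U = U := by ext p; simp [U]
      have hV : star V = V := by ext p; simp [V]
      ext G
      simp only [Set.mem_star, Set.mem_insert_iff, Set.mem_singleton_iff]
      rw [star_eq_iff_star_eq, @star_eq_iff_star_eq _ _ G V, hU, hV, eq_comm, @eq_comm _ V]
    rw [StarAlgebra.adjoin_toSubalgebra, hst, Set.union_self] at h1
    have h2 : G ∈ Submodule.span ℂ (Submonoid.closure {U, V} :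
        Set C(unitInterval × unitInterval, ℂ)) := by
      rw [← Algebra.adjoin_eq_span]; exact h1
    have h3 : Submodule.span ℂ (Submonoid.closure {U, V} :
        Set C(unitInterval × unitInterval, ℂ)) ≤ (gaussSpan H).comap (ofSquare H).toLinearMap := by
      rw [Submodule.span_le]
      intro G hG
      obtain ⟨i, j, rfl⟩ := (Submonoid.mem_closure_pair _ _ _).1 hG
      exact hmono i j
    exact h3 h2
  have hF : F ∈ A.topologicalClosure := by rw [htop]; trivial
  have hF' : F ∈ closure (A : Set C(unitInterval × unitInterval, ℂ)) := hF
  exact map_mem_closure (ofSquare H).continuous hF' hA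

/-- In the compactified coordinates a biradial function is h times the weight, with h integrable for
a finite measure on the square. Approximating h there by bounded continuous functions reduces the
claim to `ofSquare_mem_closure`. -/
theorem biradialL1_le_closure : biradialL1 H ≤ (gaussSpan H).topologicalClosure := by
  rintro f ⟨f₀, hf₀, hf⟩
  let ρ : Measure (HTypeGroup H) := volume.withDensity fun n => ENNReal.ofReal (weight H n)
  have hρ : IsFiniteMeasure ρ :=
    isFiniteMeasure_withDensity_ofReal (integrable_weight H).hasFiniteIntegral
  let μ : Measure (unitInterval × unitInterval) := Measure.map (expCoord H) ρ
  have hμ : IsFiniteMeasure μ := Measure.isFiniteMeasure_map ρ _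
  have hint : ∀ g : HTypeGroup H → ℝ, ∫ n, g n ∂ρ = ∫ n, weight H n * g n := by
    intro g
    rw [integral_withDensity_eq_integral_toReal_smul
      (measurable_weight H).ennreal_ofReal (by simp)]
    refine integral_congr_ae (Filter.Eventually.of_forall fun n => ?_)
    simp only []
    rw [ENNReal.toReal_ofReal (weight_pos H n).le, smul_eq_mul]
  -- The logarithms and square roots invert `expCoord`; the denominator is the weight.
  let h : unitInterval × unitInterval → ℂ := fun p =>
    f₀ (Real.sqrt (-(4 * Real.log p.1)), Real.sqrt (-Real.log p.2)) / ((p.1 * p.2 : ℝ) : ℂ)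
  have hhm : Measurable h := by
    refine (hf₀.comp ?_).div (by fun_prop)
    fun_prop
  have hh : ∀ n, h (expCoord H n) = f₀ (‖n.1‖, ‖n.2‖) / (weight H n : ℂ) := by
    intro n
    simp only [h, expCoord, Real.log_exp, weight]
    rw [show -(4 * -(‖n.1‖ ^ 2 / 4)) = ‖n.1‖ ^ 2 by ring, neg_neg, Real.sqrt_sq (norm_nonneg _),
      Real.sqrt_sq (norm_nonneg _)]
  have hf₀i : Integrable fun n : HTypeGroup H => f₀ (‖n.1‖, ‖n.2‖) :=
    (integrable_congr hf).1 (L1.integrable_coeFn f)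
  have hhi : Integrable h μ := by
    rw [integrable_map_measure hhm.aestronglyMeasurable (measurable_expCoord H).aemeasurable,
      integrable_withDensity_iff_integrable_smul₀' (measurable_weight H).ennreal_ofReal.aemeasurable
        (by simp)]
    refine hf₀i.congr (Filter.Eventually.of_forall fun n => ?_)
    have hw : (weight H n : ℂ) ≠ 0 := Complex.ofReal_ne_zero.2 (weight_pos H n).ne'
    simp only [Function.comp, hh]
    rw [ENNReal.toReal_ofReal (weight_pos H n).le, Complex.real_smul]
    field_simp
  change f ∈ closure (gaussSpan H : Set (HTypeGroup H →₁[volume] ℂ))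
  rw [← closure_closure, Metric.mem_closure_iff]
  intro ε hε
  obtain ⟨g, hg, -⟩ := hhi.exists_boundedContinuous_integral_sub_le (half_pos hε)
  refine ⟨ofSquare H g.toContinuousMap, ofSquare_mem_closure H _, ?_⟩
  have hfe : f = hf₀i.toL1 _ := by
    rw [← Integrable.toL1_coeFn f (L1.integrable_coeFn f)]
    exact (Integrable.toL1_eq_toL1_iff _ _ _ _).2 hf
  rw [dist_eq_norm, hfe, ofSquare_apply, ← Integrable.toL1_sub, L1.norm_of_fun_eq_integral_norm]
  refine lt_of_le_of_lt (le_of_eq_of_le ?_ hg) (half_lt_self hε)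
  refine Eq.trans ?_ ((hint _).symm.trans (integral_map (f := fun p => ‖h p - g p‖)
    (measurable_expCoord H).aemeasurable
    (hhm.sub g.continuous.measurable).norm.aestronglyMeasurable).symm)
  refine integral_congr_ae (Filter.Eventually.of_forall fun n => ?_)
  have e : ∀ (A G : ℂ) (w : ℝ), 0 < w → ‖A - G * w‖ = w * ‖A / w - G‖ := by
    intro A G w hw
    have hw' : (w : ℂ) ≠ 0 := Complex.ofReal_ne_zero.2 hw.ne'
    rw [show A - G * w = w * (A / w - G) by field_simp, norm_mul, Complex.norm_real,
      Real.norm_of_nonneg hw.le]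
  simp only [hh]
  exact e _ _ _ (weight_pos H n)

/-- Two bounded functionals on `L¹(N)` which agree on product Gaussians agree on biradial
functions. -/
theorem eq_on_biradial_of_eq_on_gauss (Λ₁ Λ₂ : (HTypeGroup H →₁[volume] ℂ) →L[ℂ] ℂ)
    (h : ∀ (b r : ℝ) (hb : 0 < b) (hr : 0 < r), Λ₁ (gaussL1 H hb hr) = Λ₂ (gaussL1 H hb hr))
    {f : HTypeGroup H →₁[volume] ℂ} (hf : f ∈ biradialL1 H) : Λ₁ f = Λ₂ f := by
  have h1 : (gaussSpan H).topologicalClosure ≤ LinearMap.ker (Λ₁ - Λ₂).toLinearMap := by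
    refine Submodule.topologicalClosure_minimal _ ?_ (Λ₁ - Λ₂).isClosed_ker
    rw [gaussSpan, Submodule.span_le]
    rintro f ⟨b, r, hb, hr, rfl⟩
    simp [h b r hb hr]
  have := h1 (biradialL1_le_closure H hf)
  simpa [sub_eq_zero] using this

/-- For two Gaussians the explicit convolution depends only on |X| and |Z|. Density, continuity in
each variable and closedness of the biradial subspace extend this one argument at a time. -/
theorem convL_mem {f g : HTypeGroup H →₁[volume] ℂ} (hf : f ∈ biradialL1 H)
    (hg : g ∈ biradialL1 H) : convL H f g ∈ biradialL1 H := by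
  have h0 : ∀ (b r b' r' : ℝ) (hb : 0 < b) (hr : 0 < r) (hb' : 0 < b') (hr' : 0 < r'),
      convL H (gaussL1 H hb hr) (gaussL1 H hb' hr') ∈ biradialL1 H := by
    intro b r b' r' hb hr hb' hr'
    refine ⟨fun p => (((4 * Real.pi / (b + b')) ^ m H : ℝ) : ℂ) *
      ((Real.exp (-(b * b' / (b + b') * p.1 ^ 2 / 4)) : ℂ) *
      (((Real.pi * (r + r' + p.1 ^ 2 / (b + b'))) ^
      (-(Module.finrank ℝ z : ℝ) / 2) *
        Real.exp (-(p.2 ^ 2 / (r + r' + p.1 ^ 2 / (b + b')))) : ℝ) : ℂ)), by fun_prop, ?_⟩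
    filter_upwards [coeFn_convL (gaussL1 H hb hr) (gaussL1 H hb' hr'),
      conv_congr_ae (coeFn_gaussL1 H hb hr) (coeFn_gaussL1 H hb' hr'),
      conv_gaussN H hb hb' hr hr'] with n h1 h2 h3
    rw [h1, h2, h3, skewGauss, heat]
  have h1 : ∀ (b r : ℝ) (hb : 0 < b) (hr : 0 < r), biradialL1 H ≤
      (biradialL1 H).comap (convL H (gaussL1 H hb hr)).toLinearMap := by
    intro b r hb hr
    refine (biradialL1_le_closure H).trans (Submodule.topologicalClosure_minimal _ ?_
      ((isClosed_biradialL1 H).preimage (convL H (gaussL1 H hb hr)).continuous))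
    rw [gaussSpan, Submodule.span_le]
    rintro f ⟨b', r', hb', hr', rfl⟩
    exact h0 b r b' r' hb hr hb' hr'
  have h2 : biradialL1 H ≤ (biradialL1 H).comap ((convL H).flip g).toLinearMap := by
    refine (biradialL1_le_closure H).trans (Submodule.topologicalClosure_minimal _ ?_
      ((isClosed_biradialL1 H).preimage ((convL H).flip g).continuous))
    rw [gaussSpan, Submodule.span_le]
    rintro f ⟨b', r', hb', hr', rfl⟩
    exact h1 b' r' hb' hr' hg
  exact h2 hf

end HTypeGroup

/-! ### Characters are contractive and have bounded densities -/

/-- The functional on `L¹(μ)` given by integration against a bounded measurable function. -/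
noncomputable def functionalOfDensity {α : Type*} [MeasurableSpace α] (μ : Measure α) {φ : α → ℂ}
    (hφ : Measurable φ) {C : ℝ} (hC : ∀ x, ‖φ x‖ ≤ C) : (α →₁[μ] ℂ) →L[ℂ] ℂ :=
  have hi : ∀ f : α →₁[μ] ℂ, Integrable (fun x => φ x * f x) μ := fun f =>
    (L1.integrable_coeFn f).bdd_mul hφ.aestronglyMeasurable (Filter.Eventually.of_forall hC)
  LinearMap.mkContinuous
    { toFun := fun f => ∫ x, φ x * f x ∂μ
      map_add' := fun f g => by
        rw [← integral_add (hi f) (hi g)]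
        refine integral_congr_ae ?_
        filter_upwards [Lp.coeFn_add f g] with x hx
        rw [hx, Pi.add_apply, mul_add]
      map_smul' := fun c f => by
        rw [RingHom.id_apply, smul_eq_mul, ← integral_const_mul]
        refine integral_congr_ae ?_
        filter_upwards [Lp.coeFn_smul c f] with x hx
        rw [hx, Pi.smul_apply, smul_eq_mul, mul_left_comm] }
    C (fun f => by
      rw [L1.norm_eq_integral_norm, ← integral_const_mul]
      refine (norm_integral_le_integral_norm _).trans (integral_mono (hi f).norm
        ((L1.integrable_coeFn f).norm.const_mul _) fun x => ?_)
      simp only [norm_mul]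
      exact mul_le_mul_of_nonneg_right (hC x) (norm_nonneg _))

theorem functionalOfDensity_apply {α : Type*} [MeasurableSpace α] (μ : Measure α) {φ : α → ℂ}
    (hφ : Measurable φ) {C : ℝ} (hC : ∀ x, ‖φ x‖ ≤ C) (f : α →₁[μ] ℂ) :
    functionalOfDensity μ hφ hC f = ∫ x, φ x * f x ∂μ := rfl

namespace HTypeGroup

variable {v z : Type*} [NormedAddCommGroup v] [InnerProductSpace ℝ v]
  [FiniteDimensional ℝ v] [MeasurableSpace v] [BorelSpace v]
  [NormedAddCommGroup z] [InnerProductSpace ℝ z]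
  [FiniteDimensional ℝ z] [MeasurableSpace z] [BorelSpace z] {H : HTypeAlgebra v z}

theorem gelfandSpectrum_map_convL {ψ : biradialL1 H →ₗ[ℂ] ℂ} (hψ : ψ ∈ gelfandSpectrum H)
    (f g : biradialL1 H) : ψ ⟨convL H f g, convL_mem H f.2 g.2⟩ = ψ f * ψ g :=
  hψ.2 f g _ (coeFn_convL _ _)

/-- Otherwise some f₁ has norm less than 1 and ψ(f₁) = 1. Solving g - f₁ * g = f₁ and applying ψ
gives 0 = 1. The equation is solved by a Neumann series for the operator of convolution by f₁, so
neither a unit nor associativity is needed. -/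
theorem gelfandSpectrum_norm_le {ψ : biradialL1 H →ₗ[ℂ] ℂ} (hψ : ψ ∈ gelfandSpectrum H)
    (f : biradialL1 H) : ‖ψ f‖ ≤ ‖f‖ := by
  by_contra! hlt
  have hne : ψ f ≠ 0 := by
    intro h0
    rw [h0, norm_zero] at hlt
    exact absurd (norm_nonneg f) (not_le.2 hlt)
  set f₁ : biradialL1 H := (ψ f)⁻¹ • f with hf₁
  have h1 : ψ f₁ = 1 := by rw [hf₁, map_smul, smul_eq_mul, inv_mul_cancel₀ hne]
  have h2 : ‖f₁‖ < 1 := by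
    rw [hf₁, norm_smul, norm_inv]
    rw [inv_mul_lt_one₀ (norm_pos_iff.2 hne)]
    exact hlt
  let T : biradialL1 H →L[ℂ] biradialL1 H := LinearMap.mkContinuous
    ((convL H (f₁ : HTypeGroup H →₁[volume] ℂ)).toLinearMap.restrict
      (p := biradialL1 H) (q := biradialL1 H) fun g hg => convL_mem H f₁.2 hg) ‖f₁‖
    (fun g => norm_convL_le _ _)
  have hT : ‖T‖ < 1 := (LinearMap.mkContinuous_norm_le _ (norm_nonneg _) _).trans_lt h2
  have : CompleteSpace (biradialL1 H) := (isClosed_biradialL1 H).completeSpace_coe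
  let u := Units.oneSub T hT
  set g : biradialL1 H := (↑u⁻¹ : biradialL1 H →L[ℂ] biradialL1 H) f₁ with hg
  have h3 : g - T g = f₁ := by
    have := congrArg (fun S : biradialL1 H →L[ℂ] biradialL1 H => S f₁) u.mul_inv
    simpa [u] using this
  have h4 : ψ (T g) = ψ f₁ * ψ g := gelfandSpectrum_map_convL hψ f₁ g
  have h5 := congrArg ψ h3
  rw [map_sub, h4, h1, one_mul, sub_self] at h5
  exact zero_ne_one h5

/-- Hahn–Banach extends the contractive functional to all of L¹(N), where duality applies. The
density obtained need not be biradial. -/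
theorem exists_density_of_mem_gelfandSpectrum {ψ : biradialL1 H →ₗ[ℂ] ℂ}
    (hψ : ψ ∈ gelfandSpectrum H) :
    ∃ φ : HTypeGroup H → ℂ, Measurable φ ∧ (∃ C : ℝ, ∀ n, ‖φ n‖ ≤ C) ∧
      ∀ f : biradialL1 H, ψ f = ∫ n, φ n * (f : HTypeGroup H →₁[volume] ℂ) n := by
  let ψ' : StrongDual ℂ (biradialL1 H) := ψ.mkContinuous 1 fun f => by
    rw [one_mul]; exact gelfandSpectrum_norm_le hψ f
  obtain ⟨Ψ, hΨ, -⟩ := exists_extension_norm_eq (biradialL1 H) ψ'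
  have hw2 : MemLp (weight H) 2 volume := by
    rw [memLp_two_iff_integrable_sq (measurable_weight H).aestronglyMeasurable]
    refine (integrable_weight H).mono' ((measurable_weight H).pow_const 2).aestronglyMeasurable
      (Filter.Eventually.of_forall fun n => ?_)
    have h0 := weight_pos H n
    have h1 : weight H n ≤ 1 := by
      unfold weight
      refine mul_le_one₀ ?_ (Real.exp_pos _).le ?_ <;> rw [Real.exp_le_one_iff]
      · have : 0 ≤ ‖n.1‖ ^ 2 / 4 := by positivity
        linarith
      · have : 0 ≤ ‖n.2‖ ^ 2 := by positivity
        linarith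
    rw [Real.norm_of_nonneg (by positivity)]
    nlinarith
  obtain ⟨φ, hφm, hφb, hφ⟩ := exists_bounded_density_of_dual_L1 (measurable_weight H)
    (weight_pos H) hw2 Ψ
  refine ⟨φ, hφm, hφb, fun f => ?_⟩
  rw [← hφ, hΨ]
  rfl

end HTypeGroup

/-! ### Holomorphy in the half plane and the differential equation -/

theorem isOpen_re_pos : IsOpen {s : ℂ | 0 < s.re} :=
  isOpen_lt continuous_const Complex.continuous_re

theorem isPreconnected_re_pos : IsPreconnected {s : ℂ | 0 < s.re} :=
  (convex_halfSpace_re_gt 0).isPreconnected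

/-- Laplace type integrals are holomorphic in the right half plane. -/
theorem differentiableOn_laplace {α : Type*} [MeasurableSpace α] {μ : Measure α} {g : α → ℂ}
    (hg : Measurable g) {q : α → ℝ} (hqm : Measurable q) (hq : ∀ x, 0 ≤ q x)
    (hi : ∀ ε : ℝ, 0 < ε → Integrable (fun x => ‖g x‖ * Real.exp (-(ε * q x))) μ) :
    DifferentiableOn ℂ (fun s : ℂ => ∫ x, g x * Complex.exp (-(s * q x)) ∂μ) {s | 0 < s.re} := by
  intro s hs
  have hs' : 0 < s.re := hs
  refine DifferentiableAt.differentiableWithinAt ?_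
  have hmeas : ∀ s : ℂ, AEStronglyMeasurable (fun x => g x * Complex.exp (-(s * q x))) μ := by
    intro s
    refine Measurable.aestronglyMeasurable ?_
    fun_prop
  have hnorm : ∀ (w : ℂ) x, ‖Complex.exp (-(w * q x))‖ = Real.exp (-(w.re * q x)) := by
    intro w x
    rw [Complex.norm_exp]
    simp
  refine (hasDerivAt_integral_of_dominated_loc_of_deriv_le (μ := μ) (𝕜 := ℂ)
    (F := fun s x => g x * Complex.exp (-(s * q x)))
    (F' := fun s x => g x * (Complex.exp (-(s * q x)) * (-(q x : ℂ)))) (x₀ := s)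
    (s := Metric.ball s (s.re / 2))
    (bound := fun x => (4 / s.re) * (‖g x‖ * Real.exp (-(s.re / 4 * q x))))
    (Metric.ball_mem_nhds _ (by positivity)) (Filter.Eventually.of_forall hmeas) ?_ ?_ ?_ ?_
    ?_).2.differentiableAt
  · refine (hi s.re hs').mono' (hmeas s) (Filter.Eventually.of_forall fun x => ?_)
    rw [norm_mul, hnorm]
  · refine Measurable.aestronglyMeasurable ?_
    fun_prop
  · refine Filter.Eventually.of_forall fun x w hw => ?_
    have h1 : s.re / 2 ≤ w.re := by
      rw [Metric.mem_ball, dist_eq_norm] at hw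
      have h2 := (Complex.abs_re_le_norm (w - s)).trans_lt hw
      rw [Complex.sub_re, abs_lt] at h2
      linarith
    rw [norm_mul, norm_mul, hnorm, norm_neg, Complex.norm_real, Real.norm_of_nonneg (hq x),
      mul_left_comm (4 / s.re)]
    refine mul_le_mul_of_nonneg_left ?_ (norm_nonneg (g x))
    have h3 : q x ≤ 4 / s.re * Real.exp (s.re / 4 * q x) := by
      have := Real.add_one_le_exp (s.re / 4 * q x)
      rw [div_mul_eq_mul_div, le_div_iff₀ hs']
      linarith
    calc Real.exp (-(w.re * q x)) * q x
        ≤ Real.exp (-(s.re / 2 * q x)) * (4 / s.re * Real.exp (s.re / 4 * q x)) := by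
          refine mul_le_mul (Real.exp_le_exp.2 ?_) h3 (hq x) (Real.exp_pos _).le
          have := mul_le_mul_of_nonneg_right h1 (hq x)
          linarith
      _ = 4 / s.re * Real.exp (-(s.re / 4 * q x)) := by
          rw [mul_left_comm, ← Real.exp_add]
          congr 2
          ring
  · exact (hi (s.re / 4) (by positivity)).const_mul _
  · refine Filter.Eventually.of_forall fun x w _ => ?_
    refine HasDerivAt.const_mul _ (HasDerivAt.cexp ?_)
    have := ((hasDerivAt_id w).mul_const (q x : ℂ)).fun_neg
    rwa [one_mul] at this

/-- A function holomorphic in the right half plane is determined by its values on the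
positive reals. -/
theorem eq_of_eq_on_pos_real {F G : ℂ → ℂ} (hF : DifferentiableOn ℂ F {s | 0 < s.re})
    (hG : DifferentiableOn ℂ G {s | 0 < s.re}) (h : ∀ s : ℝ, 0 < s → F s = G s) {s : ℂ}
    (hs : 0 < s.re) : F s = G s := by
  refine (hF.analyticOnNhd isOpen_re_pos).eqOn_of_preconnected_of_frequently_eq
    (hG.analyticOnNhd isOpen_re_pos) isPreconnected_re_pos (z₀ := 1) (by simp) ?_ hs
  have ht : Filter.Tendsto (fun t : ℝ => (t : ℂ)) (nhdsWithin 1 {1}ᶜ) (nhdsWithin 1 {1}ᶜ) := by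
    refine tendsto_nhdsWithin_of_tendsto_nhds_of_eventually_within _ ?_ ?_
    · exact (Complex.continuous_ofReal.tendsto' 1 1 (by simp)).mono_left nhdsWithin_le_nhds
    · filter_upwards [self_mem_nhdsWithin] with t ht
      simpa using ht
  refine ht.frequently (Filter.Eventually.frequently ?_)
  filter_upwards [nhdsWithin_le_nhds (Ioi_mem_nhds zero_lt_one)] with t ht
  exact h t ht

/-- By analytic continuation |F| behaves like |s|^{-d/2} |e^{-κ/s}| in the whole half plane. On rays
s = 1/(R(1+iτ)) the modulus |s| is comparable to Re s, so as R → ∞ the bound on F requires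
Re(κ(1+iτ)) ≥ 0 for every real τ. -/
theorem exponent_nonneg_of_bound {F : ℂ → ℂ} (hF : DifferentiableOn ℂ F {s | 0 < s.re}) {d : ℕ}
    {c κ : ℂ} (hc : c ≠ 0)
    (hreal : ∀ s : ℝ, 0 < s → F s = c * ((s ^ (-(d : ℝ) / 2) : ℝ) : ℂ) * Complex.exp (-(κ / s)))
    {C : ℝ} (hC : ∀ s : ℂ, 0 < s.re → ‖F s‖ ≤ C * s.re ^ (-(d : ℝ) / 2)) :
    κ.im = 0 ∧ 0 ≤ κ.re := by
  have hsq : ∀ t : ℝ, 0 < t → (t ^ (-(d : ℝ) / 2)) ^ 2 * t ^ d = 1 := by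
    intro t ht
    rw [← Real.rpow_natCast (t ^ (-(d : ℝ) / 2)) 2, ← Real.rpow_mul ht.le, ← Real.rpow_natCast t d,
      ← Real.rpow_add ht]
    simp
  -- Squaring turns the possibly half-integral power of s into an integral one, so no branch has to
  -- be chosen.
  have hG : ∀ s : ℂ, 0 < s.re → F s ^ 2 * s ^ d * Complex.exp (2 * κ / s) = c ^ 2 := by
    intro s hs
    refine eq_of_eq_on_pos_real (F := fun s => F s ^ 2 * s ^ d * Complex.exp (2 * κ / s))
      (G := fun _ => c ^ 2) ?_ (differentiableOn_const _) ?_ hs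
    · refine ((hF.pow 2).mul (differentiableOn_id.pow d)).mul (DifferentiableOn.cexp ?_)
      refine (differentiableOn_const _).div differentiableOn_id fun x hx hx0 => ?_
      have hx' : 0 < x.re := hx
      rw [show x = 0 from hx0] at hx'
      simp at hx'
    · intro t ht
      have ht' : (t : ℂ) ≠ 0 := by exact_mod_cast ht.ne'
      have e1 : (((t ^ (-(d : ℝ) / 2) : ℝ) : ℂ)) ^ 2 * (t : ℂ) ^ d = 1 := by
        exact_mod_cast hsq t ht
      have e2 : Complex.exp (-(κ / t)) ^ 2 * Complex.exp (2 * κ / t) = 1 := by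
        rw [← Complex.exp_nat_mul, ← Complex.exp_add]
        convert Complex.exp_zero using 2
        push_cast
        ring
      rw [hreal t ht]
      linear_combination c ^ 2 * e1 + c ^ 2 * (((t ^ (-(d : ℝ) / 2) : ℝ) : ℂ)) ^ 2 * t ^ d * e2
  have key : ∀ τ : ℝ, 0 ≤ κ.re - τ * κ.im := by
    intro τ
    by_contra! hneg
    have hρ : ∀ R : ℝ, 0 < R → ‖c‖ ^ 2 ≤ C ^ 2 * Real.sqrt (1 + τ ^ 2) ^ d *
        Real.exp (2 * R * (κ.re - τ * κ.im)) := by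
      intro R hR
      set w : ℂ := R * (1 + τ * Complex.I) with hw
      have hwre : w.re = R := by simp [hw]
      have hw0 : w ≠ 0 := by
        intro h
        rw [h] at hwre
        simp only [Complex.zero_re] at hwre
        exact hR.ne hwre
      have hwn : ‖w‖ = R * Real.sqrt (1 + τ ^ 2) := by
        rw [hw, norm_mul, Complex.norm_real, Real.norm_of_nonneg hR.le]
        congr 1
        rw [Complex.norm_eq_sqrt_sq_add_sq]
        simp
      have hsre : (w⁻¹).re = R / ‖w‖ ^ 2 := by
        rw [Complex.inv_re, hwre, Complex.normSq_eq_norm_sq]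
      have hwpos : 0 < ‖w‖ := norm_pos_iff.2 hw0
      have hspos : 0 < (w⁻¹).re := by rw [hsre]; positivity
      have h1 := hG _ hspos
      have h2 := hC _ hspos
      have h3 : ‖Complex.exp (2 * κ / w⁻¹)‖ = Real.exp (2 * R * (κ.re - τ * κ.im)) := by
        rw [Complex.norm_exp]
        congr 1
        rw [div_inv_eq_mul, hw]
        simp
        ring
      rw [← norm_pow, ← h1, norm_mul, norm_mul, h3, norm_pow, norm_pow]
      refine mul_le_mul_of_nonneg_right ?_ (Real.exp_pos _).le
      have hsq' := hsq _ hspos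
      have h4 : ‖w⁻¹‖ = Real.sqrt (1 + τ ^ 2) * (w⁻¹).re := by
        rw [hsre, norm_inv, eq_comm, mul_div_assoc', mul_comm, ← hwn]
        field_simp
      calc ‖F w⁻¹‖ ^ 2 * ‖w⁻¹‖ ^ d
          ≤ (C * (w⁻¹).re ^ (-(d : ℝ) / 2)) ^ 2 * (Real.sqrt (1 + τ ^ 2) * (w⁻¹).re) ^ d := by
            rw [h4]
            gcongr
        _ = C ^ 2 * Real.sqrt (1 + τ ^ 2) ^ d *
            (((w⁻¹).re ^ (-(d : ℝ) / 2)) ^ 2 * (w⁻¹).re ^ d) := by ring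
        _ = _ := by rw [hsq', mul_one]
    have hlim : Filter.Tendsto (fun R : ℝ => C ^ 2 * Real.sqrt (1 + τ ^ 2) ^ d *
        Real.exp (2 * R * (κ.re - τ * κ.im))) Filter.atTop (nhds 0) := by
      rw [← mul_zero (C ^ 2 * Real.sqrt (1 + τ ^ 2) ^ d)]
      refine Filter.Tendsto.const_mul _ (Real.tendsto_exp_atBot.comp ?_)
      refine Filter.Tendsto.atTop_mul_const_of_neg hneg ?_
      exact Filter.tendsto_id.const_mul_atTop (by norm_num)
    have h0 : ‖c‖ ^ 2 ≤ 0 := ge_of_tendsto hlim (by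
      filter_upwards [Filter.eventually_gt_atTop 0] with R hR using hρ R hR)
    have : 0 < ‖c‖ ^ 2 := pow_pos (norm_pos_iff.2 hc) 2
    linarith
  refine ⟨?_, by simpa using key 0⟩
  by_contra him
  -- For this τ the quantity Re κ - τ Im κ would be -1.
  have := key ((κ.re + 1) / κ.im)
  rw [div_mul_cancel₀ _ him] at this
  linarith

/-- A differentiable function on `(0, ∞)` with zero derivative is constant. -/
theorem eq_of_deriv_eq_zero_Ioi {f : ℝ → ℂ} {a : ℝ} (hf : ∀ x, a < x → HasDerivAt f 0 x) {x y : ℝ}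
    (hx : a < x) (hy : a < y) : f x = f y := by
  refine (convex_Ioi a).is_const_of_fderivWithin_eq_zero (𝕜 := ℝ) (f := f)
    (fun t ht => (hf t ht).differentiableAt.differentiableWithinAt) ?_ hx hy
  intro t ht
  have h := (hf t ht).hasFDerivAt.hasFDerivWithinAt (s := Set.Ioi a)
  rw [h.fderivWithin (isOpen_Ioi.uniqueDiffWithinAt ht)]
  ext
  simp

/-- Solutions of `f(b, r) f(b', r') = Φ(b, b', r + r')` are exponential in `r`. -/
theorem exists_exponent_of_mul_eq {f : ℝ → ℝ → ℂ} {Φ : ℝ → ℝ → ℝ → ℂ}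
    (hd : ∀ b r, 0 < b → 0 < r → DifferentiableAt ℝ (f b) r)
    (hf : ∀ b b' r r', 0 < b → 0 < b' → 0 < r → 0 < r' → f b r * f b' r' = Φ b b' (r + r'))
    {b₀ r₀ : ℝ} (hb₀ : 0 < b₀) (hr₀ : 0 < r₀) (hne : f b₀ r₀ ≠ 0) :
    ∃ κ : ℂ, ∀ b r, 0 < b → 0 < r → f b r = f b 1 * Complex.exp κ * Complex.exp (-(κ * r)) := by
  refine ⟨-(deriv (f b₀) r₀ / f b₀ r₀), fun b r hb hr => ?_⟩
  set κ := -(deriv (f b₀) r₀ / f b₀ r₀) with hκ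
  have hder : ∀ r, 0 < r → HasDerivAt (f b) (-κ * f b r) r := by
    intro r hr
    -- Moving t from the second variable to the first keeps the sum r + r₀. The derivative at t = 0
    -- therefore vanishes, which makes the logarithmic derivative of every f(b, ·) equal to the one
    -- at (b₀, r₀), where f is not zero.
    have h1 : HasDerivAt (fun t : ℝ => f b (r + t) * f b₀ (r₀ - t))
        (deriv (f b) r * f b₀ r₀ - f b r * deriv (f b₀) r₀) 0 := by
      have a1 : HasDerivAt (fun t : ℝ => f b (r + t)) (deriv (f b) r) 0 := by
        have := (hd b r hb hr).hasDerivAt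
        rw [← add_zero r] at this
        simpa using this.comp_const_add r 0
      have a2 : HasDerivAt (fun t : ℝ => f b₀ (r₀ - t)) (-deriv (f b₀) r₀) 0 := by
        have := (hd b₀ r₀ hb₀ hr₀).hasDerivAt
        rw [← sub_zero r₀] at this
        simpa using this.comp_const_sub r₀ 0
      have := a1.fun_mul a2
      rwa [add_zero, sub_zero, mul_neg, ← sub_eq_add_neg] at this
    have h2 : (fun t : ℝ => f b (r + t) * f b₀ (r₀ - t)) =ᶠ[nhds 0] fun _ => f b r * f b₀ r₀ := by
      have e1 : ∀ᶠ t : ℝ in nhds 0, -r < t := Ioi_mem_nhds (by linarith)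
      have e2 : ∀ᶠ t : ℝ in nhds 0, t < r₀ := Iio_mem_nhds (by linarith)
      filter_upwards [e1, e2] with t ht1 ht2
      rw [hf b b₀ _ _ hb hb₀ (by linarith) (by linarith), hf b b₀ _ _ hb hb₀ hr hr₀]
      congr 1
      ring
    have h3 := (h1.congr_of_eventuallyEq h2.symm).unique (hasDerivAt_const (0 : ℝ) (f b r * f b₀ r₀))
    have h4 : deriv (f b) r = -κ * f b r := by
      rw [hκ]
      field_simp
      linear_combination h3
    rw [← h4]
    exact (hd b r hb hr).hasDerivAt
  have hconst : ∀ r, 0 < r → HasDerivAt (fun r : ℝ => f b r * Complex.exp (κ * r)) 0 r := by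
    intro r hr
    have h1 : HasDerivAt (fun r : ℝ => Complex.exp (κ * r)) (Complex.exp (κ * r) * κ) r := by
      have := ((hasDerivAt_id (r : ℂ)).const_mul κ).cexp.comp_ofReal
      simpa using this
    have := (hder r hr).fun_mul h1
    rwa [show -κ * f b r * Complex.exp (κ * r) + f b r * (Complex.exp (κ * r) * κ) = 0 by ring]
      at this
  have h := eq_of_deriv_eq_zero_Ioi hconst hr one_pos
  simp only [Complex.ofReal_one, mul_one] at h
  rw [← h, mul_assoc, ← Complex.exp_add, add_neg_cancel, Complex.exp_zero, mul_one]

/-- The hyperbolic addition formula implies a first order differential equation. -/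
theorem exists_ode_of_addition_formula {y : ℝ → ℂ} {ν : ℝ} {m : ℕ} (hm : 1 ≤ m)
    (hd : ∀ b, 0 < b → DifferentiableAt ℝ y b)
    (hadd : ∀ b b', 0 < b → 0 < b' → y b * y b' =
      (((4 * Real.pi / (b + b')) ^ m : ℝ) : ℂ) * y ((b * b' + ν ^ 2) / (b + b')))
    {b₀ : ℝ} (hb₀ : 0 < b₀) (hne : y b₀ ≠ 0) :
    ∃ E : ℂ, ∀ b : ℝ, 0 < b →
      ((b : ℂ) ^ 2 - (ν : ℂ) ^ 2) * deriv y b = (E - m * b) * y b := by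
  obtain ⟨p, rfl⟩ : ∃ p, m = p + 1 := ⟨m - 1, by omega⟩
  -- The addition formula, cleared of its denominator, is differentiated in b alone; the inner
  -- derivative is (b'² - ν²)/(b+b')².
  have hder : ∀ b b' : ℝ, 0 < b → 0 < b' →
      (p + 1 : ℂ) * (b + b') ^ p * (y b * y b') + (b + b') ^ (p + 1) * (deriv y b * y b') =
      (4 * Real.pi) ^ (p + 1) * (deriv y ((b * b' + ν ^ 2) / (b + b')) *
        ((b' ^ 2 - ν ^ 2) / (b + b') ^ 2)) := by
    intro b b' hb hb'
    have hpos : 0 < b + b' := add_pos hb hb'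
    have hu : HasDerivAt (fun t : ℝ => (t * b' + ν ^ 2) / (t + b'))
        ((b' ^ 2 - ν ^ 2) / (b + b') ^ 2) b := by
      have h1 : HasDerivAt (fun t : ℝ => t * b' + ν ^ 2) b' b := by
        simpa using ((hasDerivAt_id b).mul_const b').add_const (ν ^ 2)
      have h2 : HasDerivAt (fun t : ℝ => t + b') 1 b := (hasDerivAt_id b).add_const b'
      refine (h1.fun_div h2 hpos.ne').congr_deriv ?_
      ring
    have hupos : 0 < (b * b' + ν ^ 2) / (b + b') := by positivity
    have h1 : HasDerivAt (fun t : ℝ => ((4 * Real.pi : ℝ) : ℂ) ^ (p + 1) *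
        y ((t * b' + ν ^ 2) / (t + b'))) (((4 * Real.pi : ℝ) : ℂ) ^ (p + 1) *
        ((((b' ^ 2 - ν ^ 2) / (b + b') ^ 2 : ℝ) : ℂ) *
          deriv y ((b * b' + ν ^ 2) / (b + b')))) b := by
      have := HasDerivAt.scomp b (hd _ hupos).hasDerivAt hu
      exact (this.const_mul _)
    have h2 : HasDerivAt (fun t : ℝ => ((t : ℂ) + b') ^ (p + 1) * (y t * y b'))
        (((p + 1 : ℂ) * (b + b') ^ p) * (y b * y b') + (b + b') ^ (p + 1) * (deriv y b * y b')) b := by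
      have a1 : HasDerivAt (fun t : ℝ => (t : ℂ) + b') 1 b :=
        (hasDerivAt_id b).ofReal_comp.add_const (b' : ℂ)
      have a2 := (a1.fun_pow (p + 1)).fun_mul ((hd b hb).hasDerivAt.mul_const (y b'))
      simpa using a2
    have h3 : (fun t : ℝ => ((t : ℂ) + b') ^ (p + 1) * (y t * y b')) =ᶠ[nhds b]
        (fun t : ℝ => ((4 * Real.pi : ℝ) : ℂ) ^ (p + 1) * y ((t * b' + ν ^ 2) / (t + b'))) := by
      filter_upwards [Ioi_mem_nhds hb] with t ht
      have ht' : 0 < t := ht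
      have hne : (t : ℂ) + b' ≠ 0 := by exact_mod_cast (add_pos ht' hb').ne'
      rw [hadd t b' ht' hb']
      push_cast
      rw [div_pow]
      field_simp
    have h4 := (h1.congr_of_eventuallyEq h3).unique h2
    rw [← h4]
    push_cast
    ring
  -- The constant is the value at b₀ of mb + (b² - ν²) y'/y. The relations at (b, b₀) and (b₀, b)
  -- contain the same derivative `D`, with coefficients proportional to b₀² - ν² and b² - ν²;
  -- eliminating it shows that the expression is the same at b, up to division by y(b).
  refine ⟨(p + 1) * b₀ + (b₀ ^ 2 - ν ^ 2) * (deriv y b₀ / y b₀), fun b hb => ?_⟩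
  have e1 := hder b b₀ hb hb₀
  have e2 := hder b₀ b hb₀ hb
  have hs : (b : ℂ) + b₀ ≠ 0 := by exact_mod_cast (add_pos hb hb₀).ne'
  rw [show (b₀ * b + ν ^ 2) / (b₀ + b) = (b * b₀ + ν ^ 2) / (b + b₀) by
    rw [mul_comm b₀, add_comm b₀], add_comm (b₀ : ℂ)] at e2
  set D := deriv y ((b * b₀ + ν ^ 2) / (b + b₀))
  have key : ((b : ℂ) + b₀) ^ p * y b₀ * ((b + b₀) * (((b : ℂ) ^ 2 - (ν : ℂ) ^ 2) * deriv y b)) =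
      ((b : ℂ) + b₀) ^ p * y b₀ * ((b + b₀) * (((p + 1) * b₀ + (b₀ ^ 2 - ν ^ 2) *
        (deriv y b₀ / y b₀) - (p + 1) * b) * y b)) := by
    have hq : deriv y b₀ / y b₀ * y b₀ = deriv y b₀ := div_mul_cancel₀ _ hne
    linear_combination (((b : ℂ) ^ 2 - (ν : ℂ) ^ 2)) * e1 - ((b₀ : ℂ) ^ 2 - (ν : ℂ) ^ 2) * e2 -
      ((b : ℂ) + b₀) ^ (p + 1) * ((b₀ : ℂ) ^ 2 - (ν : ℂ) ^ 2) * y b * hq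
  have h5 := mul_left_cancel₀ hs (mul_left_cancel₀ (mul_ne_zero (pow_ne_zero p hs) hne) key)
  rw [h5]
  push_cast
  ring

theorem analyticOnNhd_of_holomorphic {y : ℝ → ℂ} {Y : ℂ → ℂ}
    (hY : DifferentiableOn ℂ Y {s | 0 < s.re}) (hy : ∀ b : ℝ, 0 < b → y b = Y b) :
    AnalyticOnNhd ℝ y (Set.Ioi 0) := by
  intro b hb
  have h1 : AnalyticAt ℂ Y (b : ℂ) := hY.analyticOnNhd isOpen_re_pos _ (by simpa using hb)
  have h2 : AnalyticAt ℝ (fun t : ℝ => Y (t : ℂ)) b :=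
    AnalyticAt.fun_comp (g := Y) (f := fun t : ℝ => (t : ℂ)) h1.restrictScalars
      (Complex.ofRealCLM.analyticAt b)
  refine h2.congr ?_
  filter_upwards [Ioi_mem_nhds hb] with t ht
  exact (hy t ht).symm

/-- The equation is singular at b = ν, but y is analytic there. Writing y = (b-ν)^l g with g(ν) ≠ 0,
cancelling (b-ν)^l and letting b → ν yields E - mν = 2νl. With this E the equation integrates
explicitly beyond ν; no sign information is needed below ν. -/
theorem ode_solution_of_pos {y : ℝ → ℂ} {ν : ℝ} (hν : 0 < ν) {m : ℕ} {E : ℂ}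
    (ha : AnalyticOnNhd ℝ y (Set.Ioi 0))
    (hode : ∀ b : ℝ, 0 < b → ((b : ℂ) ^ 2 - (ν : ℂ) ^ 2) * deriv y b = (E - m * b) * y b)
    {b₀ : ℝ} (hb₀ : 0 < b₀) (hne : y b₀ ≠ 0) :
    ∃ (c : ℂ) (l : ℕ), c ≠ 0 ∧ ∀ b : ℝ, ν < b →
      y b = c * (((b - ν) ^ l / (b + ν) ^ (m + l) : ℝ) : ℂ) := by
  -- Identity theorem on (0, ∞): y is not locally zero anywhere, so its order of vanishing at ν is
  -- finite.
  have hid : ∀ x : ℝ, 0 < x → ¬ (∀ᶠ b in nhds x, y b = 0) := by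
    intro x hx h
    have := ha.eqOn_of_preconnected_of_frequently_eq (g := fun _ => 0) analyticOnNhd_const
      isPreconnected_Ioi (z₀ := x) hx ((Filter.Eventually.filter_mono nhdsWithin_le_nhds h).frequently)
      hb₀
    exact hne this
  obtain ⟨l, g, hg, hgν, hyg⟩ := (ha ν hν).exists_eventuallyEq_pow_smul_nonzero_iff.2 (hid ν hν)
  have hE : E - m * ν = 2 * ν * l := by
    have h1 : ∀ᶠ b : ℝ in nhdsWithin ν {ν}ᶜ,
        ((b : ℂ) + ν) * (l * g b + (b - ν) * deriv g b) = (E - m * b) * g b := by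
      have hya : ∀ᶠ b : ℝ in nhds ν, ∀ᶠ t in nhds b, y t = ((t - ν) ^ l : ℝ) • g t :=
        eventually_eventually_nhds.2 hyg
      have hga : ∀ᶠ b : ℝ in nhds ν, AnalyticAt ℝ g b := hg.eventually_analyticAt
      filter_upwards [nhdsWithin_le_nhds hya, nhdsWithin_le_nhds hga, self_mem_nhdsWithin,
        nhdsWithin_le_nhds (Ioi_mem_nhds hν)] with b h1 h2 h3 h4
      have hbν : (b : ℂ) - ν ≠ 0 := by
        rw [sub_ne_zero]; exact_mod_cast h3
      have hyb := h1.self_of_nhds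
      have hdy : HasDerivAt y (((l : ℂ) * (b - ν) ^ (l - 1)) * g b + (b - ν) ^ l * deriv g b) b := by
        have a1 : HasDerivAt (fun t : ℝ => (t : ℂ) - ν) 1 b :=
          (hasDerivAt_id b).ofReal_comp.sub_const (ν : ℂ)
        have a2 := (a1.fun_pow l).fun_mul h2.differentiableAt.hasDerivAt
        rw [mul_one] at a2
        refine a2.congr_of_eventuallyEq ?_
        filter_upwards [h1] with t ht
        rw [ht, Complex.real_smul]
        push_cast
        ring
      have h5 := hode b h4
      rw [hdy.deriv, hyb, Complex.real_smul] at h5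
      push_cast at h5
      refine mul_left_cancel₀ (pow_ne_zero l hbν) ?_
      rcases l with _ | l
      · simp only [pow_zero, Nat.cast_zero, zero_mul, one_mul, zero_add] at h5 ⊢
        linear_combination h5
      · simp only [Nat.add_sub_cancel] at h5
        linear_combination h5
    have hgc : ContinuousAt g ν := hg.continuousAt
    have hgd : ContinuousAt (deriv g) ν := hg.deriv.continuousAt
    have t1 : Filter.Tendsto (fun b : ℝ => ((b : ℂ) + ν) * (l * g b + (b - ν) * deriv g b))
        (nhdsWithin ν {ν}ᶜ) (nhds (((ν : ℂ) + ν) * (l * g ν + (ν - ν) * deriv g ν))) := by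
      refine Filter.Tendsto.mono_left ?_ nhdsWithin_le_nhds
      have hc := Complex.continuous_ofReal.continuousAt (x := ν)
      exact (hc.add_const _).mul ((hgc.const_mul _).add ((hc.sub_const _).mul hgd))
    have t2 : Filter.Tendsto (fun b : ℝ => (E - m * b) * g b)
        (nhdsWithin ν {ν}ᶜ) (nhds ((E - m * ν) * g ν)) := by
      refine Filter.Tendsto.mono_left ?_ nhdsWithin_le_nhds
      have hc := Complex.continuous_ofReal.continuousAt (x := ν)
      exact (continuousAt_const.sub (hc.const_mul _)).mul hgc
    have h6 := tendsto_nhds_unique (t2.congr' (h1.mono fun b hb => hb.symm)) t1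
    refine mul_right_cancel₀ hgν ?_
    rw [h6]
    ring
  set h : ℝ → ℂ := fun b => y b * ((b : ℂ) + ν) ^ (m + l) / ((b : ℂ) - ν) ^ l with hh
  have hder : ∀ b : ℝ, ν < b → HasDerivAt h 0 b := by
    intro b hb
    have hb0 : 0 < b := hν.trans hb
    have n1 : (b : ℂ) - ν ≠ 0 := by rw [sub_ne_zero]; exact_mod_cast hb.ne'
    have n2 : (b : ℂ) + ν ≠ 0 := by exact_mod_cast (add_pos hb0 hν).ne'
    have a1 : HasDerivAt (fun t : ℝ => (t : ℂ) - ν) 1 b :=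
      (hasDerivAt_id b).ofReal_comp.sub_const (ν : ℂ)
    have a2 : HasDerivAt (fun t : ℝ => (t : ℂ) + ν) 1 b :=
      (hasDerivAt_id b).ofReal_comp.add_const (ν : ℂ)
    have a3 := ((ha b hb0).differentiableAt.hasDerivAt.fun_mul (a2.fun_pow (m + l))).fun_div
      (a1.fun_pow l) (pow_ne_zero l n1)
    refine a3.congr_deriv ?_
    rw [div_eq_zero_iff]
    left
    have h5 := hode b hb0
    have hE' : E = m * ν + 2 * ν * l := by linear_combination hE
    rw [hE'] at h5
    rw [mul_one, mul_one]
    refine mul_left_cancel₀ (mul_ne_zero n1 n2) ?_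
    -- The exponents m + l - 1 and l - 1 are truncated at zero. In that case the numerical factor in
    -- front vanishes, so both identities persist.
    have p1 : ((m + l : ℕ) : ℂ) * ((b : ℂ) + ν) ^ (m + l - 1) * (b + ν) =
        (m + l : ℕ) * (b + ν) ^ (m + l) := by
      rcases (m + l) with _ | k
      · simp
      · simp only [Nat.add_sub_cancel]; ring
    have p2 : (l : ℂ) * ((b : ℂ) - ν) ^ (l - 1) * (b - ν) = l * (b - ν) ^ l := by
      rcases l with _ | k
      · simp
      · simp only [Nat.add_sub_cancel]; ring
    push_cast at p1 ⊢
    linear_combination (b - ν : ℂ) ^ l * (b + ν) ^ (m + l) * h5 +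
      (b - ν : ℂ) * (b - ν) ^ l * y b * p1 - y b * (b + ν) * (b + ν) ^ (m + l) * p2
  have hy : ∀ b : ℝ, ν < b → y b = h (ν + 1) * (((b - ν) ^ l / (b + ν) ^ (m + l) : ℝ) : ℂ) := by
    intro b hb
    have hb0 : 0 < b := hν.trans hb
    have n1 : (b : ℂ) - ν ≠ 0 := by rw [sub_ne_zero]; exact_mod_cast hb.ne'
    have n2 : (b : ℂ) + ν ≠ 0 := by exact_mod_cast (add_pos hb0 hν).ne'
    rw [← eq_of_deriv_eq_zero_Ioi hder hb (lt_add_one ν), hh]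
    push_cast
    field_simp
  refine ⟨h (ν + 1), l, fun h0 => ?_, hy⟩
  refine hid (ν + 1) (by linarith) ?_
  filter_upwards [Ioi_mem_nhds (lt_add_one ν)] with b hb
  rw [hy b hb, h0, zero_mul]

/-- b^m e^{E/b} is an integrating factor. The power b^{-m} is written with exponent -(2m)/2 to match
`exponent_nonneg_of_bound` with d = 2m. -/
theorem ode_solution_of_zero {y : ℝ → ℂ} {m : ℕ} {E : ℂ}
    (hd : ∀ b, 0 < b → DifferentiableAt ℝ y b)
    (hode : ∀ b : ℝ, 0 < b → (b : ℂ) ^ 2 * deriv y b = (E - m * b) * y b)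
    {b : ℝ} (hb : 0 < b) :
    y b = (y 1 * Complex.exp E) * (((b : ℝ) ^ (-((2 * m : ℕ) : ℝ) / 2) : ℝ) : ℂ) *
      Complex.exp (-(E / b)) := by
  have hder : ∀ b : ℝ, 0 < b →
      HasDerivAt (fun b : ℝ => y b * (b : ℂ) ^ m * Complex.exp (E / b)) 0 b := by
    intro b hb
    have n1 : (b : ℂ) ≠ 0 := by exact_mod_cast hb.ne'
    have a1 : HasDerivAt (fun t : ℝ => (t : ℂ)) 1 b := (hasDerivAt_id b).ofReal_comp
    have a2 : HasDerivAt (fun t : ℝ => Complex.exp (E / t))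
        (Complex.exp (E / b) * (E * (-(1 : ℂ) / (b : ℂ) ^ 2))) b := by
      have := (a1.fun_inv n1).const_mul E
      simpa only [← div_eq_mul_inv] using this.cexp
    have a3 := ((hd b hb).hasDerivAt.fun_mul (a1.fun_pow m)).fun_mul a2
    refine a3.congr_deriv ?_
    have h5 := hode b hb
    refine mul_left_cancel₀ (pow_ne_zero 2 n1) ?_
    have p2 : (m : ℂ) * (b : ℂ) ^ (m - 1) * b = m * b ^ m := by
      rcases m with _ | k
      · simp
      · simp only [Nat.add_sub_cancel]; ring
    field_simp
    linear_combination Complex.exp (E / b) * ((b : ℂ) ^ m * h5 + b * y b * p2)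
  have h := eq_of_deriv_eq_zero_Ioi hder hb one_pos
  have n1 : (b : ℂ) ≠ 0 := by exact_mod_cast hb.ne'
  simp only [Complex.ofReal_one, one_pow, mul_one, div_one] at h
  rw [← h]
  have e1 : b ^ (-((2 * m : ℕ) : ℝ) / 2) = (b ^ m)⁻¹ := by
    rw [show -((2 * m : ℕ) : ℝ) / 2 = -(m : ℝ) by push_cast; ring, Real.rpow_neg hb.le,
      Real.rpow_natCast]
  have e2 : Complex.exp (E / b) * Complex.exp (-(E / b)) = 1 := by
    rw [← Complex.exp_add, add_neg_cancel, Complex.exp_zero]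
  rw [e1]
  push_cast
  have n3 : (b : ℂ) ^ m ≠ 0 := pow_ne_zero _ n1
  field_simp
  linear_combination -y b * e2

/-! ### Gaussian transforms and partial integrals of bounded functions -/

section Laplace

variable {E : Type*} [NormedAddCommGroup E] [InnerProductSpace ℝ E]
  [FiniteDimensional ℝ E] [MeasurableSpace E] [BorelSpace E]

theorem differentiableOn_gaussian_transform {a : E → ℂ} (ha : Measurable a) {C : ℝ}
    (hC : ∀ x, ‖a x‖ ≤ C) :
    DifferentiableOn ℂ (fun s : ℂ => ∫ x, a x * Complex.exp (-(s * (‖x‖ ^ 2 : ℝ))))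
      {s | 0 < s.re} := by
  refine differentiableOn_laplace ha (by fun_prop) (fun x => by positivity) fun ε hε => ?_
  refine (integrable_gaussian hε).bdd_mul ha.norm.aestronglyMeasurable (c := C)
    (Filter.Eventually.of_forall fun x => ?_)
  rw [norm_norm]
  exact hC x

theorem norm_gaussian_transform_le {a : E → ℂ} {C : ℝ}
    (hC : ∀ x, ‖a x‖ ≤ C) {s : ℂ} (hs : 0 < s.re) :
    ‖∫ x, a x * Complex.exp (-(s * (‖x‖ ^ 2 : ℝ)))‖ ≤
      C * Real.pi ^ ((Module.finrank ℝ E : ℝ) / 2) * s.re ^ (-(Module.finrank ℝ E : ℝ) / 2) := by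
  have h1 : Real.pi ^ ((Module.finrank ℝ E : ℝ) / 2) * s.re ^ (-(Module.finrank ℝ E : ℝ) / 2) =
      (Real.pi / s.re) ^ ((Module.finrank ℝ E : ℝ) / 2) := by
    rw [Real.div_rpow Real.pi_pos.le hs.le, neg_div, Real.rpow_neg hs.le]
    rfl
  rw [mul_assoc, h1, ← integral_gaussian_real hs, ← integral_const_mul]
  refine norm_integral_le_of_norm_le ((integrable_gaussian hs).const_mul C)
    (Filter.Eventually.of_forall fun x => ?_)
  rw [norm_mul, Complex.norm_exp]
  have : (-(s * ((‖x‖ ^ 2 : ℝ) : ℂ))).re = -(s.re * ‖x‖ ^ 2) := by simp [-Complex.ofReal_pow]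
  rw [this]
  exact mul_le_mul_of_nonneg_right (hC x) (Real.exp_pos _).le

end Laplace

section PartialIntegral

variable {α β : Type*} [MeasurableSpace α] [MeasurableSpace β] {μ : Measure α} {ν : Measure β}
  [SFinite μ] [SFinite ν]

theorem measurable_partial_integral {φ : α × β → ℂ} (hφ : Measurable φ) {h : β → ℂ}
    (hh : Measurable h) : Measurable fun x => ∫ y, φ (x, y) * h y ∂ν :=
  (StronglyMeasurable.integral_prod_right (f := fun x y => φ (x, y) * h y)
    (hφ.mul (hh.comp measurable_snd)).stronglyMeasurable).measurable

theorem norm_partial_integral_le {φ : α × β → ℂ} {C : ℝ} (hC : ∀ p, ‖φ p‖ ≤ C) {h : β → ℂ}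
    (hi : Integrable h ν) (x : α) : ‖∫ y, φ (x, y) * h y ∂ν‖ ≤ C * ∫ y, ‖h y‖ ∂ν := by
  rw [← integral_const_mul]
  refine norm_integral_le_of_norm_le (hi.norm.const_mul C) (Filter.Eventually.of_forall fun y => ?_)
  rw [norm_mul]
  exact mul_le_mul_of_nonneg_right (hC _) (norm_nonneg _)

theorem integral_eq_integral_partial {φ : α × β → ℂ} (hφ : Measurable φ) {C : ℝ}
    (hC : ∀ p, ‖φ p‖ ≤ C) {g : α → ℂ} (hg : Integrable g μ) {h : β → ℂ} (hi : Integrable h ν) :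
    ∫ p, φ p * (g p.1 * h p.2) ∂(μ.prod ν) = ∫ x, (∫ y, φ (x, y) * h y ∂ν) * g x ∂μ := by
  rw [integral_prod _ ((hg.mul_prod hi).bdd_mul hφ.aestronglyMeasurable
    (Filter.Eventually.of_forall hC))]
  refine integral_congr_ae (Filter.Eventually.of_forall fun x => ?_)
  simp only []
  rw [← integral_mul_const]
  refine integral_congr_ae (Filter.Eventually.of_forall fun y => ?_)
  simp only []
  ring

theorem integral_eq_integral_partial' {φ : α × β → ℂ} (hφ : Measurable φ) {C : ℝ}
    (hC : ∀ p, ‖φ p‖ ≤ C) {g : α → ℂ} (hg : Integrable g μ) {h : β → ℂ} (hi : Integrable h ν) :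
    ∫ p, φ p * (g p.1 * h p.2) ∂(μ.prod ν) = ∫ y, (∫ x, φ (x, y) * g x ∂μ) * h y ∂ν := by
  rw [integral_prod_symm _ ((hg.mul_prod hi).bdd_mul hφ.aestronglyMeasurable
    (Filter.Eventually.of_forall hC))]
  refine integral_congr_ae (Filter.Eventually.of_forall fun y => ?_)
  simp only []
  rw [← integral_mul_const]
  refine integral_congr_ae (Filter.Eventually.of_forall fun x => ?_)
  simp only []
  ring

end PartialIntegral

/-! ### Densities tested on Gaussians -/

namespace HTypeGroup

variable {v z : Type*} [NormedAddCommGroup v] [InnerProductSpace ℝ v]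
  [FiniteDimensional ℝ v] [MeasurableSpace v] [BorelSpace v]
  [NormedAddCommGroup z] [InnerProductSpace ℝ z]
  [FiniteDimensional ℝ z] [MeasurableSpace z] [BorelSpace z] {H : HTypeAlgebra v z}

theorem integrable_gaussian_quarter {b : ℝ} (hb : 0 < b) :
    Integrable fun X : v => (Real.exp (-(b * ‖X‖ ^ 2 / 4)) : ℂ) := by
  have := integrable_gaussian (E := v) (b := b / 4) (by positivity)
  refine this.ofReal.congr (Filter.Eventually.of_forall fun X => ?_)
  simp only []
  congr 3
  ring

theorem integral_density_mul_gaussL1 (φ : HTypeGroup H → ℂ) {b r : ℝ} (hb : 0 < b) (hr : 0 < r) :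
    ∫ n, φ n * gaussL1 H hb hr n = ∫ n, φ n * gaussN H b r n := by
  refine integral_congr_ae ?_
  filter_upwards [coeFn_gaussL1 H hb hr] with n hn
  rw [hn]

theorem gauss_mul_of_density {ψ : biradialL1 H →ₗ[ℂ] ℂ} (hψ : ψ ∈ gelfandSpectrum H)
    {φ : HTypeGroup H → ℂ}
    (hφ : ∀ f : biradialL1 H, ψ f = ∫ n, φ n * (f : HTypeGroup H →₁[volume] ℂ) n)
    {b b' r r' : ℝ} (hb : 0 < b) (hb' : 0 < b') (hr : 0 < r) (hr' : 0 < r') :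
    (∫ n, φ n * gaussN H b r n) * (∫ n, φ n * gaussN H b' r' n) =
      (((4 * Real.pi / (b + b')) ^ m H : ℝ) : ℂ) *
        ∫ n, φ n * skewGauss H (b + b') (b * b' / (b + b')) (r + r') n := by
  have h := gelfandSpectrum_map_convL hψ ⟨_, gaussL1_mem H hb hr⟩ ⟨_, gaussL1_mem H hb' hr'⟩
  rw [hφ, hφ, hφ] at h
  simp only [integral_density_mul_gaussL1] at h
  rw [← h, ← integral_const_mul]
  refine integral_congr_ae ?_
  filter_upwards [coeFn_convL (gaussL1 H hb hr) (gaussL1 H hb' hr'),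
      conv_congr_ae (coeFn_gaussL1 H hb hr) (coeFn_gaussL1 H hb' hr'),
      conv_gaussN H hb hb' hr hr'] with n h1 h2 h3
  rw [h1, h2, h3]
  ring

/-- Up to a nonzero constant this is a convolution of two integrable functions. -/
theorem integrable_skewGauss {b b' r r' : ℝ} (hb : 0 < b) (hb' : 0 < b') (hr : 0 < r)
    (hr' : 0 < r') :
    Integrable (skewGauss H (b + b') (b * b' / (b + b')) (r + r')) := by
  have hc : (((4 * Real.pi / (b + b')) ^ m H : ℝ) : ℂ) ≠ 0 :=
    Complex.ofReal_ne_zero.2 (by have := Real.pi_pos; positivity)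
  have h := (integrable_congr (conv_gaussN H hb hb' hr hr')).1
    (integrable_conv (integrable_gaussN H hb hr) (integrable_gaussN H hb' hr'))
  refine (h.const_mul (((4 * Real.pi / (b + b')) ^ m H : ℝ) : ℂ)⁻¹).congr
    (Filter.Eventually.of_forall fun n => ?_)
  simp only []
  rw [inv_mul_cancel_left₀ hc]

/-- The Fourier transform of the fibre Gaussian at l contributes e^{-|l|²|X|²/(4(b+b'))}, which
joins the Gaussian in X and changes its parameter from bb'/(b+b') to (bb'+|l|²)/(b+b'). -/
theorem integral_product_density_skewGauss {a : v → ℂ} (ha : Measurable a) {C : ℝ}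
    (hC : ∀ X, ‖a X‖ ≤ C) (l : z) {b b' r r' : ℝ} (hb : 0 < b) (hb' : 0 < b') (hr : 0 < r)
    (hr' : 0 < r') :
    ∫ n : HTypeGroup H, (a n.1 * Complex.exp (Complex.I * (inner ℝ l n.2 : ℝ))) *
      skewGauss H (b + b') (b * b' / (b + b')) (r + r') n =
    Complex.exp (-((r + r' : ℝ) * ‖l‖ ^ 2 / 4)) *
      ∫ X, a X * (Real.exp (-(((b * b' + ‖l‖ ^ 2) / (b + b')) * ‖X‖ ^ 2 / 4)) : ℂ) := by
  have hm : Measurable fun n : v × z =>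
      a n.1 * Complex.exp (Complex.I * (inner ℝ l n.2 : ℝ)) := by fun_prop
  have hint : Integrable fun n : HTypeGroup H =>
      (a n.1 * Complex.exp (Complex.I * (inner ℝ l n.2 : ℝ))) *
      skewGauss H (b + b') (b * b' / (b + b')) (r + r') n := by
    refine (integrable_skewGauss hb hb' hr hr').bdd_mul (c := C)
      (Measurable.aestronglyMeasurable hm) (Filter.Eventually.of_forall fun n => ?_)
    rw [norm_mul, mul_comm Complex.I, Complex.norm_exp_ofReal_mul_I, mul_one]
    exact hC _
  refine (integral_prod (μ := (volume : Measure v)) (ν := (volume : Measure z)) _ hint).trans ?_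
  rw [← integral_const_mul]
  refine integral_congr_ae (Filter.Eventually.of_forall fun X => ?_)
  have hR : 0 < r + r' + ‖X‖ ^ 2 / (b + b') := by positivity
  have h := integral_heat_mul_character hR l
  have e : ∀ Z : z, (a X * Complex.exp (Complex.I * (inner ℝ l Z : ℝ))) *
      skewGauss H (b + b') (b * b' / (b + b')) (r + r') (X, Z) =
      (a X * (Real.exp (-(b * b' / (b + b') * ‖X‖ ^ 2 / 4)) : ℂ)) *
      (heat (r + r' + ‖X‖ ^ 2 / (b + b')) Z * Complex.exp (Complex.I * (inner ℝ l Z : ℝ))) := by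
    intro Z
    change _ * ((Real.exp (-(b * b' / (b + b') * ‖X‖ ^ 2 / 4)) : ℂ) *
      heat (r + r' + ‖X‖ ^ 2 / (b + b')) Z) = _
    ring
  change ∫ Z : z, (a X * Complex.exp (Complex.I * (inner ℝ l Z : ℝ))) *
      skewGauss H (b + b') (b * b' / (b + b')) (r + r') (X, Z) = _
  simp_rw [e]
  rw [integral_const_mul, h, mul_assoc, mul_left_comm _ (a X)]
  congr 1
  rw [Complex.ofReal_exp, Complex.ofReal_exp, ← Complex.exp_add, ← Complex.exp_add]
  congr 1
  have hB : (b : ℂ) + b' ≠ 0 := by exact_mod_cast (add_pos hb hb').ne'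
  push_cast
  field_simp
  ring

theorem integral_product_density_gaussN (a : v → ℂ) (l : z) {b r : ℝ} (hr : 0 < r) :
    ∫ n : HTypeGroup H, (a n.1 * Complex.exp (Complex.I * (inner ℝ l n.2 : ℝ))) *
      gaussN H b r n =
    (∫ X, a X * (Real.exp (-(b * ‖X‖ ^ 2 / 4)) : ℂ)) * Complex.exp (-(r * ‖l‖ ^ 2 / 4)) := by
  rw [← integral_heat_mul_character hr l]
  refine Eq.trans ?_ (integral_prod_mul (μ := (volume : Measure v)) (ν := (volume : Measure z))
    (fun X => a X * (Real.exp (-(b * ‖X‖ ^ 2 / 4)) : ℂ))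
    (fun Z => heat r Z * Complex.exp (Complex.I * (inner ℝ l Z : ℝ))))
  refine integral_congr_ae (Filter.Eventually.of_forall fun n => ?_)
  change _ * ((Real.exp (-(b * ‖n.1‖ ^ 2 / 4)) : ℂ) * heat r n.2) = _
  ring

end HTypeGroup

/-! ### The product density of a character -/

namespace HTypeGroup

variable {v z : Type*} [NormedAddCommGroup v] [InnerProductSpace ℝ v]
  [FiniteDimensional ℝ v] [MeasurableSpace v] [BorelSpace v]
  [NormedAddCommGroup z] [InnerProductSpace ℝ z]
  [FiniteDimensional ℝ z] [MeasurableSpace z] [BorelSpace z] {H : HTypeAlgebra v z}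

theorem exists_gauss_ne_zero {ψ : biradialL1 H →ₗ[ℂ] ℂ} (hψ : ψ ∈ gelfandSpectrum H)
    {φ : HTypeGroup H → ℂ} (hφm : Measurable φ) {C : ℝ} (hC : ∀ n, ‖φ n‖ ≤ C)
    (hφ : ∀ f : biradialL1 H, ψ f = ∫ n, φ n * (f : HTypeGroup H →₁[volume] ℂ) n) :
    ∃ b r : ℝ, 0 < b ∧ 0 < r ∧ ∫ n, φ n * gaussN H b r n ≠ 0 := by
  by_contra! hcon
  refine hψ.1 (LinearMap.ext fun f => ?_)
  rw [hφ f, LinearMap.zero_apply]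
  have := eq_on_biradial_of_eq_on_gauss H (functionalOfDensity volume hφm hC) 0
    (fun b r hb hr => by
      rw [functionalOfDensity_apply, integral_density_mul_gaussL1, hcon b r hb hr,
        zero_apply]) f.2
  simpa [functionalOfDensity_apply] using this

/-- As a function of `r`, a character is exponential on the product Gaussians, with a nonnegative
exponent. -/
theorem exists_frequency {ψ : biradialL1 H →ₗ[ℂ] ℂ} (hψ : ψ ∈ gelfandSpectrum H)
    {φ : HTypeGroup H → ℂ} (hφm : Measurable φ) {C : ℝ} (hC : ∀ n, ‖φ n‖ ≤ C)
    (hφ : ∀ f : biradialL1 H, ψ f = ∫ n, φ n * (f : HTypeGroup H →₁[volume] ℂ) n) :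
    ∃ ν : ℝ, 0 ≤ ν ∧ ∀ b r : ℝ, 0 < b → 0 < r → ∫ n, φ n * gaussN H b r n =
      (∫ n, φ n * gaussN H b 1 n) * Complex.exp (ν ^ 2 / 4) * Complex.exp (-(r * ν ^ 2 / 4)) := by
  have hpi := Real.pi_pos
  obtain ⟨b₀, r₀, hb₀, hr₀, hne⟩ := exists_gauss_ne_zero hψ hφm hC hφ
  set k : ℝ := (Module.finrank ℝ z : ℝ) with hk
  let A : ℝ → z → ℂ := fun b Z => ∫ X : v, φ (X, Z) * (Real.exp (-(b * ‖X‖ ^ 2 / 4)) : ℂ)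
  have hAm : ∀ b, Measurable (A b) := by
    intro b
    have h1 : Measurable fun p : z × v => φ (p.2, p.1) := hφm.comp measurable_swap
    exact measurable_partial_integral (φ := fun p : z × v => φ (p.2, p.1)) h1
      (h := fun X => (Real.exp (-(b * ‖X‖ ^ 2 / 4)) : ℂ)) (by fun_prop)
  have hAb : ∀ b, 0 < b → ∀ Z, ‖A b Z‖ ≤ C * ∫ X : v, ‖(Real.exp (-(b * ‖X‖ ^ 2 / 4)) : ℂ)‖ :=
    fun b hb Z => norm_partial_integral_le (φ := fun p : z × v => φ (p.2, p.1))
      (fun p => hC _) (integrable_gaussian_quarter hb) Z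
  let T : ℝ → ℂ → ℂ := fun b s => ∫ Z, A b Z * Complex.exp (-(s * (‖Z‖ ^ 2 : ℝ)))
  have hT : ∀ b, 0 < b → DifferentiableOn ℂ (T b) {s | 0 < s.re} := fun b hb =>
    differentiableOn_gaussian_transform (hAm b) (hAb b hb)
  -- In s = 1/r the pairing is, up to the normalizing power, a Gaussian transform holomorphic in the
  -- right half plane. This provides both the derivative in r and the growth bound.
  have hfT : ∀ b r : ℝ, 0 < b → 0 < r → ∫ n, φ n * gaussN H b r n =
      (((Real.pi * r) ^ (-k / 2) : ℝ) : ℂ) * T b ((r⁻¹ : ℝ) : ℂ) := by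
    intro b r hb hr
    refine (integral_eq_integral_partial' (μ := (volume : Measure v)) (ν := (volume : Measure z))
      hφm hC (integrable_gaussian_quarter hb) (integrable_heat hr)).trans ?_
    rw [← integral_const_mul]
    refine integral_congr_ae (Filter.Eventually.of_forall fun Z => ?_)
    simp only [heat]
    rw [← Complex.ofReal_mul, ← Complex.ofReal_neg, ← Complex.ofReal_exp, Complex.ofReal_mul,
      show -(‖Z‖ ^ 2 / r) = -(r⁻¹ * ‖Z‖ ^ 2) by ring]
    ring
  have hd : ∀ b r, 0 < b → 0 < r → DifferentiableAt ℝ (fun r => ∫ n, φ n * gaussN H b r n) r := by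
    intro b r hb hr
    have h1 : DifferentiableAt ℝ (fun r : ℝ => (((Real.pi * r) ^ (-k / 2) : ℝ) : ℂ) *
        T b ((r⁻¹ : ℝ) : ℂ)) r := by
      have a1 : DifferentiableAt ℝ (fun r : ℝ => (Real.pi * r) ^ (-k / 2)) r :=
        (differentiableAt_id.const_mul _).rpow_const (Or.inl (by positivity))
      have a2 : DifferentiableAt ℝ (fun r : ℝ => T b (r : ℂ)) r⁻¹ := by
        have h2 := ((hT b hb).differentiableAt (isOpen_re_pos.mem_nhds
          (show (0 : ℝ) < ((r⁻¹ : ℝ) : ℂ).re by simpa using hr))).hasDerivAt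
        exact h2.comp_ofReal.differentiableAt
      have a3 : DifferentiableAt ℝ (fun r : ℝ => r⁻¹) r := differentiableAt_inv hr.ne'
      have a4 := DifferentiableAt.fun_comp' (f := fun r : ℝ => r⁻¹)
        (g := fun r : ℝ => T b (r : ℂ)) r a2 a3
      exact a1.hasDerivAt.ofReal_comp.differentiableAt.mul a4
    refine h1.congr_of_eventuallyEq ?_
    filter_upwards [Ioi_mem_nhds hr] with t ht
    exact hfT b t hb ht
  obtain ⟨κ, hκ⟩ := exists_exponent_of_mul_eq
    (f := fun b r => ∫ n, φ n * gaussN H b r n)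
    (Φ := fun b b' R => (((4 * Real.pi / (b + b')) ^ m H : ℝ) : ℂ) *
        ∫ n, φ n * skewGauss H (b + b') (b * b' / (b + b')) R n) hd
    (fun b b' r r' hb hb' hr hr' => gauss_mul_of_density hψ hφ hb hb' hr hr') hb₀ hr₀ hne
  have hne1 : ∫ n, φ n * gaussN H b₀ 1 n ≠ 0 := by
    intro h0
    refine hne ?_
    have := hκ b₀ r₀ hb₀ hr₀
    rw [this, h0, zero_mul, zero_mul]
  -- The exponential law in r = 1/s says that `T b₀` is c s^{-k/2} e^{-κ/s} on the positive reals.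
  have hsector := exponent_nonneg_of_bound (F := T b₀) (hT b₀ hb₀) (d := Module.finrank ℝ z)
    (c := (∫ n, φ n * gaussN H b₀ 1 n) * Complex.exp κ * ((Real.pi ^ (k / 2) : ℝ) : ℂ)) (κ := κ)
    (mul_ne_zero (mul_ne_zero hne1 (Complex.exp_ne_zero _))
      (Complex.ofReal_ne_zero.2 (by positivity)))
    (fun s hs => by
      have h1 := hκ b₀ s⁻¹ hb₀ (inv_pos.2 hs)
      rw [hfT b₀ s⁻¹ hb₀ (inv_pos.2 hs), inv_inv] at h1
      have h2 : (Real.pi * s⁻¹) ^ (-k / 2) * (Real.pi ^ (k / 2) * s ^ (-k / 2)) = 1 := by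
        rw [Real.mul_rpow hpi.le (inv_pos.2 hs).le, Real.inv_rpow hs.le]
        have e1 : Real.pi ^ (-k / 2) * Real.pi ^ (k / 2) = 1 := by
          rw [← Real.rpow_add hpi, show -k / 2 + k / 2 = 0 by ring, Real.rpow_zero]
        have e2 : (s ^ (-k / 2))⁻¹ * s ^ (-k / 2) = 1 :=
          inv_mul_cancel₀ (Real.rpow_pos_of_pos hs _).ne'
        linear_combination (s ^ (-k / 2))⁻¹ * s ^ (-k / 2) * e1 + e2
      have h2' : (((Real.pi * s⁻¹) ^ (-k / 2) : ℝ) : ℂ) * (((Real.pi ^ (k / 2) : ℝ) : ℂ) *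
          ((s ^ (-k / 2) : ℝ) : ℂ)) = 1 := by exact_mod_cast h2
      have h3 : Complex.exp (-(κ * ((s⁻¹ : ℝ) : ℂ))) = Complex.exp (-(κ / s)) := by
        push_cast; rfl
      rw [h3] at h1
      rw [← hk]
      linear_combination (((Real.pi ^ (k / 2) : ℝ) : ℂ) * ((s ^ (-k / 2) : ℝ) : ℂ)) * h1 -
        T b₀ s * h2')
    (fun s hs => norm_gaussian_transform_le (hAb b₀ hb₀) hs)
  refine ⟨2 * Real.sqrt κ.re, by positivity, fun b r hb hr => ?_⟩
  have hκν : κ = ((2 * Real.sqrt κ.re : ℝ) : ℂ) ^ 2 / 4 := by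
    rw [← Complex.ofReal_pow, mul_pow, Real.sq_sqrt hsector.2]
    apply Complex.ext
    · simp [-Complex.ofReal_mul]
      ring
    · simp [-Complex.ofReal_mul, hsector.1]
  have h := hκ b r hb hr
  rw [h, ← hκν]
  congr 2
  linear_combination -(r : ℂ) * hκν

/-- The profile of a character of `L¹(N)^♮`: it is given by a product density
`a(X) exp (i ⟨l, Z⟩)`, and the Gaussian transform of `a` has constant sign beyond `|l|`. -/
theorem exists_product_density {ψ : biradialL1 H →ₗ[ℂ] ℂ} (hψ : ψ ∈ gelfandSpectrum H) :
    ∃ (l : z) (a : v → ℂ), Measurable a ∧ (∃ C : ℝ, ∀ X, ‖a X‖ ≤ C) ∧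
      (∀ f : biradialL1 H, ψ f = ∫ n : HTypeGroup H,
        (a n.1 * Complex.exp (Complex.I * (inner ℝ l n.2 : ℝ))) *
          (f : HTypeGroup H →₁[volume] ℂ) n) ∧
      ∃ (c : ℂ) (g : ℝ → ℝ), c ≠ 0 ∧ (∀ τ, ‖l‖ < τ → 0 < g τ) ∧
        ∀ τ, ‖l‖ < τ → ∫ X, a X * (Real.exp (-(τ * ‖X‖ ^ 2 / 4)) : ℂ) = c * g τ := by
  obtain ⟨φ, hφm, ⟨C, hC⟩, hφ⟩ := exists_density_of_mem_gelfandSpectrum hψ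
  obtain ⟨ν, hν, hνf⟩ := exists_frequency hψ hφm hC hφ
  have hnt : Nontrivial z := Module.finrank_pos_iff (R := ℝ).1 (one_le_m_k H).2
  -- Any vector of length ν will do: the density is only tested on biradial functions, and their
  -- pairing with a plane wave depends on l only through |l|.
  obtain ⟨l, hl⟩ := exists_norm_eq z hν
  -- The pairing in Z is taken at r = 1; the factor e^{ν²/4} compensates the value e^{-ν²/4} of the
  -- exponential there.
  let a : v → ℂ := fun X => ∫ Z : z, φ (X, Z) * (Complex.exp (ν ^ 2 / 4) * heat 1 Z)
  have hhm : Measurable (fun Z : z => Complex.exp (ν ^ 2 / 4) * heat 1 Z) :=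
    ((continuous_heat 1).measurable.const_mul _)
  have hhi : Integrable (fun Z : z => Complex.exp (ν ^ 2 / 4) * heat 1 Z) :=
    (integrable_heat one_pos).const_mul _
  have ham : Measurable a := measurable_partial_integral hφm hhm
  obtain ⟨A, hA⟩ : ∃ A, ∀ X, ‖a X‖ ≤ A := ⟨_, norm_partial_integral_le hC hhi⟩
  let y : ℝ → ℂ := fun b => ∫ X, a X * (Real.exp (-(b * ‖X‖ ^ 2 / 4)) : ℂ)
  have hy : ∀ b, 0 < b → y b = (∫ n, φ n * gaussN H b 1 n) * Complex.exp (ν ^ 2 / 4) := by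
    intro b hb
    refine (integral_eq_integral_partial (μ := (volume : Measure v)) (ν := (volume : Measure z))
      hφm hC (integrable_gaussian_quarter hb) hhi).symm.trans ?_
    rw [← integral_mul_const]
    refine integral_congr_ae (Filter.Eventually.of_forall fun n => ?_)
    change φ n * ((Real.exp (-(b * ‖n.1‖ ^ 2 / 4)) : ℂ) * _) =
      φ n * ((Real.exp (-(b * ‖n.1‖ ^ 2 / 4)) : ℂ) * heat 1 n.2) * _
    ring
  have hm₀ : Measurable fun n : v × z =>
      a n.1 * Complex.exp (Complex.I * (inner ℝ l n.2 : ℝ)) := by fun_prop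
  have hm : Measurable fun n : HTypeGroup H =>
      a n.1 * Complex.exp (Complex.I * (inner ℝ l n.2 : ℝ)) := hm₀
  have hmb : ∀ n : HTypeGroup H, ‖a n.1 * Complex.exp (Complex.I * (inner ℝ l n.2 : ℝ))‖ ≤ A := by
    intro n
    rw [norm_mul, mul_comm Complex.I, Complex.norm_exp_ofReal_mul_I, mul_one]
    exact hA _
  have hψa : ∀ f : biradialL1 H, ψ f = ∫ n : HTypeGroup H,
        (a n.1 * Complex.exp (Complex.I * (inner ℝ l n.2 : ℝ))) *
          (f : HTypeGroup H →₁[volume] ℂ) n := by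
    intro f
    rw [hφ f]
    refine eq_on_biradial_of_eq_on_gauss H (functionalOfDensity volume hφm hC)
      (functionalOfDensity volume hm hmb) (fun b r hb hr => ?_) f.2
    rw [functionalOfDensity_apply, functionalOfDensity_apply, integral_density_mul_gaussL1,
      integral_density_mul_gaussL1, integral_product_density_gaussN a l hr, hνf b r hb hr,
      ← hy b hb, hl]
  refine ⟨l, a, ham, ⟨A, hA⟩, hψa, ?_⟩
  -- At r = r' = 1 both sides of the multiplicative law carry the factor e^{-ν²/2}, which cancels.
  have hadd : ∀ b b', 0 < b → 0 < b' → y b * y b' =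
      (((4 * Real.pi / (b + b')) ^ m H : ℝ) : ℂ) * y ((b * b' + ν ^ 2) / (b + b')) := by
    intro b b' hb hb'
    have h := gauss_mul_of_density hψ hψa hb hb' one_pos one_pos
    rw [integral_product_density_gaussN a l one_pos, integral_product_density_gaussN a l one_pos,
      integral_product_density_skewGauss ham hA l hb hb' one_pos one_pos, hl] at h
    refine mul_right_cancel₀ (Complex.exp_ne_zero (-((1 + 1 : ℝ) * (ν : ℂ) ^ 2 / 4))) ?_
    refine Eq.trans ?_ (h.trans ?_)
    · change y b * y b' * _ = (y b * _) * (y b' * _)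
      rw [mul_mul_mul_comm, ← Complex.exp_add]
      congr 2
      push_cast
      ring
    · change _ * (_ * y _) = _
      push_cast
      ring
  let Y : ℂ → ℂ := fun b => ∫ X, a X * Complex.exp (-(b / 4 * (‖X‖ ^ 2 : ℝ)))
  have hYd : DifferentiableOn ℂ Y {s | 0 < s.re} := by
    have h := differentiableOn_gaussian_transform ham hA
    refine DifferentiableOn.comp (g := fun s : ℂ => ∫ x, a x * Complex.exp (-(s * (‖x‖ ^ 2 : ℝ))))
      (f := fun s : ℂ => s / 4) h (differentiableOn_id.div_const 4) fun s hs => ?_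
    have hs' : 0 < s.re := hs
    have : (s / 4).re = s.re / 4 := by simp
    change 0 < (s / 4).re
    rw [this]
    positivity
  have hYy : ∀ b : ℝ, y b = Y b := by
    intro b
    refine integral_congr_ae (Filter.Eventually.of_forall fun X => ?_)
    simp only []
    push_cast
    congr 2
    ring
  have han := analyticOnNhd_of_holomorphic hYd (fun b _ => hYy b)
  have hdy : ∀ b, 0 < b → DifferentiableAt ℝ y b := fun b hb => (han b hb).differentiableAt
  obtain ⟨b₀, r₀, hb₀, hr₀, hne⟩ := exists_gauss_ne_zero hψ hφm hC hφ
  have hyne : y b₀ ≠ 0 := by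
    rw [hy b₀ hb₀]
    intro h0
    rw [hνf b₀ r₀ hb₀ hr₀, h0, zero_mul] at hne
    exact hne rfl
  obtain ⟨E, hE⟩ := exists_ode_of_addition_formula (one_le_m_k H).1 hdy hadd hb₀ hyne
  rw [hl]
  rcases hν.eq_or_lt with h0 | hpos
  · subst h0
    have hode : ∀ b : ℝ, 0 < b → (b : ℂ) ^ 2 * deriv y b = (E - m H * b) * y b := by
      intro b hb
      have := hE b hb
      simpa using this
    have hsol := fun b hb => ode_solution_of_zero hdy hode (b := b) hb
    have hc : y 1 * Complex.exp E ≠ 0 := by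
      intro h0
      rw [hsol b₀ hb₀, h0, zero_mul, zero_mul] at hyne
      exact hyne rfl
    -- For ν = 0 the argument that gave the frequency is repeated in the 𝔳 variable, with d = 2m. It
    -- makes E real, so that e^{-E/τ} is positive.
    have hs := exponent_nonneg_of_bound hYd (d := 2 * m H) hc
      (fun s hs => by rw [← hYy, hsol s hs])
      (C := A * Real.pi ^ ((Module.finrank ℝ v : ℝ) / 2) *
        (1 / 4) ^ (-(Module.finrank ℝ v : ℝ) / 2)) (fun s hs => by
        have hre : (s / 4).re = 1 / 4 * s.re := by
          simp
          ring
        have := norm_gaussian_transform_le hA (s := s / 4) (by rw [hre]; positivity)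
        rw [hre, Real.mul_rpow (by norm_num) hs.le, ← mul_assoc] at this
        rw [← HTypeAlgebra.finrank_eq H]
        exact this)
    refine ⟨_, fun τ => τ ^ (-((2 * m H : ℕ) : ℝ) / 2) * Real.exp (-(E.re / τ)), hc,
      fun τ hτ => mul_pos (Real.rpow_pos_of_pos hτ _) (Real.exp_pos _), fun τ hτ => ?_⟩
    have hEr : E = (E.re : ℂ) := Complex.ext rfl (by simpa using hs.1)
    refine (hsol τ hτ).trans ?_
    rw [Complex.ofReal_mul, ← mul_assoc]
    congr 1
    rw [hEr]
    push_cast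
    simp
  · obtain ⟨c, j, hc, hsol⟩ := ode_solution_of_pos hpos han hE hb₀ hyne
    refine ⟨c, fun b => (b - ν) ^ j / (b + ν) ^ (m H + j), hc, fun τ hτ => ?_, hsol⟩
    have h1 : 0 < τ - ν := sub_pos.2 hτ
    have h2 : 0 < τ + ν := by linarith
    positivity

end HTypeGroup

/-! ### Subordination and a Laplace representation -/

/-- The Cauchy–Schlömilch integral. -/
theorem integral_exp_neg_sq_sub_div {α w : ℝ} (hα : 0 < α) (hw : 0 < w) :
    ∫ u in Set.Ioi (0 : ℝ), Real.exp (-(α * u - w / u) ^ 2) = Real.sqrt Real.pi / (2 * α) := by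
  set φ : ℝ → ℝ := fun u => α * u - w / u with hφ
  have hderiv : ∀ u ∈ Set.Ioi (0 : ℝ),
      HasDerivWithinAt φ (α + w / u ^ 2) (Set.Ioi 0) u := by
    intro u hu
    have hu' : u ≠ 0 := ne_of_gt hu
    have h1 := ((hasDerivAt_id u).const_mul α).fun_sub ((hasDerivAt_inv hu').const_mul w)
    refine (h1.congr_deriv ?_).hasDerivWithinAt
    field_simp
    ring
  have hinj : Set.InjOn φ (Set.Ioi 0) := by
    intro x hx y hy hxy
    have hx' : 0 < x := hx
    have hy' : 0 < y := hy
    simp only [hφ] at hxy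
    field_simp at hxy
    have h2 : (x - y) * (α * x * y + w) = 0 := by linear_combination hxy
    rcases mul_eq_zero.1 h2 with h | h
    · linarith
    · have : 0 < α * x * y + w := by positivity
      linarith
  have himg : φ '' Set.Ioi 0 = Set.univ := by
    refine Set.eq_univ_of_forall fun t => ?_
    have hs : |t| < Real.sqrt (t ^ 2 + 4 * α * w) := by
      rw [← Real.sqrt_sq_eq_abs]
      exact Real.sqrt_lt_sqrt (sq_nonneg _) (by nlinarith [mul_pos hα hw])
    have hs2 := Real.sq_sqrt (show 0 ≤ t ^ 2 + 4 * α * w by positivity)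
    set S := Real.sqrt (t ^ 2 + 4 * α * w)
    have hpos : 0 < t + S := by
      linarith [neg_abs_le t]
    -- The positive root of αu² - tu - w = 0.
    refine ⟨(t + S) / (2 * α), div_pos hpos (by positivity), ?_⟩
    have hne := hpos.ne'
    simp only [hφ]
    field_simp
    linear_combination hs2
  have habs : ∀ u ∈ Set.Ioi (0 : ℝ), |α + w / u ^ 2| = α + w / u ^ 2 := fun u _ =>
    abs_of_pos (by positivity)
  have hg : Integrable fun x : ℝ => Real.exp (-x ^ 2) := by
    simpa using integrable_exp_neg_mul_sq (b := 1) one_pos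
  have h1 : ∫ u in Set.Ioi (0 : ℝ), (α + w / u ^ 2) * Real.exp (-(φ u) ^ 2) =
      Real.sqrt Real.pi := by
    have h := integral_image_eq_integral_abs_deriv_smul measurableSet_Ioi hderiv hinj
      (fun x => Real.exp (-x ^ 2))
    rw [himg, setIntegral_univ] at h
    have h2 := integral_gaussian 1
    simp only [neg_mul, one_mul, div_one] at h2
    rw [← h2, h]
    refine setIntegral_congr_fun measurableSet_Ioi fun u hu => ?_
    simp only [smul_eq_mul]
    rw [habs u hu]
  have hi1 : IntegrableOn (fun u => (α + w / u ^ 2) * Real.exp (-(φ u) ^ 2)) (Set.Ioi 0) := by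
    have h := (integrableOn_image_iff_integrableOn_abs_deriv_smul measurableSet_Ioi hderiv hinj
      (fun x => Real.exp (-x ^ 2))).1 hg.integrableOn
    refine h.congr_fun (fun u hu => ?_) measurableSet_Ioi
    simp only [smul_eq_mul]
    rw [habs u hu]
  have hi2 : IntegrableOn (fun u => Real.exp (-(φ u) ^ 2)) (Set.Ioi 0) := by
    have h := ((integrable_exp_neg_mul_sq (b := α ^ 2) (by positivity)).const_mul
      (Real.exp (2 * α * w))).integrableOn (s := Set.Ioi 0)
    refine h.mono' (Measurable.aestronglyMeasurable (by fun_prop)) ?_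
    filter_upwards [ae_restrict_mem measurableSet_Ioi] with u hu
    have hu' : 0 < u := hu
    rw [Real.norm_of_nonneg (Real.exp_pos _).le, ← Real.exp_add, Real.exp_le_exp]
    have : α * u * (w / u) = α * w := by field_simp
    simp only [hφ]
    nlinarith [sq_nonneg (w / u)]
  have hi3 : IntegrableOn (fun u => w / u ^ 2 * Real.exp (-(φ u) ^ 2)) (Set.Ioi 0) := by
    refine (hi1.sub (hi2.const_mul α)).congr_fun (fun u _ => ?_) measurableSet_Ioi
    simp only [Pi.sub_apply]
    ring
  -- The substitution u ↦ w/(αu) changes the sign of αu - w/u. Hence the two terms of φ' = α + w/u²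
  -- contribute equally, and each is half of the Gaussian integral √π.
  have h2 : ∫ u in Set.Ioi (0 : ℝ), w / u ^ 2 * Real.exp (-(φ u) ^ 2) =
      α * ∫ u in Set.Ioi (0 : ℝ), Real.exp (-(φ u) ^ 2) := by
    have hd : ∀ u ∈ Set.Ioi (0 : ℝ),
        HasDerivWithinAt (fun u => w / α / u) (-(w / α / u ^ 2)) (Set.Ioi 0) u := by
      intro u hu
      have hu' : u ≠ 0 := ne_of_gt hu
      refine (((hasDerivAt_inv hu').const_mul (w / α)).congr_deriv ?_).hasDerivWithinAt
      field_simp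
    have hin : Set.InjOn (fun u : ℝ => w / α / u) (Set.Ioi 0) := by
      intro x hx y hy hxy
      have hx' : 0 < x := hx
      have hy' : 0 < y := hy
      simp only at hxy
      field_simp at hxy
      exact hxy.symm
    have him : (fun u : ℝ => w / α / u) '' Set.Ioi 0 = Set.Ioi 0 := by
      ext t
      constructor
      · rintro ⟨u, hu, rfl⟩
        have hu' : 0 < u := hu
        exact div_pos (by positivity) hu'
      · intro ht
        have ht' : 0 < t := ht
        refine ⟨w / α / t, div_pos (by positivity) ht', ?_⟩
        simp only
        field_simp
    have h := integral_image_eq_integral_abs_deriv_smul measurableSet_Ioi hd hin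
      (fun x => Real.exp (-(φ x) ^ 2))
    rw [him] at h
    rw [h, ← integral_const_mul]
    refine setIntegral_congr_fun measurableSet_Ioi fun u hu => ?_
    have hu' : 0 < u := hu
    simp only [smul_eq_mul, hφ]
    rw [abs_neg, abs_of_pos (by positivity), ← mul_assoc]
    congr 1
    · field_simp
    · congr 2
      rw [← neg_sq]
      congr 1
      field_simp
      ring
  have h3 : ∫ u in Set.Ioi (0 : ℝ), (α + w / u ^ 2) * Real.exp (-(φ u) ^ 2) =
      α * (∫ u in Set.Ioi (0 : ℝ), Real.exp (-(φ u) ^ 2)) +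
      ∫ u in Set.Ioi (0 : ℝ), w / u ^ 2 * Real.exp (-(φ u) ^ 2) := by
    rw [← integral_const_mul, ← integral_add (hi2.const_mul α) hi3]
    refine integral_congr_ae (Filter.Eventually.of_forall fun u => ?_)
    simp only []
    ring
  rw [h1, h2] at h3
  rw [eq_div_iff (by positivity)]
  linarith

/-- The subordination identity. -/
theorem integral_subordination {τ w : ℝ} (hτ : 0 < τ) (hw : 0 < w) :
    ∫ s in Set.Ioi (0 : ℝ), s ^ (-(3 / 2) : ℝ) * Real.exp (-(τ ^ 2 / (4 * s)) - s * w ^ 2) =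
      2 * Real.sqrt Real.pi / τ * Real.exp (-(w * τ)) := by
  -- With s = x^{-2} the exponent becomes -(τx/2 - w/x)² - wτ, and the powers of x cancel.
  rw [← integral_comp_rpow_Ioi _ (p := -2) (by norm_num)]
  have h := integral_exp_neg_sq_sub_div (α := τ / 2) (by positivity) hw
  have e : ∀ x ∈ Set.Ioi (0 : ℝ), (|(-2 : ℝ)| * x ^ ((-2 : ℝ) - 1)) •
      ((x ^ (-2 : ℝ)) ^ (-(3 / 2) : ℝ) *
        Real.exp (-(τ ^ 2 / (4 * x ^ (-2 : ℝ))) - x ^ (-2 : ℝ) * w ^ 2)) =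
      2 * Real.exp (-(w * τ)) * Real.exp (-(τ / 2 * x - w / x) ^ 2) := by
    intro x hx
    have hx' : 0 < x := hx
    have e1 : x ^ ((-2 : ℝ) - 1) * (x ^ (-2 : ℝ)) ^ (-(3 / 2) : ℝ) = 1 := by
      rw [← Real.rpow_mul hx'.le, ← Real.rpow_add hx']
      norm_num
    have e2 : x ^ (-2 : ℝ) = (x ^ 2)⁻¹ := by
      rw [Real.rpow_neg hx'.le, Real.rpow_two]
    rw [smul_eq_mul, mul_assoc 2 _ (Real.exp _), ← Real.exp_add, abs_neg, abs_two, mul_assoc,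
      ← mul_assoc (x ^ _), e1, one_mul, e2]
    congr 2
    field_simp
    ring
  rw [setIntegral_congr_fun measurableSet_Ioi e, integral_const_mul, h]
  field_simp

/-- The substitution x = τ² - ν² turns this into a Gamma integral. -/
theorem integral_mul_exp_neg_sq_mul_sub_sq_rpow {ν s β : ℝ} (hν : 0 ≤ ν) (hs : 0 < s)
    (hβ : 0 < β) :
    IntegrableOn (fun τ => τ * Real.exp (-(τ ^ 2 / (4 * s))) * (τ ^ 2 - ν ^ 2) ^ (β - 1))
      (Set.Ioi ν) ∧
    ∫ τ in Set.Ioi ν, τ * Real.exp (-(τ ^ 2 / (4 * s))) * (τ ^ 2 - ν ^ 2) ^ (β - 1) =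
      Real.Gamma β * 4 ^ β / 2 * (s ^ β * Real.exp (-(ν ^ 2 / (4 * s)))) := by
  have hd : ∀ τ ∈ Set.Ioi ν,
      HasDerivWithinAt (fun τ => τ ^ 2 - ν ^ 2) (2 * τ) (Set.Ioi ν) τ := by
    intro τ _
    have := ((hasDerivAt_id τ).fun_pow 2).sub_const (ν ^ 2)
    exact (this.congr_deriv (by simp)).hasDerivWithinAt
  have hin : Set.InjOn (fun τ : ℝ => τ ^ 2 - ν ^ 2) (Set.Ioi ν) := by
    intro x hx y hy hxy
    have hx' : 0 < x := hν.trans_lt hx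
    have hy' : 0 < y := hν.trans_lt hy
    simp only [sub_left_inj] at hxy
    exact (pow_left_inj₀ hx'.le hy'.le two_ne_zero).1 hxy
  have him : (fun τ : ℝ => τ ^ 2 - ν ^ 2) '' Set.Ioi ν = Set.Ioi 0 := by
    ext t
    constructor
    · rintro ⟨u, hu, rfl⟩
      have hu' : ν < u := hu
      simp only [Set.mem_Ioi]
      nlinarith
    · intro ht
      have ht' : 0 < t := ht
      refine ⟨Real.sqrt (t + ν ^ 2), ?_, ?_⟩
      · change ν < _
        exact Real.lt_sqrt_of_sq_lt (by linarith)
      · simp only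
        rw [Real.sq_sqrt (by positivity)]
        ring
  have he : ∀ τ ∈ Set.Ioi ν, |2 * τ| • (1 / 2 * Real.exp (-(ν ^ 2 / (4 * s))) *
      ((τ ^ 2 - ν ^ 2) ^ (β - 1) * Real.exp (-(1 / (4 * s) * (τ ^ 2 - ν ^ 2))))) =
      τ * Real.exp (-(τ ^ 2 / (4 * s))) * (τ ^ 2 - ν ^ 2) ^ (β - 1) := by
    intro τ hτ
    have hτ' : 0 < τ := hν.trans_lt hτ
    have e : Real.exp (-(τ ^ 2 / (4 * s))) = Real.exp (-(ν ^ 2 / (4 * s))) *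
        Real.exp (-(1 / (4 * s) * (τ ^ 2 - ν ^ 2))) := by
      rw [← Real.exp_add]
      congr 1
      field_simp
      ring
    rw [e, smul_eq_mul, abs_of_pos (by positivity)]
    ring
  have h1 := integral_image_eq_integral_abs_deriv_smul measurableSet_Ioi hd hin
    (fun x => 1 / 2 * Real.exp (-(ν ^ 2 / (4 * s))) *
      (x ^ (β - 1) * Real.exp (-(1 / (4 * s) * x))))
  have h2 := (integrableOn_image_iff_integrableOn_abs_deriv_smul measurableSet_Ioi hd hin
    (fun x => 1 / 2 * Real.exp (-(ν ^ 2 / (4 * s))) *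
      (x ^ (β - 1) * Real.exp (-(1 / (4 * s) * x))))).1 (by
      rw [him]
      refine Integrable.const_mul ?_ _
      have := integrableOn_rpow_mul_exp_neg_mul_rpow (p := 1) (s := β - 1) (b := 1 / (4 * s))
        (by linarith) one_pos (by positivity)
      simpa only [Real.rpow_one, neg_mul, IntegrableOn] using this)
  refine ⟨h2.congr_fun he measurableSet_Ioi, ?_⟩
  rw [← setIntegral_congr_fun measurableSet_Ioi he, ← h1, him, integral_const_mul,
    Real.integral_rpow_mul_exp_neg_mul_Ioi hβ (by positivity), one_div_one_div,
    Real.mul_rpow (by norm_num) hs.le]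
  ring

/-- A Laplace representation of the Bessel `K` type integral. -/
theorem integral_exp_neg_mul_sub_sq_rpow {ν w β : ℝ} (hν : 0 ≤ ν) (hw : 0 < w)
    (hβ : 1 / 2 < β) :
    ∫ τ in Set.Ioi ν, Real.exp (-(w * τ)) * (τ ^ 2 - ν ^ 2) ^ (β - 1) =
      Real.Gamma β * 4 ^ β / (4 * Real.sqrt Real.pi) *
        ∫ s in Set.Ioi (0 : ℝ), s ^ (β - 3 / 2) * Real.exp (-(s * w ^ 2) - ν ^ 2 / (4 * s)) := by
  have hpi := Real.pi_pos
  -- Integrating this kernel over s gives e^{-wτ} by subordination; integrating over τ gives a Gamma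
  -- integral. The identity compares the two orders, and the second also proves integrability since
  -- F ≥ 0.
  let F : ℝ → ℝ → ℝ := fun τ s =>
    (τ ^ 2 - ν ^ 2) ^ (β - 1) * τ *
      (s ^ (-(3 / 2) : ℝ) * Real.exp (-(τ ^ 2 / (4 * s)) - s * w ^ 2))
  have hFs : ∀ s ∈ Set.Ioi (0 : ℝ), ∀ τ, F τ s = s ^ (-(3 / 2) : ℝ) * Real.exp (-(s * w ^ 2)) *
      (τ * Real.exp (-(τ ^ 2 / (4 * s))) * (τ ^ 2 - ν ^ 2) ^ (β - 1)) := by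
    intro s _ τ
    simp only [F]
    rw [sub_eq_add_neg (-(τ ^ 2 / (4 * s))), Real.exp_add]
    ring
  have hint_s : ∀ s ∈ Set.Ioi (0 : ℝ), ∫ τ in Set.Ioi ν, F τ s = Real.Gamma β * 4 ^ β / 2 *
      (s ^ (β - 3 / 2) * Real.exp (-(s * w ^ 2) - ν ^ 2 / (4 * s))) := by
    intro s hs
    have hs' : 0 < s := hs
    simp_rw [hFs s hs]
    rw [integral_const_mul, (integral_mul_exp_neg_sq_mul_sub_sq_rpow hν hs' (by linarith)).2]
    rw [sub_eq_add_neg β, Real.rpow_add hs', sub_eq_add_neg (-(s * w ^ 2)), Real.exp_add]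
    ring
  have hF0 : ∀ τ ∈ Set.Ioi ν, ∀ s ∈ Set.Ioi (0 : ℝ), 0 ≤ F τ s := by
    intro τ hτ s hs
    have hτ' : ν < τ := hτ
    have hs' : 0 < s := hs
    have h1 : 0 ≤ τ := hν.trans hτ'.le
    have h2 : 0 ≤ τ ^ 2 - ν ^ 2 := by nlinarith
    positivity
  have hI : Integrable (Function.uncurry F)
      ((volume.restrict (Set.Ioi ν)).prod (volume.restrict (Set.Ioi (0 : ℝ)))) := by
    have hm : Measurable (Function.uncurry F) := by
      simp only [F, Function.uncurry_def]
      fun_prop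
    rw [integrable_prod_iff' hm.aestronglyMeasurable]
    constructor
    · filter_upwards [ae_restrict_mem measurableSet_Ioi] with s hs
      simp only [Function.uncurry, hFs s hs]
      exact (integral_mul_exp_neg_sq_mul_sub_sq_rpow hν hs (by linarith)).1.const_mul _
    · have hdom : IntegrableOn (fun s => Real.Gamma β * 4 ^ β / 2 *
          (s ^ (β - 3 / 2) * Real.exp (-(s * w ^ 2) - ν ^ 2 / (4 * s)))) (Set.Ioi 0) := by
        refine Integrable.const_mul ?_ _
        have := integrableOn_rpow_mul_exp_neg_mul_rpow (p := 1) (s := β - 3 / 2) (b := w ^ 2)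
          (by linarith) one_pos (by positivity)
        refine Integrable.mono' this (Measurable.aestronglyMeasurable (by fun_prop)) ?_
        filter_upwards [ae_restrict_mem measurableSet_Ioi] with s hs
        have hs' : 0 < s := hs
        rw [Real.norm_of_nonneg (by positivity), Real.rpow_one]
        refine mul_le_mul_of_nonneg_left (Real.exp_le_exp.2 ?_) (by positivity)
        have : 0 ≤ ν ^ 2 / (4 * s) := by positivity
        linarith
      refine hdom.congr ?_
      filter_upwards [ae_restrict_mem measurableSet_Ioi] with s hs
      rw [← hint_s s hs]
      refine setIntegral_congr_fun measurableSet_Ioi fun τ hτ => ?_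
      exact (Real.norm_of_nonneg (hF0 τ hτ s hs)).symm
  have hswap := integral_integral_swap hI
  rw [setIntegral_congr_fun measurableSet_Ioi hint_s, integral_const_mul] at hswap
  have hτ : ∀ τ ∈ Set.Ioi ν, ∫ s in Set.Ioi (0 : ℝ), F τ s =
      2 * Real.sqrt Real.pi * (Real.exp (-(w * τ)) * (τ ^ 2 - ν ^ 2) ^ (β - 1)) := by
    intro τ hτ
    have hτ' : 0 < τ := hν.trans_lt hτ
    simp only [F]
    rw [integral_const_mul, integral_subordination hτ' hw]
    field_simp
  rw [setIntegral_congr_fun measurableSet_Ioi hτ, integral_const_mul] at hswap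
  have hsp : 0 < Real.sqrt Real.pi := Real.sqrt_pos.2 hpi
  rw [div_mul_eq_mul_div, eq_div_iff (by positivity)]
  linear_combination 2 * hswap

/-! ### Gamma integrals of Gaussians and the superposition argument -/

section

variable {E : Type*} [NormedAddCommGroup E] [InnerProductSpace ℝ E] [FiniteDimensional ℝ E]
  [MeasurableSpace E] [BorelSpace E]

/-- Integrating out the Euclidean variable leaves a multiple of s^{Q-1-n/2} e^{-w²s}, n the
dimension; Q > n/2 is its integrability at 0. -/
theorem integrable_rpow_mul_gaussian {w Q : ℝ} (hw : 0 < w)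
    (hQ : (Module.finrank ℝ E : ℝ) / 2 < Q) :
    Integrable (fun p : E × ℝ =>
        p.2 ^ (Q - 1) * Real.exp (-(w ^ 2 * p.2)) * Real.exp (-(p.2 * ‖p.1‖ ^ 2)))
      ((volume : Measure E).prod (volume.restrict (Set.Ioi (0 : ℝ)))) := by
  have hpi := Real.pi_pos
  have hm : Measurable (fun p : E × ℝ =>
      p.2 ^ (Q - 1) * Real.exp (-(w ^ 2 * p.2)) * Real.exp (-(p.2 * ‖p.1‖ ^ 2))) := by
    fun_prop
  rw [integrable_prod_iff' hm.aestronglyMeasurable]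
  constructor
  · filter_upwards [ae_restrict_mem measurableSet_Ioi] with s hs
    exact (integrable_gaussian hs).const_mul _
  · have h := integrableOn_rpow_mul_exp_neg_mul_rpow (p := 1)
      (s := Q - 1 - (Module.finrank ℝ E : ℝ) / 2) (b := w ^ 2) (by linarith) one_pos (by positivity)
    refine (Integrable.const_mul h (Real.pi ^ ((Module.finrank ℝ E : ℝ) / 2))).congr ?_
    filter_upwards [ae_restrict_mem measurableSet_Ioi] with s hs
    have hs' : 0 < s := hs
    have e : ∀ Z : E, ‖s ^ (Q - 1) * Real.exp (-(w ^ 2 * s)) * Real.exp (-(s * ‖Z‖ ^ 2))‖ =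
        s ^ (Q - 1) * Real.exp (-(w ^ 2 * s)) * Real.exp (-(s * ‖Z‖ ^ 2)) := fun Z =>
      Real.norm_of_nonneg (by positivity)
    simp_rw [e]
    rw [integral_const_mul, integral_gaussian_real hs', Real.div_rpow hpi.le hs'.le,
      Real.rpow_sub hs', Real.rpow_one, neg_mul]
    field_simp

theorem integral_rpow_mul_gaussian {w Q : ℝ} (hw : 0 < w) (hQ : 0 < Q) (Z : E) :
    ∫ s in Set.Ioi (0 : ℝ),
      s ^ (Q - 1) * Real.exp (-(w ^ 2 * s)) * Real.exp (-(s * ‖Z‖ ^ 2)) =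
      Real.Gamma Q * ((w ^ 2 + ‖Z‖ ^ 2) ^ Q)⁻¹ := by
  have h := Real.integral_rpow_mul_exp_neg_mul_Ioi hQ (r := w ^ 2 + ‖Z‖ ^ 2) (by positivity)
  rw [one_div, Real.inv_rpow (by positivity)] at h
  rw [mul_comm, ← h]
  refine setIntegral_congr_fun measurableSet_Ioi fun s _ => ?_
  rw [mul_assoc, ← Real.exp_add]
  congr 2
  ring

/-- The partial Fourier transform in the central variable. -/
theorem integral_inv_rpow_mul {B : E → ℂ} (hBm : Measurable B) {C ν : ℝ}
    (hBC : ∀ Z, ‖B Z‖ ≤ C) (hν : 0 ≤ ν)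
    (hB : ∀ s : ℝ, 0 < s → ∫ Z : E, (Real.exp (-(s * ‖Z‖ ^ 2)) : ℂ) * B Z =
      (((Real.pi / s) ^ ((Module.finrank ℝ E : ℝ) / 2) * Real.exp (-(ν ^ 2 / (4 * s))) : ℝ) : ℂ))
    {w Q β : ℝ} (hw : 0 < w) (hQ : (Module.finrank ℝ E : ℝ) / 2 < Q)
    (hβ : β = Q + 1 / 2 - (Module.finrank ℝ E : ℝ) / 2) :
    Integrable (fun Z : E => (((w ^ 2 + ‖Z‖ ^ 2) ^ Q)⁻¹ : ℝ) * B Z) ∧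
    ∫ Z : E, (((w ^ 2 + ‖Z‖ ^ 2) ^ Q)⁻¹ : ℝ) * B Z =
      ((Real.pi ^ ((Module.finrank ℝ E : ℝ) / 2) * (4 * Real.sqrt Real.pi) /
        (Real.Gamma Q * (Real.Gamma β * 4 ^ β)) *
        ∫ τ in Set.Ioi ν, Real.exp (-(w * τ)) * (τ ^ 2 - ν ^ 2) ^ (β - 1) : ℝ) : ℂ) := by
  have hpi := Real.pi_pos
  have hQ0 : 0 < Q := lt_of_le_of_lt (by positivity) hQ
  have hG := Real.Gamma_pos_of_pos hQ0
  have hGβ := Real.Gamma_pos_of_pos (show 0 < β by linarith)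
  let F : E × ℝ → ℂ := fun p => B p.1 *
    ((p.2 ^ (Q - 1) * Real.exp (-(w ^ 2 * p.2)) * Real.exp (-(p.2 * ‖p.1‖ ^ 2)) : ℝ) : ℂ)
  have hF : Integrable F ((volume : Measure E).prod (volume.restrict (Set.Ioi (0 : ℝ)))) :=
    ((integrable_rpow_mul_gaussian hw hQ).ofReal (𝕜 := ℂ)).bdd_mul
      (hBm.comp measurable_fst).aestronglyMeasurable
      (Filter.Eventually.of_forall fun p => hBC p.1)
  have hs : ∀ Z : E, ∫ s in Set.Ioi (0 : ℝ), F (Z, s) =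
      (Real.Gamma Q : ℂ) * ((((w ^ 2 + ‖Z‖ ^ 2) ^ Q)⁻¹ : ℝ) * B Z) := by
    intro Z
    simp only [F]
    rw [integral_const_mul, integral_complex_ofReal, integral_rpow_mul_gaussian hw hQ0]
    push_cast
    ring
  have hGne : (Real.Gamma Q : ℂ) ≠ 0 := by exact_mod_cast hG.ne'
  have hint := hF.integral_prod_left
  simp only [hs] at hint
  refine ⟨?_, ?_⟩
  · have := hint.const_mul (Real.Gamma Q : ℂ)⁻¹
    simpa only [inv_mul_cancel_left₀ hGne] using this
  have hswap := integral_integral_swap (f := fun Z s => F (Z, s)) hF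
  simp only [hs] at hswap
  rw [integral_const_mul] at hswap
  have hZ : ∀ s ∈ Set.Ioi (0 : ℝ), ∫ Z : E, F (Z, s) =
      ((Real.pi ^ ((Module.finrank ℝ E : ℝ) / 2) *
        (s ^ (β - 3 / 2) * Real.exp (-(s * w ^ 2) - ν ^ 2 / (4 * s))) : ℝ) : ℂ) := by
    intro s hs
    have hs' : 0 < s := hs
    have e : ∀ Z : E, F (Z, s) = ((s ^ (Q - 1) * Real.exp (-(w ^ 2 * s)) : ℝ) : ℂ) *
        ((Real.exp (-(s * ‖Z‖ ^ 2)) : ℂ) * B Z) := by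
      intro Z
      simp only [F]
      push_cast
      ring
    simp_rw [e]
    rw [integral_const_mul, hB s hs', ← Complex.ofReal_mul, Real.div_rpow hpi.le hs'.le,
      show β - 3 / 2 = Q - 1 - (Module.finrank ℝ E : ℝ) / 2 by rw [hβ]; ring,
      Real.rpow_sub hs' (Q - 1), sub_eq_add_neg (-(s * w ^ 2)), Real.exp_add, mul_comm (w ^ 2)]
    congr 1
    field_simp
  rw [setIntegral_congr_fun measurableSet_Ioi hZ, integral_complex_ofReal, integral_const_mul]
    at hswap
  -- This replaces a dependence on w² by an exponential of w itself. For w = a + |X|²/4 the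
  -- integrand then becomes Gaussian in X.
  rw [integral_exp_neg_mul_sub_sq_rpow hν hw (by linarith)]
  have h4 : (0 : ℝ) < 4 ^ β := by positivity
  have hsp : 0 < Real.sqrt Real.pi := Real.sqrt_pos.2 hpi
  rw [← mul_right_inj' hGne, hswap, ← Complex.ofReal_mul]
  congr 1
  generalize ∫ s in Set.Ioi (0 : ℝ),
    s ^ (β - 3 / 2) * Real.exp (-(s * w ^ 2) - ν ^ 2 / (4 * s)) = I
  field_simp

/-- Integrating out X leaves at most a multiple of e^{-aτ} τ^{2(β-1)-n/2}, n the dimension. Here β ≥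
1 permits (τ²-ν²)^{β-1} ≤ τ^{2(β-1)}, and n/2 < 2β - 1 gives integrability at 0. -/
theorem integrable_exp_mul_sub_sq_rpow_mul_gaussian {a ν β : ℝ} (ha : 0 < a) (hν : 0 ≤ ν)
    (hβ1 : 1 ≤ β) (hβ : (Module.finrank ℝ E : ℝ) / 2 < 2 * β - 1) :
    Integrable (fun p : E × ℝ =>
        Real.exp (-((a + ‖p.1‖ ^ 2 / 4) * p.2)) * (p.2 ^ 2 - ν ^ 2) ^ (β - 1))
      ((volume : Measure E).prod (volume.restrict (Set.Ioi ν))) := by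
  have hpi := Real.pi_pos
  have hm : Measurable (fun p : E × ℝ =>
      Real.exp (-((a + ‖p.1‖ ^ 2 / 4) * p.2)) * (p.2 ^ 2 - ν ^ 2) ^ (β - 1)) := by
    fun_prop
  have he : ∀ (τ : ℝ) (X : E), Real.exp (-((a + ‖X‖ ^ 2 / 4) * τ)) * (τ ^ 2 - ν ^ 2) ^ (β - 1) =
      Real.exp (-(a * τ)) * (τ ^ 2 - ν ^ 2) ^ (β - 1) * Real.exp (-(τ / 4 * ‖X‖ ^ 2)) := by
    intro τ X
    rw [mul_right_comm, ← Real.exp_add]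
    congr 2
    ring
  rw [integrable_prod_iff' hm.aestronglyMeasurable]
  constructor
  · filter_upwards [ae_restrict_mem measurableSet_Ioi] with τ hτ
    have hτ' : 0 < τ := hν.trans_lt hτ
    simp only [he]
    exact (integrable_gaussian (by positivity)).const_mul _
  · have h := integrableOn_rpow_mul_exp_neg_mul_rpow (p := 1)
      (s := 2 * (β - 1) - (Module.finrank ℝ E : ℝ) / 2) (b := a) (by linarith) one_pos ha
    have h' := Integrable.const_mul (h.mono_set (Set.Ioi_subset_Ioi hν))
      ((4 * Real.pi) ^ ((Module.finrank ℝ E : ℝ) / 2))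
    refine h'.mono' hm.aestronglyMeasurable.norm.prod_swap.integral_prod_right' ?_
    filter_upwards [ae_restrict_mem measurableSet_Ioi] with τ hτ
    have hτν : ν < τ := hτ
    have hτ' : 0 < τ := hν.trans_lt hτν
    have h0 : 0 ≤ τ ^ 2 - ν ^ 2 := by nlinarith
    have e : ∀ X : E, ‖Real.exp (-((a + ‖X‖ ^ 2 / 4) * τ)) * (τ ^ 2 - ν ^ 2) ^ (β - 1)‖ =
        Real.exp (-(a * τ)) * (τ ^ 2 - ν ^ 2) ^ (β - 1) * Real.exp (-(τ / 4 * ‖X‖ ^ 2)) := by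
      intro X
      rw [Real.norm_of_nonneg (by positivity), he]
    simp_rw [e]
    rw [integral_const_mul, integral_gaussian_real (by positivity),
      Real.norm_of_nonneg (by positivity)]
    have h1 : (τ ^ 2 - ν ^ 2) ^ (β - 1) ≤ τ ^ (2 * (β - 1)) := by
      rw [Real.rpow_mul hτ'.le, Real.rpow_two]
      exact Real.rpow_le_rpow h0 (by nlinarith) (by linarith)
    rw [show Real.pi / (τ / 4) = 4 * Real.pi / τ by field_simp, Real.div_rpow (by positivity) hτ'.le,
      Real.rpow_sub hτ' (2 * (β - 1)), Real.rpow_one, neg_mul]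
    calc _ ≤ Real.exp (-(a * τ)) * τ ^ (2 * (β - 1)) *
          ((4 * Real.pi) ^ ((Module.finrank ℝ E : ℝ) / 2) /
            τ ^ ((Module.finrank ℝ E : ℝ) / 2)) := by gcongr
      _ = _ := by ring

/-- Nonvanishing of a superposition of multiples of positive numbers. -/
theorem integral_mul_ne_zero_of_transform {A : E → ℂ} (hAm : Measurable A) {C ν : ℝ}
    (hAC : ∀ X, ‖A X‖ ≤ C) (hν : 0 ≤ ν) {c : ℂ} {g : ℝ → ℝ} (hc : c ≠ 0)
    (hg : ∀ τ, ν < τ → 0 < g τ)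
    (hA : ∀ τ, ν < τ → ∫ X, A X * (Real.exp (-(τ * ‖X‖ ^ 2 / 4)) : ℂ) = c * g τ)
    {a β : ℝ} (ha : 0 < a) (hβ1 : 1 ≤ β) (hβ : (Module.finrank ℝ E : ℝ) / 2 < 2 * β - 1) :
    ∫ X : E, A X * ((∫ τ in Set.Ioi ν, Real.exp (-((a + ‖X‖ ^ 2 / 4) * τ)) *
      (τ ^ 2 - ν ^ 2) ^ (β - 1) : ℝ) : ℂ) ≠ 0 := by
  let F : E × ℝ → ℂ := fun p => A p.1 *
    ((Real.exp (-((a + ‖p.1‖ ^ 2 / 4) * p.2)) * (p.2 ^ 2 - ν ^ 2) ^ (β - 1) : ℝ) : ℂ)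
  have hF : Integrable F ((volume : Measure E).prod (volume.restrict (Set.Ioi ν))) :=
    ((integrable_exp_mul_sub_sq_rpow_mul_gaussian ha hν hβ1 hβ).ofReal (𝕜 := ℂ)).bdd_mul
      (hAm.comp measurable_fst).aestronglyMeasurable
      (Filter.Eventually.of_forall fun p => hAC p.1)
  have hX : ∀ X : E, A X * ((∫ τ in Set.Ioi ν, Real.exp (-((a + ‖X‖ ^ 2 / 4) * τ)) *
      (τ ^ 2 - ν ^ 2) ^ (β - 1) : ℝ) : ℂ) = ∫ τ in Set.Ioi ν, F (X, τ) := by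
    intro X
    simp only [F]
    rw [integral_const_mul, integral_complex_ofReal]
  have hτ : ∀ τ ∈ Set.Ioi ν, ∫ X : E, F (X, τ) =
      c * ((Real.exp (-(a * τ)) * (τ ^ 2 - ν ^ 2) ^ (β - 1) * g τ : ℝ) : ℂ) := by
    intro τ hτ
    have e : ∀ X : E, F (X, τ) = ((Real.exp (-(a * τ)) * (τ ^ 2 - ν ^ 2) ^ (β - 1) : ℝ) : ℂ) *
        (A X * (Real.exp (-(τ * ‖X‖ ^ 2 / 4)) : ℂ)) := by
      intro X
      have : Real.exp (-((a + ‖X‖ ^ 2 / 4) * τ)) =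
          Real.exp (-(a * τ)) * Real.exp (-(τ * ‖X‖ ^ 2 / 4)) := by
        rw [← Real.exp_add]
        congr 1
        ring
      simp only [F, this]
      push_cast
      ring
    simp_rw [e]
    rw [integral_const_mul, hA τ hτ]
    push_cast
    ring
  have hint := hF.integral_prod_right
  -- Neither measurability nor integrability of g is assumed: both come from Fubini, after division
  -- by c.
  have hint' : IntegrableOn
      (fun τ => Real.exp (-(a * τ)) * (τ ^ 2 - ν ^ 2) ^ (β - 1) * g τ) (Set.Ioi ν) := by
    have h1 := (hint.const_mul c⁻¹).re
    refine h1.congr ?_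
    filter_upwards [ae_restrict_mem measurableSet_Ioi] with τ hτ'
    rw [hτ τ hτ', inv_mul_cancel_left₀ hc]
    exact Complex.ofReal_re _
  have hpos : ∀ τ ∈ Set.Ioi ν, 0 < Real.exp (-(a * τ)) * (τ ^ 2 - ν ^ 2) ^ (β - 1) * g τ := by
    intro τ hτ'
    have h1 : ν < τ := hτ'
    have h2 : 0 < τ ^ 2 - ν ^ 2 := by nlinarith
    have h3 := hg τ h1
    positivity
  simp_rw [hX]
  rw [integral_integral_swap (f := fun X τ => F (X, τ)) hF,
    setIntegral_congr_fun measurableSet_Ioi hτ, integral_const_mul, integral_complex_ofReal]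
  refine mul_ne_zero hc (Complex.ofReal_ne_zero.2 (ne_of_gt ?_))
  rw [setIntegral_pos_iff_support_of_nonneg_ae _ hint']
  · refine lt_of_lt_of_le ?_ (measure_mono (s := Set.Ioi ν) fun τ h => ⟨(hpos τ h).ne', h⟩)
    simp
  · filter_upwards [ae_restrict_mem measurableSet_Ioi] with τ h
    exact (hpos τ h).le

end

/-! ### Nonvanishing for the Poisson kernel -/

namespace HTypeGroup

variable {v z : Type*} [NormedAddCommGroup v] [InnerProductSpace ℝ v]
  [FiniteDimensional ℝ v] [MeasurableSpace v] [BorelSpace v]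
  [NormedAddCommGroup z] [InnerProductSpace ℝ z]
  [FiniteDimensional ℝ z] [MeasurableSpace z] [BorelSpace z] (H : HTypeAlgebra v z)

theorem poissonCore_eq (a : ℝ) (n : HTypeGroup H) : poissonCore H a n =
    a ^ (m H + k H) *
      (((a + ‖n.1‖ ^ 2 / 4) ^ 2 + ‖n.2‖ ^ 2) ^ ((m H : ℝ) + k H))⁻¹ := by
  rw [poissonCore, div_eq_mul_inv, ← Nat.cast_add, Real.rpow_natCast]

theorem finrank_div_two : (Module.finrank ℝ v : ℝ) / 2 = m H := by
  rw [HTypeAlgebra.finrank_eq H]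
  push_cast
  ring

/-- `integral_inv_rpow_mul` with w = a + |X|²/4 and Q = m + k. It matters that K does not depend on
X. -/
theorem integral_poissonCore_fiber {B : z → ℂ} (hBm : Measurable B) {C ν : ℝ}
    (hBC : ∀ Z, ‖B Z‖ ≤ C) (hν : 0 ≤ ν)
    (hB : ∀ s : ℝ, 0 < s → ∫ Z : z, (Real.exp (-(s * ‖Z‖ ^ 2)) : ℂ) * B Z =
      (((Real.pi / s) ^ ((Module.finrank ℝ z : ℝ) / 2) * Real.exp (-(ν ^ 2 / (4 * s))) : ℝ) : ℂ))
    {a : ℝ} (ha : 0 < a) :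
    ∃ K : ℝ, 0 < K ∧ ∀ X : v,
      Integrable (fun Z : z => (poissonCore H a (X, Z) : ℂ) * B Z) ∧
      ∫ Z : z, (poissonCore H a (X, Z) : ℂ) * B Z =
        ((K * ∫ τ in Set.Ioi ν, Real.exp (-((a + ‖X‖ ^ 2 / 4) * τ)) *
          (τ ^ 2 - ν ^ 2) ^ ((m H : ℝ) + (k H : ℝ) / 2 + 1 / 2 - 1) : ℝ) : ℂ) := by
  obtain ⟨hm, hk⟩ := one_le_m_k H
  have hm' : (1 : ℝ) ≤ m H := by exact_mod_cast hm
  have hk' : (1 : ℝ) ≤ k H := by exact_mod_cast hk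
  have hpi := Real.pi_pos
  set β : ℝ := (m H : ℝ) + (k H : ℝ) / 2 + 1 / 2 with hβ
  set Q : ℝ := (m H : ℝ) + k H with hQ
  have hfz : (Module.finrank ℝ z : ℝ) = k H := rfl
  have hGQ := Real.Gamma_pos_of_pos (show 0 < Q by linarith)
  have hGβ := Real.Gamma_pos_of_pos (show 0 < β by linarith)
  refine ⟨a ^ (m H + k H) * (Real.pi ^ ((Module.finrank ℝ z : ℝ) / 2) * (4 * Real.sqrt Real.pi) /
        (Real.Gamma Q * (Real.Gamma β * 4 ^ β))), by positivity, fun X => ?_⟩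
  have h := integral_inv_rpow_mul hBm hBC hν hB (w := a + ‖X‖ ^ 2 / 4) (Q := Q) (β := β)
    (by positivity) (by rw [hfz]; linarith) (by rw [hfz, hβ, hQ]; ring)
  have e : ∀ Z : z, (poissonCore H a (X, Z) : ℂ) * B Z = ((a ^ (m H + k H) : ℝ) : ℂ) *
      (((((a + ‖X‖ ^ 2 / 4) ^ 2 + ‖Z‖ ^ 2) ^ Q)⁻¹ : ℝ) * B Z) := by
    intro Z
    refine (congrArg (fun r : ℝ => (r : ℂ) * B Z) (poissonCore_eq H a _)).trans ?_
    rw [← mul_assoc, ← Complex.ofReal_mul]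
  simp_rw [e]
  refine ⟨h.1.const_mul _, ?_⟩
  rw [integral_const_mul, h.2, ← Complex.ofReal_mul, mul_assoc (a ^ (m H + k H))]

theorem poissonCore_pos {a : ℝ} (ha : 0 < a) (n : HTypeGroup H) : 0 < poissonCore H a n := by
  rw [poissonCore]
  positivity

/-- `integrable_poissonKernel` includes the factor `poissonConst`, whose positivity itself rests on
integrability of the core. The fibre formula with B = 1 and ν = 0 settles the core directly. -/
theorem integrable_poissonCore {a : ℝ} (ha : 0 < a) :
    Integrable (fun n : v × z => poissonCore H a n) ((volume : Measure v).prod volume) := by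
  obtain ⟨hm, hk⟩ := one_le_m_k H
  have hm' : (1 : ℝ) ≤ m H := by exact_mod_cast hm
  have hk' : (1 : ℝ) ≤ k H := by exact_mod_cast hk
  have hmeas : Measurable (fun n : v × z => poissonCore H a n) := by
    unfold poissonCore
    fun_prop
  obtain ⟨K, hK, h⟩ := integral_poissonCore_fiber H (B := fun _ => 1) (C := 1) (ν := 0)
    measurable_const (by simp) le_rfl (fun s hs => by
      simp only [mul_one]
      rw [integral_complex_ofReal, integral_gaussian_real hs]
      simp) ha
  have h0 : ∀ n : v × z, ‖poissonCore H a n‖ = poissonCore H a n := fun n =>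
    Real.norm_of_nonneg (poissonCore_pos H ha n).le
  rw [integrable_prod_iff hmeas.aestronglyMeasurable]
  constructor
  · refine Filter.Eventually.of_forall fun X => ?_
    simpa using (h X).1.re
  · have hF := (integrable_exp_mul_sub_sq_rpow_mul_gaussian (E := v) (a := a) (ν := 0)
      (β := (m H : ℝ) + (k H : ℝ) / 2 + 1 / 2) ha le_rfl (by linarith)
      (by rw [finrank_div_two H]; linarith)).integral_prod_left.const_mul K
    refine hF.congr (Filter.Eventually.of_forall fun X => ?_)
    have h2 := (h X).2
    simp only [mul_one] at h2
    rw [integral_complex_ofReal] at h2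
    simp_rw [h0]
    exact (Complex.ofReal_injective h2).symm

theorem poissonConst_pos : 0 < poissonConst H := by
  refine inv_pos.2 ?_
  change 0 < ∫ n : v × z, poissonCore H 1 n ∂((volume : Measure v).prod volume)
  refine (integral_pos_iff_support_of_nonneg (fun n => (poissonCore_pos H one_pos n).le)
    (integrable_poissonCore H one_pos)).2 ?_
  exact (Measure.measure_univ_pos.2 (NeZero.ne ((volume : Measure v).prod
    (volume : Measure z)))).trans_le (measure_mono fun n _ => (poissonCore_pos H one_pos n).ne')

/-- Nonvanishing of the integral of the Poisson kernel against a product function. -/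
theorem integral_poissonKernel_mul_ne_zero {A : v → ℂ} {B : z → ℂ} {C C' ν : ℝ}
    (hAm : Measurable A) (hAC : ∀ X, ‖A X‖ ≤ C') (hBm : Measurable B) (hBC : ∀ Z, ‖B Z‖ ≤ C)
    (hν : 0 ≤ ν)
    (hB : ∀ s : ℝ, 0 < s → ∫ Z : z, (Real.exp (-(s * ‖Z‖ ^ 2)) : ℂ) * B Z =
      (((Real.pi / s) ^ ((Module.finrank ℝ z : ℝ) / 2) * Real.exp (-(ν ^ 2 / (4 * s))) : ℝ) : ℂ))
    {c : ℂ} {g : ℝ → ℝ} (hc : c ≠ 0) (hg : ∀ τ, ν < τ → 0 < g τ)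
    (hA : ∀ τ, ν < τ → ∫ X, A X * (Real.exp (-(τ * ‖X‖ ^ 2 / 4)) : ℂ) = c * g τ)
    {a : ℝ} (ha : 0 < a) :
    ∫ n : HTypeGroup H, (poissonKernel H a n : ℂ) * (A n.1 * B n.2) ≠ 0 := by
  obtain ⟨hm, hk⟩ := one_le_m_k H
  have hm' : (1 : ℝ) ≤ m H := by exact_mod_cast hm
  have hk' : (1 : ℝ) ≤ k H := by exact_mod_cast hk
  obtain ⟨K, hK, h⟩ := integral_poissonCore_fiber H hBm hBC hν hB ha
  have e : ∀ n : HTypeGroup H, (poissonKernel H a n : ℂ) * (A n.1 * B n.2) =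
      (poissonConst H : ℂ) * (A n.1 * ((poissonCore H a (n.1, n.2) : ℂ) * B n.2)) := by
    intro n
    change ((poissonConst H * poissonCore H a n : ℝ) : ℂ) * (A n.1 * B n.2) =
      (poissonConst H : ℂ) * (A n.1 * ((poissonCore H a n : ℂ) * B n.2))
    push_cast
    ring
  have hint : Integrable (fun n : v × z => A n.1 * ((poissonCore H a (n.1, n.2) : ℂ) * B n.2))
      ((volume : Measure v).prod volume) := by
    refine Integrable.bdd_mul (c := C') ?_ (hAm.comp measurable_fst).aestronglyMeasurable
      (Filter.Eventually.of_forall fun n => hAC n.1)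
    exact ((integrable_poissonCore H ha).ofReal (𝕜 := ℂ)).mul_bdd (c := C)
      (hBm.comp measurable_snd).aestronglyMeasurable
      (Filter.Eventually.of_forall fun n => hBC n.2)
  have key : ∫ n : HTypeGroup H, (poissonKernel H a n : ℂ) * (A n.1 * B n.2) =
      (poissonConst H : ℂ) * ∫ n : v × z, A n.1 * ((poissonCore H a (n.1, n.2) : ℂ) * B n.2)
        ∂((volume : Measure v).prod volume) := by
    refine Eq.trans ?_ (integral_const_mul _ _)
    exact integral_congr_ae (Filter.Eventually.of_forall e)
  rw [key, integral_prod _ hint]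
  refine mul_ne_zero (Complex.ofReal_ne_zero.2 (poissonConst_pos H).ne') ?_
  simp_rw [integral_const_mul, (h _).2]
  have e2 : ∀ (X : v) (r : ℝ), A X * ((K * r : ℝ) : ℂ) = (K : ℂ) * (A X * (r : ℂ)) := by
    intro X r
    push_cast
    ring
  simp_rw [e2]
  rw [integral_const_mul]
  exact mul_ne_zero (Complex.ofReal_ne_zero.2 hK.ne')
    (integral_mul_ne_zero_of_transform hAm hAC hν hc hg hA ha (by linarith)
      (by rw [finrank_div_two H]; linarith))

/-- The Gelfand transform of the Poisson kernel never vanishes. -/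
theorem gelfandSpectrum_poissonL1_ne_zero {a : ℝ} (ha : 0 < a)
    {ψ : biradialL1 H →ₗ[ℂ] ℂ} (hψ : ψ ∈ gelfandSpectrum H) : ψ (poissonL1 H ha) ≠ 0 := by
  obtain ⟨l, A, hAm, ⟨C, hC⟩, hf, c, g, hc, hg, hA⟩ := exists_product_density hψ
  -- The plane wave has the required Gaussian transform, with frequency |l|.
  have h := integral_poissonKernel_mul_ne_zero H (B := fun Z : z =>
    Complex.exp (Complex.I * (inner ℝ l Z : ℝ))) (C := 1) (ν := ‖l‖) hAm hC (by fun_prop)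
    (fun Z => by rw [mul_comm, Complex.norm_exp_ofReal_mul_I]) (norm_nonneg l) (fun s hs => by
      have h := integral_gaussian_linear hs Complex.I l
      rw [Complex.I_sq] at h
      push_cast
      simp_rw [← Complex.exp_add]
      refine h.trans ?_
      congr 2
      ring) hc hg hA ha
  rw [hf]
  refine fun h0 => h (Eq.trans ?_ h0)
  refine integral_congr_ae ?_
  filter_upwards [Integrable.coeFn_toL1 (integrable_poissonKernel H ha)] with n hn
  change _ = _ * ((integrable_poissonKernel H ha).toL1 _ : HTypeGroup H → ℂ) n
  rw [hn]
  ring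

end HTypeGroup

/-! ### Power series of the generalized Bessel functions -/

theorem integral_rpow_mul_one_sub_rpow {p q : ℝ} (hp : 0 < p) (hq : 0 < q) :
    IntegrableOn (fun u : ℝ => u ^ (p - 1) * (1 - u) ^ (q - 1)) (Set.Ioo 0 1) ∧
    ∫ u in Set.Ioo (0 : ℝ) 1, u ^ (p - 1) * (1 - u) ^ (q - 1) =
      Real.Gamma p * Real.Gamma q / Real.Gamma (p + q) := by
  have e : ∀ u ∈ Set.Ioo (0 : ℝ) 1, (u : ℂ) ^ ((p : ℂ) - 1) * (1 - (u : ℂ)) ^ ((q : ℂ) - 1) =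
      ((u ^ (p - 1) * (1 - u) ^ (q - 1) : ℝ) : ℂ) := by
    intro u hu
    rw [Complex.ofReal_mul, Complex.ofReal_cpow hu.1.le, Complex.ofReal_cpow (by linarith [hu.2])]
    push_cast
    rfl
  have h := Complex.betaIntegral_convergent (u := (p : ℂ)) (v := (q : ℂ)) (by simpa) (by simpa)
  rw [intervalIntegrable_iff_integrableOn_Ioo_of_le zero_le_one] at h
  refine ⟨?_, ?_⟩
  · refine (h.congr_fun e measurableSet_Ioo).re.congr (Filter.Eventually.of_forall fun u => ?_)
    exact Complex.ofReal_re _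
  · have hb := Complex.Gamma_mul_Gamma_eq_betaIntegral (s := (p : ℂ)) (t := (q : ℂ))
      (by simpa) (by simpa)
    rw [Complex.betaIntegral, intervalIntegral.integral_of_le zero_le_one,
      integral_Ioc_eq_integral_Ioo, setIntegral_congr_fun measurableSet_Ioo e,
      integral_complex_ofReal, ← Complex.ofReal_add, Complex.Gamma_ofReal, Complex.Gamma_ofReal,
      Complex.Gamma_ofReal] at hb
    rw [eq_div_iff (Real.Gamma_pos_of_pos (by linarith)).ne', mul_comm]
    exact_mod_cast hb.symm

theorem integral_pow_mul_one_sub_sq_rpow {q : ℝ} (hq : 0 < q) (j : ℕ) :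
    IntegrableOn (fun t : ℝ => t ^ (2 * j) * (1 - t ^ 2) ^ (q - 1)) (Set.Ioo 0 1) ∧
    ∫ t in Set.Ioo (0 : ℝ) 1, t ^ (2 * j) * (1 - t ^ 2) ^ (q - 1) =
      Real.Gamma (j + 1 / 2) * Real.Gamma q / (2 * Real.Gamma (j + 1 / 2 + q)) := by
  have hd : ∀ t ∈ Set.Ioo (0 : ℝ) 1,
      HasDerivWithinAt (fun t => t ^ 2) (2 * t) (Set.Ioo 0 1) t := by
    intro t _
    exact (((hasDerivAt_id t).fun_pow 2).congr_deriv (by simp)).hasDerivWithinAt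
  have hin : Set.InjOn (fun t : ℝ => t ^ 2) (Set.Ioo 0 1) := by
    intro x hx y hy hxy
    exact (pow_left_inj₀ hx.1.le hy.1.le two_ne_zero).1 hxy
  have him : (fun t : ℝ => t ^ 2) '' Set.Ioo 0 1 = Set.Ioo 0 1 := by
    ext u
    constructor
    · rintro ⟨t, ht, rfl⟩
      have h0 := ht.1
      have h1 := ht.2
      exact ⟨by positivity, by nlinarith⟩
    · intro hu
      refine ⟨Real.sqrt u, ⟨Real.sqrt_pos.2 hu.1, ?_⟩, Real.sq_sqrt hu.1.le⟩
      rw [Real.sqrt_lt' one_pos]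
      simpa using hu.2
  have he : ∀ t ∈ Set.Ioo (0 : ℝ) 1, |2 * t| • (1 / 2 *
      ((t ^ 2) ^ ((j : ℝ) + 1 / 2 - 1) * (1 - t ^ 2) ^ (q - 1))) =
      t ^ (2 * j) * (1 - t ^ 2) ^ (q - 1) := by
    intro t ht
    have h0 : 0 < t := ht.1
    have h1 : (t ^ 2) ^ ((j : ℝ) + 1 / 2 - 1) * t = t ^ (2 * j) := by
      rw [← Real.rpow_two, ← Real.rpow_mul h0.le, ← Real.rpow_natCast t (2 * j)]
      conv_lhs => rw [← Real.rpow_one t, ← Real.rpow_mul h0.le, ← Real.rpow_add h0]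
      congr 1
      push_cast
      ring
    rw [smul_eq_mul, abs_of_pos (by positivity), ← h1]
    ring
  obtain ⟨h1, h2⟩ := integral_rpow_mul_one_sub_rpow (p := (j : ℝ) + 1 / 2) (by positivity) hq
  have h3 := integral_image_eq_integral_abs_deriv_smul measurableSet_Ioo hd hin
    (fun u => 1 / 2 * (u ^ ((j : ℝ) + 1 / 2 - 1) * (1 - u) ^ (q - 1)))
  have h4 := (integrableOn_image_iff_integrableOn_abs_deriv_smul measurableSet_Ioo hd hin
    (fun u => 1 / 2 * (u ^ ((j : ℝ) + 1 / 2 - 1) * (1 - u) ^ (q - 1)))).1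
    (by rw [him]; exact Integrable.const_mul h1 _)
  refine ⟨h4.congr_fun he measurableSet_Ioo, ?_⟩
  rw [← setIntegral_congr_fun measurableSet_Ioo he, ← h3, him, integral_const_mul, h2]
  ring

/-- Legendre's duplication formula at j + 1/2. It converts the (2j)! of the cosine series into the
4^j j! of the Bessel series. -/
theorem Gamma_add_half_div_factorial (j : ℕ) :
    Real.Gamma (j + 1 / 2) / ((2 * j).factorial : ℝ) =
      Real.Gamma (1 / 2) / (4 ^ j * (j.factorial : ℝ)) := by
  have h := Real.Gamma_mul_Gamma_add_half ((j : ℝ) + 1 / 2)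
  have e1 : (j : ℝ) + 1 / 2 + 1 / 2 = (j : ℝ) + 1 := by ring
  have e2 : 2 * ((j : ℝ) + 1 / 2) = ((2 * j : ℕ) : ℝ) + 1 := by push_cast; ring
  have e3 : (2 : ℝ) ^ (1 - (((2 * j : ℕ) : ℝ) + 1)) = (4 ^ j)⁻¹ := by
    rw [show 1 - (((2 * j : ℕ) : ℝ) + 1) = -((2 * j : ℕ) : ℝ) by ring,
      Real.rpow_neg (by norm_num), Real.rpow_natCast, pow_mul]
    norm_num
  rw [e1, e2, e3, Real.Gamma_nat_eq_factorial, Real.Gamma_nat_eq_factorial] at h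
  have hf1 : ((2 * j).factorial : ℝ) ≠ 0 := by positivity
  have hf2 : (j.factorial : ℝ) ≠ 0 := by positivity
  rw [Real.Gamma_one_half_eq, div_eq_div_iff hf1 (by positivity)]
  generalize Real.Gamma ((j : ℝ) + 1 / 2) = G at h ⊢
  field_simp at h
  linear_combination h

namespace HTypeGroup

theorem genBessel_eq_integral {r : ℝ} (hr : -1 / 2 < r) (x : ℝ) :
    genBessel r x =
      ((Real.Gamma (r + 1) / (Real.Gamma (r + 1 / 2) * Real.Gamma (1 / 2)) *
        (2 * ∫ t in Set.Ioo (0 : ℝ) 1, Real.cos (x * t) * (1 - t ^ 2) ^ (r + 1 / 2 - 1)) : ℝ)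
          : ℂ) := by
  have hint := (integral_pow_mul_one_sub_sq_rpow (q := r + 1 / 2) (by linarith) 0).1
  simp only [mul_zero, pow_zero, one_mul] at hint
  let f : ℝ → ℂ := fun s => Complex.exp (Complex.I * x * s) *
    (((1 - s ^ 2) ^ (r + 1 / 2 - 1) : ℝ) : ℂ)
  have hf : IntervalIntegrable f volume 0 1 := by
    rw [intervalIntegrable_iff_integrableOn_Ioo_of_le zero_le_one]
    refine (hint.ofReal (𝕜 := ℂ)).bdd_mul (c := 1) (by fun_prop)
      (Filter.Eventually.of_forall fun s => ?_)
    rw [mul_assoc, ← Complex.ofReal_mul, mul_comm, Complex.norm_exp_ofReal_mul_I]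
  have hf' : IntervalIntegrable (fun s => f (-s)) volume 0 1 := by
    rw [intervalIntegrable_iff_integrableOn_Ioo_of_le zero_le_one]
    simp only [f]
    simp only [neg_sq]
    refine (hint.ofReal (𝕜 := ℂ)).bdd_mul (c := 1) (by fun_prop)
      (Filter.Eventually.of_forall fun s => ?_)
    rw [mul_assoc, ← Complex.ofReal_mul, mul_comm, Complex.norm_exp_ofReal_mul_I]
  have hfn : IntervalIntegrable f volume (-1) 0 := by
    have := (IntervalIntegrable.iff_comp_neg (f := fun s => f (-s)) (a := 0) (b := 1)).1 hf'
    simpa using this.symm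
  have key : ∫ s in (-1 : ℝ)..1, f s =
      ((2 * ∫ t in Set.Ioo (0 : ℝ) 1, Real.cos (x * t) * (1 - t ^ 2) ^ (r + 1 / 2 - 1) : ℝ)
        : ℂ) := by
    rw [← intervalIntegral.integral_add_adjacent_intervals hfn hf]
    have h1 := intervalIntegral.integral_comp_neg (a := 0) (b := 1) f
    rw [neg_zero] at h1
    rw [← h1, ← intervalIntegral.integral_add hf' hf,
      intervalIntegral.integral_of_le zero_le_one, integral_Ioc_eq_integral_Ioo,
      ← integral_const_mul, ← integral_complex_ofReal]
    refine integral_congr_ae (Filter.Eventually.of_forall fun s => ?_)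
    simp only [f, neg_sq]
    rw [← add_mul]
    push_cast
    rw [Complex.cos, ← mul_assoc]
    congr 1
    rw [mul_div_cancel₀ _ two_ne_zero, add_comm]
    congr 2 <;> ring
  have hne : r ≠ -1 / 2 := hr.ne'
  rw [genBessel, if_neg hne, show (2 * r + 1) / 2 = r + 1 / 2 by ring,
    show (2 * r - 1) / 2 = r + 1 / 2 - 1 by ring, Complex.ofReal_mul, ← key]

/-- The cosine is expanded and integrated term by term against the weight, each term being a Beta
integral; the absolute series is dominated by cosh |x| times the weight. -/
theorem hasSum_genBessel_real {r : ℝ} (hr : -1 / 2 < r) (x : ℝ) :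
    HasSum (fun j : ℕ => (-1) ^ j * (x ^ 2 / 4) ^ j * Real.Gamma (r + 1) /
        ((j.factorial : ℝ) * Real.Gamma (r + 1 + j)))
      (Real.Gamma (r + 1) / (Real.Gamma (r + 1 / 2) * Real.Gamma (1 / 2)) *
        (2 * ∫ t in Set.Ioo (0 : ℝ) 1, Real.cos (x * t) * (1 - t ^ 2) ^ (r + 1 / 2 - 1))) := by
  have hq : 0 < r + 1 / 2 := by linarith
  have hw := (integral_pow_mul_one_sub_sq_rpow hq 0).1
  simp only [mul_zero, pow_zero, one_mul] at hw
  have hmem := ae_restrict_mem (μ := (volume : Measure ℝ)) (s := Set.Ioo (0 : ℝ) 1)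
    measurableSet_Ioo
  have hsum := hasSum_integral_of_dominated_convergence
    (μ := (volume : Measure ℝ).restrict (Set.Ioo 0 1))
    (F := fun (j : ℕ) (t : ℝ) => (-1) ^ j * x ^ (2 * j) / ((2 * j).factorial : ℝ) *
      (t ^ (2 * j) * (1 - t ^ 2) ^ (r + 1 / 2 - 1)))
    (f := fun t => Real.cos (x * t) * (1 - t ^ 2) ^ (r + 1 / 2 - 1))
    (fun j t => |x| ^ (2 * j) / ((2 * j).factorial : ℝ) * (1 - t ^ 2) ^ (r + 1 / 2 - 1))
    (fun j => Measurable.aestronglyMeasurable (by fun_prop))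
    (fun j => by
      filter_upwards [hmem] with t ht
      have h0 : 0 < t := ht.1
      have h1 : 0 ≤ 1 - t ^ 2 := by nlinarith [ht.2]
      have h2 : t ^ (2 * j) ≤ 1 := pow_le_one₀ h0.le ht.2.le
      have h3 : 0 ≤ (1 - t ^ 2) ^ (r + 1 / 2 - 1) := by positivity
      rw [norm_mul, norm_div, norm_mul, norm_pow, norm_pow, norm_neg, norm_one, one_pow, one_mul,
        Real.norm_eq_abs, Real.norm_natCast, Real.norm_of_nonneg (by positivity)]
      gcongr
      exact mul_le_of_le_one_left h3 h2)
    (Filter.Eventually.of_forall fun t => (Real.hasSum_cosh |x|).summable.mul_right _)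
    (by
      simp_rw [tsum_mul_right]
      exact hw.const_mul _)
    (Filter.Eventually.of_forall fun t => by
      refine ((Real.hasSum_cos (x * t)).mul_right _).congr_fun ?_
      intro j
      simp only [mul_pow]
      ring)
  have hG1 := (Real.Gamma_pos_of_pos (show 0 < r + 1 by linarith)).ne'
  have hG2 := (Real.Gamma_pos_of_pos hq).ne'
  have hG3 := (Real.Gamma_pos_of_pos (show (0 : ℝ) < 1 / 2 by norm_num)).ne'
  refine ((hsum.mul_left 2).mul_left _).congr_fun fun j => ?_
  have hG4 := (Real.Gamma_pos_of_pos
    (add_pos_of_pos_of_nonneg (show 0 < r + 1 by linarith) (Nat.cast_nonneg j))).ne'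
  have hf1 : ((2 * j).factorial : ℝ) ≠ 0 := by positivity
  have hf2 : (j.factorial : ℝ) ≠ 0 := by positivity
  have h := Gamma_add_half_div_factorial j
  rw [div_eq_iff hf1] at h
  rw [integral_const_mul, (integral_pow_mul_one_sub_sq_rpow hq j).2, h,
    show (j : ℝ) + 1 / 2 + (r + 1 / 2) = r + 1 + j by ring, div_pow, ← pow_mul]
  generalize Real.Gamma (r + 1) = G1 at *
  generalize Real.Gamma (r + 1 / 2) = G2 at *
  generalize Real.Gamma (1 / 2) = G3 at *
  generalize Real.Gamma (r + 1 + j) = G4 at *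
  field_simp

/-- The power series of the generalized Bessel functions. -/
theorem hasSum_genBessel {r : ℝ} (hr : -1 / 2 ≤ r) (x : ℝ) :
    HasSum (fun j : ℕ => (((-1) ^ j * (x ^ 2 / 4) ^ j * Real.Gamma (r + 1) /
        ((j.factorial : ℝ) * Real.Gamma (r + 1 + j)) : ℝ) : ℂ)) (genBessel r x) := by
  rcases hr.eq_or_lt with rfl | hr
  · rw [genBessel, if_pos rfl]
    refine Complex.hasSum_ofReal.2 ((Real.hasSum_cos x).congr_fun fun j => ?_)
    have h := Gamma_add_half_div_factorial j
    have hf1 : ((2 * j).factorial : ℝ) ≠ 0 := by positivity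
    have hf2 : (j.factorial : ℝ) ≠ 0 := by positivity
    have hG3 := (Real.Gamma_pos_of_pos (show (0 : ℝ) < 1 / 2 by norm_num)).ne'
    rw [div_eq_iff hf1] at h
    rw [show (-1 : ℝ) / 2 + 1 = 1 / 2 by norm_num, add_comm (1 / 2 : ℝ), h, div_pow, ← pow_mul]
    generalize Real.Gamma (1 / 2) = G3 at *
    field_simp
  · rw [genBessel_eq_integral hr]
    exact Complex.hasSum_ofReal.2 (hasSum_genBessel_real hr x)

theorem measurable_genBessel {r : ℝ} (hr : -1 / 2 ≤ r) : Measurable (genBessel r) := by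
  have h : genBessel r = fun x => ∑' j : ℕ, (((-1) ^ j * (x ^ 2 / 4) ^ j * Real.Gamma (r + 1) /
      ((j.factorial : ℝ) * Real.Gamma (r + 1 + j)) : ℝ) : ℂ) :=
    funext fun x => (hasSum_genBessel hr x).tsum_eq.symm
  rw [h]
  exact Measurable.tsum fun j => by fun_prop

theorem exists_norm_genBessel_le (r : ℝ) : ∃ C, ∀ x, ‖genBessel r x‖ ≤ C := by
  by_cases hr : r = -1 / 2
  · refine ⟨1, fun x => ?_⟩
    rw [genBessel, if_pos hr, Complex.norm_real]
    exact Real.abs_cos_le_one x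
  · refine ⟨‖((Real.Gamma (r + 1) / (Real.Gamma ((2 * r + 1) / 2) * Real.Gamma (1 / 2)) : ℝ) : ℂ)‖ *
      ∫ s in (-1 : ℝ)..1, ‖(((1 - s ^ 2) ^ ((2 * r - 1) / 2) : ℝ) : ℂ)‖, fun x => ?_⟩
    rw [genBessel, if_neg hr, norm_mul]
    refine mul_le_mul_of_nonneg_left ?_ (norm_nonneg _)
    refine (intervalIntegral.norm_integral_le_integral_norm (by norm_num)).trans_eq ?_
    refine intervalIntegral.integral_congr fun s _ => ?_
    rw [norm_mul, mul_assoc, ← Complex.ofReal_mul, mul_comm Complex.I,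
      Complex.norm_exp_ofReal_mul_I, one_mul]

end HTypeGroup

/-! ### Gaussian integrals of Bessel and Laguerre functions -/

section

variable {E : Type*} [NormedAddCommGroup E] [InnerProductSpace ℝ E] [FiniteDimensional ℝ E]
  [MeasurableSpace E] [BorelSpace E]

/-- Even moments of a Gaussian. -/
theorem integral_norm_pow_mul_gaussian [Nontrivial E] {s : ℝ} (hs : 0 < s) (j : ℕ) :
    Integrable (fun Z : E => ‖Z‖ ^ (2 * j) * Real.exp (-(s * ‖Z‖ ^ 2))) ∧
    ∫ Z : E, ‖Z‖ ^ (2 * j) * Real.exp (-(s * ‖Z‖ ^ 2)) =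
      (Real.pi / s) ^ ((Module.finrank ℝ E : ℝ) / 2) *
        (Real.Gamma ((Module.finrank ℝ E : ℝ) / 2 + j) /
          (Real.Gamma ((Module.finrank ℝ E : ℝ) / 2) * s ^ j)) := by
  set n := Module.finrank ℝ E with hn
  have hn0 : 0 < n := Module.finrank_pos
  have hn1 : (1 : ℝ) ≤ n := by exact_mod_cast hn0
  have he : ∀ j : ℕ, ∀ y ∈ Set.Ioi (0 : ℝ),
      y ^ ((n : ℝ) - 1 + 2 * j) * Real.exp (-s * y ^ (2 : ℝ)) =
      y ^ (n - 1) • (y ^ (2 * j) * Real.exp (-(s * y ^ 2))) := by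
    intro j y hy
    rw [smul_eq_mul, ← mul_assoc, ← pow_add, ← Real.rpow_natCast, Real.rpow_two, neg_mul]
    push_cast [Nat.cast_sub hn0]
    rfl
  have hI : ∀ j : ℕ, ∫ y in Set.Ioi (0 : ℝ), y ^ (n - 1) • (y ^ (2 * j) *
      Real.exp (-(s * y ^ 2))) = s ^ (-((n : ℝ) / 2 + j)) * (1 / 2) * Real.Gamma ((n : ℝ) / 2 + j) := by
    intro j
    rw [← setIntegral_congr_fun measurableSet_Ioi (he j),
      integral_rpow_mul_exp_neg_mul_rpow two_pos
        (by have : (0 : ℝ) ≤ j := Nat.cast_nonneg j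
            linarith) hs]
    congr 3 <;> ring
  have hR := fun j : ℕ => integral_fun_norm_addHaar (volume : Measure E)
    (fun y => y ^ (2 * j) * Real.exp (-(s * y ^ 2)))
  simp only [← hn, hI] at hR
  -- The case j = 0 is the known Gaussian integral; comparing with it eliminates the volume of the
  -- unit ball from polar coordinates.
  have h0 := hR 0
  simp only [mul_zero, pow_zero, one_mul, Nat.cast_zero, add_zero] at h0
  rw [integral_gaussian_real hs, ← hn] at h0
  refine ⟨?_, ?_⟩
  · rw [integrable_fun_norm_addHaar (volume : Measure E)
      (f := fun y => y ^ (2 * j) * Real.exp (-(s * y ^ 2)))]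
    refine IntegrableOn.congr_fun ?_ (he j) measurableSet_Ioi
    exact integrableOn_rpow_mul_exp_neg_mul_rpow
      (by have : (0 : ℝ) ≤ j := Nat.cast_nonneg j
          linarith) two_pos hs
  · have hG := (Real.Gamma_pos_of_pos (show 0 < (n : ℝ) / 2 by positivity)).ne'
    have hsj : s ^ (-((n : ℝ) / 2 + j)) = s ^ (-((n : ℝ) / 2)) / s ^ j := by
      rw [neg_add, Real.rpow_add hs, Real.rpow_neg hs.le (j : ℝ), Real.rpow_natCast]
      exact (div_eq_mul_inv _ _).symm
    rw [hR j, h0, hsj]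
    simp only [nsmul_eq_mul, smul_eq_mul]
    field_simp

/-- Gaussian integrals of the generalized Bessel function attached to the dimension. -/
theorem integral_gaussian_mul_genBessel [Nontrivial E] {s : ℝ} (hs : 0 < s) (ν : ℝ) :
    ∫ Z : E, (Real.exp (-(s * ‖Z‖ ^ 2)) : ℂ) *
      HTypeGroup.genBessel (((Module.finrank ℝ E : ℝ) - 2) / 2) (ν * ‖Z‖) =
      (((Real.pi / s) ^ ((Module.finrank ℝ E : ℝ) / 2) * Real.exp (-(ν ^ 2 / (4 * s))) : ℝ) : ℂ) := by
  set n := Module.finrank ℝ E with hn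
  have hn0 : 0 < n := Module.finrank_pos
  have hn1 : (1 : ℝ) ≤ n := by exact_mod_cast hn0
  have hr : -1 / 2 ≤ ((n : ℝ) - 2) / 2 := by linarith
  have hr1 : ((n : ℝ) - 2) / 2 + 1 = (n : ℝ) / 2 := by ring
  have hG := Real.Gamma_pos_of_pos (show 0 < (n : ℝ) / 2 by positivity)
  have hGj : ∀ j : ℕ, 0 < Real.Gamma ((n : ℝ) / 2 + j) := fun j =>
    Real.Gamma_pos_of_pos (by positivity)
  let b : ℕ → ℝ := fun j => (ν ^ 2 / 4) ^ j * Real.Gamma ((n : ℝ) / 2) /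
    ((j.factorial : ℝ) * Real.Gamma ((n : ℝ) / 2 + j))
  have hb : ∀ j, 0 ≤ b j := fun j => by
    have := hGj j
    positivity
  let F : ℕ → E → ℝ := fun j Z => (-1) ^ j * b j * (‖Z‖ ^ (2 * j) * Real.exp (-(s * ‖Z‖ ^ 2)))
  have hFi : ∀ j, Integrable (F j) := fun j =>
    (integral_norm_pow_mul_gaussian hs j).1.const_mul _
  -- The factor Γ(n/2 + j) of the moment cancels the one in the Bessel coefficient, which leaves the
  -- terms of an exponential series.
  have hval : ∀ j, b j * ∫ Z : E, ‖Z‖ ^ (2 * j) * Real.exp (-(s * ‖Z‖ ^ 2)) =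
      (Real.pi / s) ^ ((n : ℝ) / 2) * ((ν ^ 2 / (4 * s)) ^ j / (j.factorial : ℝ)) := by
    intro j
    have h1 := (hGj j).ne'
    have h2 : (j.factorial : ℝ) ≠ 0 := by positivity
    rw [(integral_norm_pow_mul_gaussian hs j).2, ← hn]
    simp only [b]
    rw [show ν ^ 2 / (4 * s) = ν ^ 2 / 4 / s by field_simp, div_pow _ s]
    generalize Real.Gamma ((n : ℝ) / 2) = G1 at *
    generalize Real.Gamma ((n : ℝ) / 2 + j) = G2 at *
    field_simp
  have hnorm : ∀ j, ∫ Z : E, ‖F j Z‖ =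
      (Real.pi / s) ^ ((n : ℝ) / 2) * ((ν ^ 2 / (4 * s)) ^ j / (j.factorial : ℝ)) := by
    intro j
    rw [← hval, ← integral_const_mul]
    refine integral_congr_ae (Filter.Eventually.of_forall fun Z => ?_)
    simp only [F]
    rw [norm_mul, norm_mul, norm_pow, norm_neg, norm_one, one_pow, one_mul,
      Real.norm_of_nonneg (hb j), Real.norm_of_nonneg (by positivity)]
  have hsum := hasSum_integral_of_summable_integral_norm hFi (by
    simp_rw [hnorm]
    exact (Real.summable_pow_div_factorial _).mul_left _)
  have hF : ∀ Z : E, (Real.exp (-(s * ‖Z‖ ^ 2)) : ℂ) *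
      HTypeGroup.genBessel (((n : ℝ) - 2) / 2) (ν * ‖Z‖) = ((∑' j, F j Z : ℝ) : ℂ) := by
    intro Z
    have h := (HTypeGroup.hasSum_genBessel hr (ν * ‖Z‖)).mul_left
      (Real.exp (-(s * ‖Z‖ ^ 2)) : ℂ)
    rw [← h.tsum_eq, Complex.ofReal_tsum]
    refine tsum_congr fun j => ?_
    rw [← Complex.ofReal_mul]
    congr 1
    simp only [F, b, hr1]
    rw [show (ν * ‖Z‖) ^ 2 / 4 = ν ^ 2 / 4 * ‖Z‖ ^ 2 by ring, mul_pow (ν ^ 2 / 4), ← pow_mul]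
    ring
  simp_rw [hF]
  rw [integral_complex_ofReal, ← hsum.tsum_eq]
  congr 1
  have hexp := (NormedSpace.expSeries_div_hasSum_exp (𝔸 := ℝ) (-(ν ^ 2 / (4 * s)))).mul_left
    ((Real.pi / s) ^ ((n : ℝ) / 2))
  rw [← Real.exp_eq_exp_ℝ] at hexp
  rw [← hexp.tsum_eq]
  refine tsum_congr fun j => ?_
  simp only [F]
  rw [integral_const_mul, mul_assoc, hval j, neg_pow (ν ^ 2 / (4 * s))]
  ring

end

namespace HTypeGroup

theorem exists_abs_exp_mul_laguerre_le (α l : ℕ) :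
    ∃ C, ∀ y : ℝ, 0 ≤ y → |Real.exp (-y) * laguerre α l (2 * y)| ≤ C := by
  refine ⟨∑ j ∈ Finset.range (l + 1), ((l + α).choose (l - j) : ℝ) * 2 ^ j, fun y hy => ?_⟩
  rw [laguerre, Finset.mul_sum]
  refine (Finset.abs_sum_le_sum_abs _ _).trans (Finset.sum_le_sum fun j _ => ?_)
  have h := Real.pow_div_factorial_le_exp y hy j
  rw [abs_mul, abs_div, abs_mul, abs_pow, abs_neg, Nat.abs_cast, Nat.abs_cast, Real.abs_exp,
    abs_of_nonneg (by positivity : 0 ≤ 2 * y), mul_pow, Real.exp_neg]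
  calc (Real.exp y)⁻¹ * (((l + α).choose (l - j) : ℝ) * (2 ^ j * y ^ j) / (j.factorial : ℝ))
      = (Real.exp y)⁻¹ * (y ^ j / (j.factorial : ℝ)) *
        (((l + α).choose (l - j) : ℝ) * 2 ^ j) := by ring
    _ ≤ (Real.exp y)⁻¹ * Real.exp y * (((l + α).choose (l - j) : ℝ) * 2 ^ j) := by gcongr
    _ = _ := by rw [inv_mul_cancel₀ (Real.exp_pos y).ne', one_mul]

/-- Laguerre coefficient times Gaussian moment is a binomial coefficient of l, up to a factor free
of j. This sums the Gaussian transform of L_l to an l-th power. -/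
theorem choose_mul_Gamma_div (m l j : ℕ) (hj : j ≤ l) (hm : 1 ≤ m) :
    ((l + (m - 1)).choose (l - j) : ℝ) *
      (Real.Gamma (m + j) / (Real.Gamma m * (j.factorial : ℝ))) =
      ((l + (m - 1)).choose l : ℝ) * (l.choose j : ℝ) := by
  obtain ⟨p, rfl⟩ : ∃ p, m = p + 1 := ⟨m - 1, by omega⟩
  have e : ((p + 1 : ℕ) : ℝ) + j = ((p + j : ℕ) : ℝ) + 1 := by push_cast; ring
  have e' : ((p + 1 : ℕ) : ℝ) = (p : ℝ) + 1 := by push_cast; ring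
  rw [e, e', Real.Gamma_nat_eq_factorial, Real.Gamma_nat_eq_factorial, Nat.add_sub_cancel,
    Nat.cast_choose ℝ (show l - j ≤ l + p by omega), Nat.cast_choose ℝ (show l ≤ l + p by omega),
    Nat.cast_choose ℝ hj, show l + p - (l - j) = p + j by omega, Nat.add_sub_cancel_left]
  field_simp

/-- The Gaussian integral of a Laguerre polynomial. -/
theorem integral_gaussian_mul_laguerre {E : Type*} [NormedAddCommGroup E] [InnerProductSpace ℝ E]
    [FiniteDimensional ℝ E] [MeasurableSpace E] [BorelSpace E] {m : ℕ} (hm : 1 ≤ m)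
    (hE : Module.finrank ℝ E = 2 * m) (l : ℕ) {s : ℝ} (hs : 0 < s) (t : ℝ) :
    ∫ X : E, Real.exp (-(s * ‖X‖ ^ 2)) * laguerre (m - 1) l (t * ‖X‖ ^ 2) =
      (Real.pi / s) ^ (m : ℝ) * (((l + (m - 1)).choose l : ℝ) * (1 - t / s) ^ l) := by
  have : Nontrivial E := Module.nontrivial_of_finrank_pos (R := ℝ) (by omega)
  have hE2 : (Module.finrank ℝ E : ℝ) / 2 = m := by
    rw [hE]
    push_cast
    ring
  have e : ∀ X : E, Real.exp (-(s * ‖X‖ ^ 2)) * laguerre (m - 1) l (t * ‖X‖ ^ 2) =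
      ∑ j ∈ Finset.range (l + 1), ((l + (m - 1)).choose (l - j) : ℝ) * (-t) ^ j /
        (j.factorial : ℝ) * (‖X‖ ^ (2 * j) * Real.exp (-(s * ‖X‖ ^ 2))) := by
    intro X
    rw [laguerre, Finset.mul_sum]
    refine Finset.sum_congr rfl fun j _ => ?_
    rw [← neg_mul t, mul_pow, ← pow_mul]
    ring
  simp_rw [e]
  rw [integral_finsetSum _ fun j _ => (integral_norm_pow_mul_gaussian hs j).1.const_mul _,
    sub_eq_neg_add, add_pow, Finset.mul_sum, Finset.mul_sum]
  refine Finset.sum_congr rfl fun j hj => ?_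
  have hj' : j ≤ l := Nat.lt_succ_iff.1 (Finset.mem_range.1 hj)
  have h := choose_mul_Gamma_div m l j hj' hm
  rw [integral_const_mul, (integral_norm_pow_mul_gaussian hs j).2, hE2, one_pow, mul_one,
    ← neg_div, div_pow]
  calc _ = (Real.pi / s) ^ (m : ℝ) * ((-t) ^ j / s ^ j) *
        (((l + (m - 1)).choose (l - j) : ℝ) *
          (Real.Gamma (m + j) / (Real.Gamma m * (j.factorial : ℝ)))) := by
        field_simp
    _ = _ := by rw [h]; ring

end HTypeGroup

/-! ### The bounded spherical functions -/

namespace HTypeGroup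

variable {v z : Type*} [NormedAddCommGroup v] [InnerProductSpace ℝ v]
  [FiniteDimensional ℝ v] [MeasurableSpace v] [BorelSpace v]
  [NormedAddCommGroup z] [InnerProductSpace ℝ z]
  [FiniteDimensional ℝ z] [MeasurableSpace z] [BorelSpace z] (H : HTypeAlgebra v z)

theorem measurable_laguerre (α l : ℕ) : Measurable (laguerre α l) := by
  unfold laguerre
  fun_prop

/-- The factor e^{-ν|X|²/4} shifts τ to τ + ν, so the Laguerre integral is taken at s = (τ+ν)/4, t =
ν/2, where 1 - t/s = (τ-ν)/(τ+ν). This is positive exactly in the range τ > ν selected by the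
Laplace representation. -/
theorem integral_poissonKernel_mul_sphericalLaguerre_ne_zero {a ν : ℝ} (ha : 0 < a) (hν : 0 < ν)
    (l : ℕ) :
    ∫ n : HTypeGroup H, (poissonKernel H a n : ℂ) * sphericalLaguerre H ν l n ≠ 0 := by
  obtain ⟨hm, hk⟩ := one_le_m_k H
  have hpi := Real.pi_pos
  have : Nontrivial z := Module.nontrivial_of_finrank_pos (R := ℝ) (show 0 < k H by omega)
  have hk' : (1 : ℝ) ≤ k H := by exact_mod_cast hk
  have hr : -1 / 2 ≤ ((k H : ℝ) - 2) / 2 := by linarith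
  obtain ⟨C, hC⟩ := exists_norm_genBessel_le (((k H : ℝ) - 2) / 2)
  obtain ⟨C', hC'⟩ := exists_abs_exp_mul_laguerre_le (m H - 1) l
  have hbin : 0 < ((l + (m H - 1)).choose l : ℝ) := by
    exact_mod_cast Nat.choose_pos (Nat.le_add_right _ _)
  have hlag := measurable_laguerre (m H - 1) l
  have hgb := measurable_genBessel hr
  refine integral_poissonKernel_mul_ne_zero H (ν := ν) (C := C)
    (C' := C' / ((l + (m H - 1)).choose l : ℝ))
    (A := fun X => ((Real.exp (-(ν * ‖X‖ ^ 2 / 4)) * laguerre (m H - 1) l (ν * ‖X‖ ^ 2 / 2) /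
      ((l + (m H - 1)).choose l : ℝ) : ℝ) : ℂ))
    (B := fun Z => genBessel (((k H : ℝ) - 2) / 2) (ν * ‖Z‖))
    (c := 1) (g := fun τ => (Real.pi / ((τ + ν) / 4)) ^ (m H : ℝ) * ((τ - ν) / (τ + ν)) ^ l)
    ?_ ?_ ?_ (fun Z => hC _) hν.le (fun s hs => integral_gaussian_mul_genBessel hs ν) one_ne_zero
    ?_ ?_ ha
  · fun_prop
  · intro X
    rw [Complex.norm_real, Real.norm_eq_abs, abs_div, abs_of_pos hbin]
    have h := hC' (ν * ‖X‖ ^ 2 / 4) (by positivity)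
    rw [show 2 * (ν * ‖X‖ ^ 2 / 4) = ν * ‖X‖ ^ 2 / 2 by ring] at h
    gcongr
  · fun_prop
  · intro τ hτ
    have h1 : 0 < τ - ν := by linarith
    have h2 : 0 < τ + ν := by linarith
    positivity
  · intro τ hτ
    have h2 : 0 < τ + ν := by linarith
    have h := integral_gaussian_mul_laguerre (E := v) hm (HTypeAlgebra.finrank_eq H) l
      (s := (τ + ν) / 4) (by positivity) (ν / 2)
    have e : ∀ X : v, ((Real.exp (-(ν * ‖X‖ ^ 2 / 4)) * laguerre (m H - 1) l (ν * ‖X‖ ^ 2 / 2) /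
        ((l + (m H - 1)).choose l : ℝ) : ℝ) : ℂ) * (Real.exp (-(τ * ‖X‖ ^ 2 / 4)) : ℂ) =
        (((((l + (m H - 1)).choose l : ℝ))⁻¹ * (Real.exp (-((τ + ν) / 4 * ‖X‖ ^ 2)) *
          laguerre (m H - 1) l (ν / 2 * ‖X‖ ^ 2)) : ℝ) : ℂ) := by
      intro X
      rw [← Complex.ofReal_mul, show -((τ + ν) / 4 * ‖X‖ ^ 2) =
        -(ν * ‖X‖ ^ 2 / 4) + -(τ * ‖X‖ ^ 2 / 4) by ring, Real.exp_add,
        show ν / 2 * ‖X‖ ^ 2 = ν * ‖X‖ ^ 2 / 2 by ring]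
      congr 1
      ring
    simp_rw [e]
    rw [integral_complex_ofReal, integral_const_mul, h, one_mul,
      show 1 - ν / 2 / ((τ + ν) / 4) = (τ - ν) / (τ + ν) by field_simp; ring]
    congr 1
    field_simp

/-- Here the central factor is B = 1, of frequency ν = 0, and the Gaussian transform of the Bessel
factor is positive for every τ > 0. -/
theorem integral_poissonKernel_mul_sphericalBessel_ne_zero {a : ℝ} (ha : 0 < a) (μ : ℝ) :
    ∫ n : HTypeGroup H, (poissonKernel H a n : ℂ) * sphericalBessel H μ n ≠ 0 := by
  obtain ⟨hm, hk⟩ := one_le_m_k H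
  have hpi := Real.pi_pos
  have hv := HTypeAlgebra.finrank_eq H
  have : Nontrivial v := Module.nontrivial_of_finrank_pos (R := ℝ) (by omega)
  have hm' : (1 : ℝ) ≤ m H := by exact_mod_cast hm
  have hr : -1 / 2 ≤ (m H : ℝ) - 1 := by linarith
  obtain ⟨C, hC⟩ := exists_norm_genBessel_le ((m H : ℝ) - 1)
  have hgb := measurable_genBessel hr
  have key := integral_poissonKernel_mul_ne_zero H (ν := 0) (C := 1) (C' := C)
    (A := fun X => genBessel ((m H : ℝ) - 1) (μ * ‖X‖)) (B := fun _ => 1)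
    (c := 1) (g := fun τ => (Real.pi / (τ / 4)) ^ ((Module.finrank ℝ v : ℝ) / 2) *
      Real.exp (-(μ ^ 2 / (4 * (τ / 4)))))
    (by fun_prop) (fun X => hC _) measurable_const (by simp) le_rfl
    (fun s hs => by
      simp only [mul_one]
      rw [integral_complex_ofReal, integral_gaussian_real hs]
      simp) one_ne_zero
    (fun τ hτ => by positivity)
    (fun τ hτ => by
      have h := integral_gaussian_mul_genBessel (E := v) (s := τ / 4) (by positivity) μ
      rw [show ((Module.finrank ℝ v : ℝ) - 2) / 2 = (m H : ℝ) - 1 by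
        rw [← finrank_div_two H]; ring] at h
      rw [one_mul, ← h]
      refine integral_congr_ae (Filter.Eventually.of_forall fun X => ?_)
      simp only
      rw [mul_comm, show τ / 4 * ‖X‖ ^ 2 = τ * ‖X‖ ^ 2 / 4 by ring]) ha
  simp only [mul_one] at key
  exact key

end HTypeGroup

theorem proposition4p4 {v z : Type*}
    [NormedAddCommGroup v] [InnerProductSpace ℝ v] [FiniteDimensional ℝ v]
    [MeasurableSpace v] [BorelSpace v]
    [NormedAddCommGroup z] [InnerProductSpace ℝ z] [FiniteDimensional ℝ z]
    [MeasurableSpace z] [BorelSpace z]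
    (H : HTypeAlgebra v z) (a : ℝ) (ha : 0 < a) :
    (∀ ψ ∈ HTypeGroup.gelfandSpectrum H, ψ (HTypeGroup.poissonL1 H ha) ≠ 0) ∧
    (∀ ν : ℝ, 0 < ν → ∀ l : ℕ,
      (∫ n : HTypeGroup H, (HTypeGroup.poissonKernel H a n : ℂ) *
        HTypeGroup.sphericalLaguerre H ν l n) ≠ 0) ∧
    (∀ μ : ℝ, 0 ≤ μ →
      (∫ n : HTypeGroup H, (HTypeGroup.poissonKernel H a n : ℂ) *
        HTypeGroup.sphericalBessel H μ n) ≠ 0) :=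
  ⟨fun _ hψ => HTypeGroup.gelfandSpectrum_poissonL1_ne_zero H ha hψ,
    fun _ hν l => HTypeGroup.integral_poissonKernel_mul_sphericalLaguerre_ne_zero H ha hν l,
    fun μ _ => HTypeGroup.integral_poissonKernel_mul_sphericalBessel_ne_zero H ha μ⟩
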